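/- **Theorem 2.1 (Carleman estimate for Biot's system).** Let $\Omega\subset\mathbb R^3$ be a non-empty bounded open set, $x_0\in\mathbb R^3\setminus\overline\Omega$, and let $\varrho_{11},\varrho_{12},\varrho_{22},\mu,\lambda,\mathrm q,\mathrm r\in C^2(\overline\Omega)$ be real-valued with, on $\overline\Omega$, $$\mu,\ \lambda+\mu,\ \mathrm q,\ \mathrm r,\ \varrho_{11},\ \varrho_{22}>0,\qquad \varrho:=\varrho_{11}\varrho_{22}-\varrho_{12}^2>0,\qquad \lambda\mathrm r-\mathrm q^2>0 .$$ Put $\mu_1=\varrho^{-1}\varrho_{22}\,\mu$, and suppose that for every $x\in\overline\Omega$ the matrix $$A(x)=\frac1\varrho\begin{pmatrix}\varrho_{22}&-\varrho_{12}\\-\varrho_{12}&\varrho_{11}\end{pmatrix}\begin{pmatrix}2\mu+\lambda&\mathrm q\\ \mathrm q&\mathrm r\end{pmatrix}$$ has two distinct eigenvalues $\mu_2(x)\neq\mu_3(x)$. Let $m>0$, $\theta\in(0,1)$ and $c_1^*,c_2^*,c_3^*>0$ be such that for $j=1,2,3$ $$\mu_j\in C^2(\overline\Omega),\quad \mu_j>c_j^*\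 \text{on }\overline\Omega,\quad \|\mu_j\|_{C^2(\overline\Omega)}\le m,\quad \frac{\nabla\mu_j\cdot(x-x_0)}{2\mu_j}\le 1-\theta ,$$ where $\|c\|_{C^2(\overline\Omega)}=\max_{k\le 2}\sup_\Omega|D^kc|$ (operator norms), and let $c_0^*=\min\{c_1^*,c_2^*,c_3^*\}$. Let $$D^2=\max_{x\in\overline\Omega}|x-x_0|^2,\quad d^2=\min_{x\in\overline\Omega}|x-x_0|^2,\quad D_0=\sqrt{D^2-d^2},$$ let $\beta>0$ satisfy $$\beta+\frac{mD_0}{\sqrt{c_0^*}}\sqrt\beta<\theta c_0^*,\qquad c_0^*d^2-\beta D^2>0,$$ and let $T>T_0:=D_0/\sqrt\beta$, $\gamma>0$, $Q=\Omega\times(-T,T)$, $\varphi(x,t)=e^{\gamma(|x-x_0|^2-\beta t^2)}$. Let $K\subset Q$ be compact with $$\beta+\frac{m}{\sqrt{c_0^*}}\,\beta|t|<\theta c_0^*\qquad\text{for all }(x,t)\in K$$ (this holds for every compact $K\subset\Omega\times[-T_0,T_0]$, and for every compact $K\subset Q$ if $T$ is sufficiently close to $T_0$). Then there exist $\tau_*>0$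 and $C>0$ such that $$\int_Q\tau\left(|\nabla_{x,t}\mathbf u^s|^2+|\nabla_{x,t}(\mathrm{div}\,\mathbf u^s)|^2+|\nabla_{x,t}(\mathrm{div}\,\mathbf u^f)|^2\right)e^{2\tau\varphi}\,dx\,dt+\int_Q\tau^3\left(|\mathbf u^s|^2+|\mathrm{div}\,\mathbf u^s|^2+|\mathrm{div}\,\mathbf u^f|^2\right)e^{2\tau\varphi}\,dx\,dt\le C\int_Q\left(|F|^2+|\nabla F|^2\right)e^{2\tau\varphi}\,dx\,dt$$ for every $\tau\ge\tau_*$ and all real $\mathbf u^s,\mathbf u^f\in (H^2(Q))^3$ that vanish almost everywhere outside $K$ and satisfy, almost everywhere in $Q$, $$\varrho_{11}\partial_t^2\mathbf u^s+\varrho_{12}\partial_t^2\mathbf u^f-\Delta_{\mu,\lambda}\mathbf u^s-\nabla(\mathrm q\,\mathrm{div}\,\mathbf u^f)=F_1,\qquad \varrho_{12}\partial_t^2\mathbf u^s+\varrho_{22}\partial_t^2\mathbf u^f-\nabla(\mathrm q\,\mathrm{div}\,\mathbf u^s)-\nabla(\mathrm r\,\mathrm{div}\,\mathbf u^f)=F_2,$$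 where $F=(F_1,F_2)$ has components in $L^2(Q)$ with weak spatial gradient in $L^2(Q)$. Here $\nabla$, $\mathrm{div}$ and $\Delta$ act in $x$ only, and $$\Delta_{\mu,\lambda}\mathbf v=\mu\Delta\mathbf v+(\mu+\lambda)\nabla\mathrm{div}\,\mathbf v+(\mathrm{div}\,\mathbf v)\nabla\lambda+\left(\nabla\mathbf v+(\nabla\mathbf v)^T\right)\nabla\mu .$$ -/

import Mathlib

open MeasureTheory Set

noncomputable section

namespace Biot

/-- The space of points `x = (x₁, x₂, x₃)`, with the Euclidean norm. -/
abbrev Space := EuclideanSpace ℝ (Fin 3)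

/-- The space of points `z = (x, t)`, with Lebesgue measure. -/
abbrev Spacetime := EuclideanSpace ℝ (Fin 3) × ℝ

/-- The space-time cylinder `Q = Ω × (-T, T)`. -/
def cylinder (Ω : Set Space) (T : ℝ) : Set Spacetime := Ω ×ˢ Ioo (-T) T

/-! ### Sobolev functions on an open set of space-time -/

/-- The coordinate directions of space-time: `0, 1, 2` are the spatial ones, `3` is time. -/
def dir (a : Fin 4) : Spacetime :=
  Fin.lastCases (motive := fun _ => Spacetime) (0, 1)
    (fun i => (EuclideanSpace.single i 1, 0)) a

/-- The index of the spatial direction `xᵢ`. -/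
abbrev sp (i : Fin 3) : Fin 4 := i.castSucc

/-- The index of the time direction. -/
abbrev tm : Fin 4 := Fin.last 3

/-- `g` is the weak partial derivative of `f` on `Q` in the direction with index `a`. -/
def IsWeakPartial (Q : Set Spacetime) (a : Fin 4) (f g : Spacetime → ℝ) : Prop :=
  ∀ η : Spacetime → ℝ, ContDiff ℝ (⊤ : ℕ∞) η → HasCompactSupport η → tsupport η ⊆ Q →
    ∫ z in Q, f z * fderiv ℝ η z (dir a) = - ∫ z in Q, g z * η z

/-- An element of `H²(Q)`: a function of `L²(Q)` together with its first and second weak partial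
derivatives, all of them in `L²(Q)`. Here `dd a b` is the derivative `∂_b ∂_a`. -/
structure SobolevH2 (Q : Set Spacetime) where
  val : Spacetime → ℝ
  d : Fin 4 → Spacetime → ℝ
  dd : Fin 4 → Fin 4 → Spacetime → ℝ
  memLp_val : MemLp val 2 (volume.restrict Q)
  memLp_d : ∀ a, MemLp (d a) 2 (volume.restrict Q)
  memLp_dd : ∀ a b, MemLp (dd a b) 2 (volume.restrict Q)
  weak_d : ∀ a, IsWeakPartial Q a val (d a)
  weak_dd : ∀ a b, IsWeakPartial Q b (d a) (dd a b)

/-- A function of `L²(Q)` whose weak spatial gradient is in `L²(Q)`,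
together with this gradient. -/
structure SpatialH1 (Q : Set Spacetime) where
  val : Spacetime → ℝ
  d : Fin 3 → Spacetime → ℝ
  memLp_val : MemLp val 2 (volume.restrict Q)
  memLp_d : ∀ i, MemLp (d i) 2 (volume.restrict Q)
  weak_d : ∀ i, IsWeakPartial Q (sp i) val (d i)

/-! ### Vector fields with components in `H²(Q)`: `u i` is the `i`-th component -/

section VectorFields

variable {Q : Set Spacetime}

/-- The spatial divergence `div u`. -/
def div (u : Fin 3 → SobolevH2 Q) (z : Spacetime) : ℝ := ∑ j, (u j).d (sp j) z

/-- The derivative of `div u` in the space-time direction `a`. -/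
def dDiv (u : Fin 3 → SobolevH2 Q) (a : Fin 4) (z : Spacetime) : ℝ := ∑ j, (u j).dd (sp j) a z

/-- The `i`-th component of the spatial Laplacian `Δ u`. -/
def lapl (u : Fin 3 → SobolevH2 Q) (i : Fin 3) (z : Spacetime) : ℝ :=
  ∑ j, (u i).dd (sp j) (sp j) z

/-- `|u|²`. -/
def normSq (u : Fin 3 → SobolevH2 Q) (z : Spacetime) : ℝ := ∑ i, (u i).val z ^ 2

/-- `|∇_{x,t} u|²`. -/
def gradSq (u : Fin 3 → SobolevH2 Q) (z : Spacetime) : ℝ := ∑ i, ∑ a, (u i).d a z ^ 2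

/-- `|∇_{x,t} (div u)|²`. -/
def gradDivSq (u : Fin 3 → SobolevH2 Q) (z : Spacetime) : ℝ := ∑ a, dDiv u a z ^ 2

/-- `|G|²` for a source term `G`. -/
def sourceSq (G : Fin 3 → SpatialH1 Q) (z : Spacetime) : ℝ := ∑ i, (G i).val z ^ 2

/-- `|∇ G|²` for a source term `G` (spatial gradient). -/
def gradSourceSq (G : Fin 3 → SpatialH1 Q) (z : Spacetime) : ℝ := ∑ i, ∑ j, (G i).d j z ^ 2

/-- The classical partial derivative `∂ᵢ c` of a coefficient. -/
def pd (c : Space → ℝ) (i : Fin 3) (x : Space) : ℝ := fderiv ℝ c x (EuclideanSpace.single i 1)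

/-- The `i`-th component of `∇ (c div u) = c ∇ (div u) + (div u) ∇ c`, for a coefficient
`c = c(x)` of class `C²`. -/
def gradMulDiv (c : Space → ℝ) (u : Fin 3 → SobolevH2 Q) (i : Fin 3) (z : Spacetime) : ℝ :=
  c z.1 * dDiv u (sp i) z + div u z * pd c i z.1

/-- The `i`-th component of
`Δ_{μ,λ} v = μ Δv + (μ + λ) ∇(div v) + (div v) ∇λ + (∇v + (∇v)ᵀ) ∇μ`. -/
def lame (μ lam : Space → ℝ) (v : Fin 3 → SobolevH2 Q) (i : Fin 3) (z : Spacetime) : ℝ :=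
  μ z.1 * lapl v i z + (μ z.1 + lam z.1) * dDiv v (sp i) z + div v z * pd lam i z.1
    + ∑ j, ((v i).d (sp j) z + (v j).d (sp i) z) * pd μ j z.1

end VectorFields

/-! ### Coefficients -/

/-- The class `C²(Ω̄)`, for an open set `Ω`: twice continuously differentiable functions on `Ω`
which extend continuously, with their derivatives of order at most two, to the closure. -/
def IsC2Closure (Ω : Set Space) (c : Space → ℝ) : Prop :=
  ContDiffOn ℝ 2 c Ω ∧ ContinuousOn c (closure Ω) ∧
    ∀ k : ℕ, k ≤ 2 → ∃ g : Space → ContinuousMultilinearMap ℝ (fun _ : Fin k => Space) ℝ,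
      ContinuousOn g (closure Ω) ∧ EqOn g (iteratedFDeriv ℝ k c) Ω

/-- The class `𝒞(m, θ)` of scalar coefficients, with the lower bound `cstar` made explicit;
the norm of `C²(Ω̄)` is the maximum of the sup norms of the derivatives of order `0, 1, 2`. -/
structure SpeedClass (Ω : Set Space) (x₀ : Space) (m θ cstar : ℝ) (c : Space → ℝ) : Prop where
  isC2 : IsC2Closure Ω c
  lower : ∀ x ∈ closure Ω, cstar < c x
  norm_le : ∀ k : ℕ, k ≤ 2 → ∀ x ∈ Ω, ‖iteratedFDeriv ℝ k c x‖ ≤ m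
  radial : ∀ x ∈ Ω, fderiv ℝ c x (x - x₀) / (2 * c x) ≤ 1 - θ

/-- The coefficients of Biot's system. -/
structure Coeffs where
  rho11 : Space → ℝ
  rho12 : Space → ℝ
  rho22 : Space → ℝ
  mu : Space → ℝ
  lam : Space → ℝ
  q : Space → ℝ
  r : Space → ℝ

/-- `ϱ = ϱ₁₁ ϱ₂₂ - ϱ₁₂²`. -/
def Coeffs.rho (P : Coeffs) (x : Space) : ℝ := P.rho11 x * P.rho22 x - P.rho12 x ^ 2

/-- Regularity of the coefficients and their sign conditions on the closure of `Ω`. -/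
structure Coeffs.Admissible (P : Coeffs) (Ω : Set Space) : Prop where
  rho11_C2 : IsC2Closure Ω P.rho11
  rho12_C2 : IsC2Closure Ω P.rho12
  rho22_C2 : IsC2Closure Ω P.rho22
  mu_C2 : IsC2Closure Ω P.mu
  lam_C2 : IsC2Closure Ω P.lam
  q_C2 : IsC2Closure Ω P.q
  r_C2 : IsC2Closure Ω P.r
  mu_pos : ∀ x ∈ closure Ω, 0 < P.mu x
  lam_add_mu_pos : ∀ x ∈ closure Ω, 0 < P.lam x + P.mu x
  q_pos : ∀ x ∈ closure Ω, 0 < P.q x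
  r_pos : ∀ x ∈ closure Ω, 0 < P.r x
  rho11_pos : ∀ x ∈ closure Ω, 0 < P.rho11 x
  rho22_pos : ∀ x ∈ closure Ω, 0 < P.rho22 x
  rho_pos : ∀ x ∈ closure Ω, 0 < P.rho x
  lam_mul_r : ∀ x ∈ closure Ω, 0 < P.lam x * P.r x - P.q x ^ 2

/-- The matrix `A(x) = ϱ⁻¹ (ϱ₂₂, -ϱ₁₂; -ϱ₁₂, ϱ₁₁) (2μ + λ, q; q, r)`. -/
def Coeffs.A (P : Coeffs) (x : Space) : Matrix (Fin 2) (Fin 2) ℝ :=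
  (P.rho x)⁻¹ • (!![P.rho22 x, -P.rho12 x; -P.rho12 x, P.rho11 x] *
    !![2 * P.mu x + P.lam x, P.q x; P.q x, P.r x])

/-- `μ₁ = ϱ⁻¹ ϱ₂₂ μ`. -/
def Coeffs.mu1 (P : Coeffs) (x : Space) : ℝ := (P.rho x)⁻¹ * P.rho22 x * P.mu x

/-- `c₂(x)` and `c₃(x)` are the two distinct eigenvalues of `A(x)`, for `x` in the closure
of `Ω`. -/
def Coeffs.IsEigenvaluePair (P : Coeffs) (Ω : Set Space) (c₂ c₃ : Space → ℝ) : Prop :=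
  ∀ x ∈ closure Ω, c₂ x ≠ c₃ x ∧
    Module.End.HasEigenvalue (Matrix.toLin' (P.A x)) (c₂ x) ∧
    Module.End.HasEigenvalue (Matrix.toLin' (P.A x)) (c₃ x)

/-! ### The weight -/

/-- `D² = max |x - x₀|²` over the closure of `Ω`. -/
def maxDistSq (Ω : Set Space) (x₀ : Space) : ℝ := sSup ((fun x => ‖x - x₀‖ ^ 2) '' closure Ω)

/-- `d² = min |x - x₀|²` over the closure of `Ω`. -/
def minDistSq (Ω : Set Space) (x₀ : Space) : ℝ := sInf ((fun x => ‖x - x₀‖ ^ 2) '' closure Ω)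

/-- `D₀ = (D² - d²)^{1/2}`. -/
def D0 (Ω : Set Space) (x₀ : Space) : ℝ := √(maxDistSq Ω x₀ - minDistSq Ω x₀)

/-- `φ(x, t) = exp (γ (|x - x₀|² - β t²))`. -/
def phi (x₀ : Space) (β γ : ℝ) (z : Spacetime) : ℝ :=
  Real.exp (γ * (‖z.1 - x₀‖ ^ 2 - β * z.2 ^ 2))

/-! ### Biot's system -/

/-- `(us, uf)` solves Biot's system with source `(F₁, F₂)`, almost everywhere in `Q`. -/
def IsSolution (P : Coeffs) {Q : Set Spacetime} (us uf : Fin 3 → SobolevH2 Q)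
    (F₁ F₂ : Fin 3 → SpatialH1 Q) : Prop :=
  ∀ᵐ z ∂(volume.restrict Q), ∀ i : Fin 3,
    (P.rho11 z.1 * (us i).dd tm tm z + P.rho12 z.1 * (uf i).dd tm tm z
        - lame P.mu P.lam us i z - gradMulDiv P.q uf i z = (F₁ i).val z) ∧
    (P.rho12 z.1 * (us i).dd tm tm z + P.rho22 z.1 * (uf i).dd tm tm z
        - gradMulDiv P.q us i z - gradMulDiv P.r uf i z = (F₂ i).val z)

/-- The vector field `u` vanishes almost everywhere in `Q` outside the set `K`. -/
def SupportedIn {Q : Set Spacetime} (u : Fin 3 → SobolevH2 Q) (K : Set Spacetime) : Prop :=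
  ∀ᵐ z ∂(volume.restrict Q), z ∉ K → ∀ i, (u i).val z = 0

end Biot

end

/-!
# Why the Carleman estimate for Biot's system holds

**One wave equation.** Conjugate `L = c ∂_t² - Δ`, where `c` is the reciprocal of the wave speed, by
`e^{τφ}` and multiply the main part of the conjugated operator by `h v - 2 ∑ g_a ∂_aφ ∂_av`. The
product is a divergence plus a quadratic form in `(∇v, τ v)` (`flux_algebra`), whose coefficients
are the Poisson bracket `{q, B}`, with `q` the symbol and `B` the derivative along the gradient of
the weight, corrected by a free multiplier `k`. If the form `{q, B} - k q` is positive definite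
modulo `B²`, and `{q, B} + k q` is positive at the gradient of the weight, integration gives the
scalar Carleman estimate with the factors `τ` and `τ³` (`Pseudoconvex.carleman`). For
`φ = e^{γ(|x - x₀|² - β t²)}` a multiplier with both properties exists as soon as the radial
condition `∇μ_j · (x - x₀) ≤ 2 (1 - θ) μ_j` and the bound on `|t|` hold (`exists_pseudoconvex`).

**The system.** Inverting the mass matrix, and taking the curl of the solid equation and the
divergence of both equations, gives wave equations in which the Laplacian of the solid displacement
is expressed by first derivatives of `div u^s` and `curl u^s`. Modulo first-order terms, `u^s` and
`curl u^s` propagate with speed `μ₁`, while the two divergences `V` satisfy `∂_t² V = A Δ V`. As `A`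
has the eigenvalues `μ₂ ≠ μ₃`, the rows of `A - μ₃` and `A - μ₂` are left eigenvectors or zero, and
the components of `(A - μ₃) V` and `(A - μ₂) V` solve scalar wave equations with speeds `μ₂` and
`μ₃`. Together they determine `V`. The scalar estimates for all these unknowns are added, and the
first-order coupling is absorbed for large `τ` (`carleman_absorb`, `smooth_estimate`). The gradient
of the source appears since the equations were differentiated once. Neither the fluid displacement
nor its curl occurs in the coupling, and neither is estimated.

**Fields in `H²`.** The differentiated equations make no sense for `H²` fields, so the estimate is
first proved for smooth ones. The coefficients are replaced by compactly supported `C²` functions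
which agree with them near a slightly larger compact set, and the fields, extended by zero, are
mollified. The source of the mollified field is the mollified source up to commutators with the
coefficients. By Friedrichs' lemma (`friedrichs`) even the gradients of these commutators tend to
zero in `L²`, because all coefficients of the system are `C²` functions or first derivatives of such
functions, hence of class `C¹`. So both sides of the estimate pass to the limit
(`sobolev_estimate`, `cylinder_estimate`).
-/

noncomputable section

namespace Biot

/-! ### Partial derivatives on space-time -/

/-- The classical partial derivative of `f` in the space-time direction with index `a`. -/
def D (a : Fin 4) (f : Spacetime → ℝ) (z : Spacetime) : ℝ := fderiv ℝ f z (dir a)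

/-- `f` is differentiable at `z` and its partial derivative with index `a` is `f'`. -/
def HasD (a : Fin 4) (f : Spacetime → ℝ) (f' : ℝ) (z : Spacetime) : Prop :=
  DifferentiableAt ℝ f z ∧ D a f z = f'

variable {a b : Fin 4} {f g : Spacetime → ℝ} {f' g' : ℝ} {z : Spacetime}

theorem hasD (h : DifferentiableAt ℝ f z) : HasD a f (D a f z) z := ⟨h, rfl⟩

theorem HasD.congr (h : HasD a f f' z) (e : f' = g') : HasD a f g' z := ⟨h.1, h.2.trans e⟩

theorem HasD.const (c : ℝ) : HasD a (fun _ => c) 0 z :=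
  ⟨differentiableAt_const c, by simp [D]⟩

theorem HasD.add (hf : HasD a f f' z) (hg : HasD a g g' z) :
    HasD a (fun z => f z + g z) (f' + g') z := by
  refine ⟨hf.1.add hg.1, ?_⟩
  rw [D, fderiv_fun_add hf.1 hg.1, ← hf.2, ← hg.2]; rfl

theorem HasD.sub (hf : HasD a f f' z) (hg : HasD a g g' z) :
    HasD a (fun z => f z - g z) (f' - g') z := by
  refine ⟨hf.1.sub hg.1, ?_⟩
  rw [D, fderiv_fun_sub hf.1 hg.1, ← hf.2, ← hg.2]; rfl

theorem HasD.mul (hf : HasD a f f' z) (hg : HasD a g g' z) :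
    HasD a (fun z => f z * g z) (f' * g z + f z * g') z := by
  refine ⟨hf.1.mul hg.1, ?_⟩
  rw [D, fderiv_fun_mul hf.1 hg.1, ← hf.2, ← hg.2]
  simp [D]; ring

theorem HasD.const_mul (c : ℝ) (hf : HasD a f f' z) : HasD a (fun z => c * f z) (c * f') z :=
  ((HasD.const c).mul hf).congr (by ring)

theorem HasD.sq (hf : HasD a f f' z) : HasD a (fun z => f z ^ 2) (2 * f z * f') z := by
  have := hf.mul hf
  simp only [← pow_two] at this
  exact this.congr (by ring)

theorem HasD.exp (hf : HasD a f f' z) :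
    HasD a (fun z => Real.exp (f z)) (Real.exp (f z) * f') z := by
  refine ⟨hf.1.exp, ?_⟩
  rw [D, fderiv_exp hf.1, ← hf.2]; simp [D]

theorem HasD.sum {ι : Type*} {s : Finset ι} {f : ι → Spacetime → ℝ} {f' : ι → ℝ}
    (h : ∀ i ∈ s, HasD a (f i) (f' i) z) :
    HasD a (fun z => ∑ i ∈ s, f i z) (∑ i ∈ s, f' i) z := by
  refine ⟨DifferentiableAt.fun_sum fun i hi => (h i hi).1, ?_⟩
  rw [D, fderiv_fun_sum fun i hi => (h i hi).1]
  simp only [sum_apply]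
  exact Finset.sum_congr rfl fun i hi => (h i hi).2

theorem contDiff_D {n m : WithTop ℕ∞} (hf : ContDiff ℝ n f) (h : m + 1 ≤ n) :
    ContDiff ℝ m (D a f) :=
  (hf.fderiv_right h).clm_apply contDiff_const

theorem D_eq_zero_of_notMem (hz : z ∉ tsupport f) : D a f z = 0 := by
  have : f =ᶠ[nhds z] fun _ => 0 := notMem_tsupport_iff_eventuallyEq.1 hz
  rw [D, this.fderiv_eq]; simp

theorem D_congr (e : f =ᶠ[nhds z] g) : D a f z = D a g z := by
  rw [D, D, e.fderiv_eq]

theorem tsupport_D_subset : tsupport (D a f) ⊆ tsupport f := by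
  refine closure_minimal (fun z hz => ?_) (isClosed_tsupport f)
  by_contra h
  exact hz (D_eq_zero_of_notMem h)

theorem D_comm (hf : ContDiffAt ℝ 2 f z) : D a (D b f) z = D b (D a f) z := by
  have hs := hf.isSymmSndFDerivAt (by simp)
  have hd : DifferentiableAt ℝ (fderiv ℝ f) z :=
    (hf.fderiv_right (m := 1) (by norm_num)).differentiableAt (by norm_num)
  have key : ∀ c d : Fin 4, D c (D d f) z = fderiv ℝ (fderiv ℝ f) z (dir c) (dir d) := by
    intro c d
    have : D d f = fun y => fderiv ℝ f y (dir d) := rfl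
    rw [D, this, fderiv_clm_apply hd (differentiableAt_const _)]
    simp
  rw [key, key]; exact hs _ _

/-- Space-time is the product of a Euclidean space and the line; its volume is the product
measure. -/
instance : (volume : Measure Spacetime).IsAddHaarMeasure :=
  inferInstanceAs (((volume : Measure Space).prod (volume : Measure ℝ)).IsAddHaarMeasure)

theorem integral_D_eq_zero (hf : ContDiff ℝ 1 f) (hc : HasCompactSupport f) :
    ∫ z, D a f z = 0 := by
  have hD : Integrable (D a f) :=
    (contDiff_D (m := 0) hf (by norm_num)).continuous.integrable_of_hasCompactSupport
      (hc.mono' ((subset_tsupport _).trans tsupport_D_subset))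
  have := integral_mul_fderiv_eq_neg_fderiv_mul_of_integrable (μ := (volume : Measure Spacetime))
    (f := fun _ => (1 : ℝ)) (g := f) (v := dir a) (by simp) (by simpa [D] using! hD)
    (by simpa using hf.continuous.integrable_of_hasCompactSupport hc)
    (fun _ _ => differentiableAt_const _) (fun z _ => hf.differentiable (by norm_num) z)
  simpa [D] using this

/-! ### The conjugated wave operator -/

/-- The quadratic form `∑ g_a ξ_a²`, the symbol of the operator `∑ g_a ∂_a²`. -/
def qf (g ξ : Fin 4 → ℝ) : ℝ := ∑ a, g a * ξ a ^ 2

/-- The polar form of `qf g`. -/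
def bf (g ξ η : Fin 4 → ℝ) : ℝ := ∑ a, g a * ξ a * η a

/-- The quadratic form `{q, B}(ξ)`, where `q(z, ξ) = ∑ g_a(z) ξ_a²`, `B(z, ξ) = ∑ g_a ∂_aφ ξ_a`
and `{·, ·}` is the Poisson bracket; it is half of the iterated bracket `{q, {q, φ}}` of Hörmander's
condition. The arguments are the values at one point: `dg a b = ∂_a g_b`, `p = ∇φ` and
`pp a b = ∂_a ∂_b φ`. -/
def commForm (g : Fin 4 → ℝ) (dg : Fin 4 → Fin 4 → ℝ) (p : Fin 4 → ℝ)
    (pp : Fin 4 → Fin 4 → ℝ) (ξ : Fin 4 → ℝ) : ℝ :=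
  ∑ a, ∑ b, (2 * g a * g b * pp a b * ξ a * ξ b + 2 * g a * dg a b * p b * ξ a * ξ b
    - g a * p a * dg a b * ξ b ^ 2)

/-- The component with index `a` of the vector field whose divergence is left over in
`flux_algebra`; the multiplier is `h v - 2 ∑ g_b ∂_bφ ∂_bv`. -/
def flux (g : Fin 4 → Spacetime → ℝ) (φ h v : Spacetime → ℝ) (τ : ℝ) (a : Fin 4)
    (z : Spacetime) : ℝ :=
  ∑ b, (g a z * D a φ z * (g b z * D b v z ^ 2)
      - 2 * (g a z * D a v z * (g b z * D b φ z * D b v z)))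
   - τ ^ 2 * (g a z * D a φ z * (∑ b, g b z * D b φ z ^ 2) * v z ^ 2)
   + h z * v z * (g a z * D a v z)

/-- The product of the two main parts of the conjugated operator is a divergence plus a quadratic
form in `(∇v, v)`, the cross terms between `∇v` and `v` being of lower order. The identity is
pointwise: `p`, `pp` are the derivatives of the weight, `w`, `v`, `vv` the value and the derivatives
of the function, and the sum on the right of the first line is the divergence of `flux`, by
`hasD_flux`. The free multiplier `k` moves the form by multiples of `q`, with opposite signs in the
two places where it occurs. -/
theorem flux_algebra (g p v : Fin 4 → ℝ) (dg pp vv : Fin 4 → Fin 4 → ℝ) (dh : Fin 4 → ℝ)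
    (h k τ w : ℝ) (hdg : ∀ a, dg a a = 0) (hp : ∀ a b, pp a b = pp b a)
    (hv : ∀ a b, vv a b = vv b a) (hk : h = k - ∑ a, g a * pp a a) :
    (∑ a, g a * vv a a + τ ^ 2 * qf g p * w) * (h * w - 2 * bf g p v) =
      ∑ a, (∑ b, (((dg a a * p a + g a * pp a a) * (g b * v b ^ 2)
          + g a * p a * (dg a b * v b ^ 2 + g b * (2 * v b * vv a b)))
          - 2 * ((dg a a * v a + g a * vv a a) * (g b * p b * v b)
            + g a * v a * ((dg a b * p b + g b * pp a b) * v b + g b * p b * vv a b)))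
        - τ ^ 2 * (((dg a a * p a + g a * pp a a) * (∑ b, g b * p b ^ 2)
            + g a * p a * (∑ b, (dg a b * p b ^ 2 + g b * (2 * p b * pp a b)))) * w ^ 2
            + g a * p a * (∑ b, g b * p b ^ 2) * (2 * w * v a))
        + ((dh a * w + h * v a) * (g a * v a) + h * w * (dg a a * v a + g a * vv a a)))
      + commForm g dg p pp v - k * qf g v
      + τ ^ 2 * (commForm g dg p pp p + k * qf g p) * w ^ 2
      - w * ∑ a, g a * dh a * v a := by
  have h10 := hp 1 0; have h20 := hp 2 0; have h30 := hp 3 0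
  have h21 := hp 2 1; have h31 := hp 3 1; have h32 := hp 3 2
  have v10 := hv 1 0; have v20 := hv 2 0; have v30 := hv 3 0
  have v21 := hv 2 1; have v31 := hv 3 1; have v32 := hv 3 2
  simp only [qf, bf, commForm, Fin.sum_univ_four, hdg, h10, h20, h30, h21, h31, h32, v10, v20,
    v30, v21, v31, v32] at hk ⊢
  subst hk
  ring

theorem hasD_flux {g : Fin 4 → Spacetime → ℝ} {φ h v : Spacetime → ℝ} (τ : ℝ) (a : Fin 4)
    (hg : ∀ a, ContDiff ℝ 1 (g a)) (hφ : ContDiff ℝ 3 φ) (hh : ContDiff ℝ 1 h)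
    (hv : ContDiff ℝ 2 v) (z : Spacetime) :
    HasD a (flux g φ h v τ a)
      ((∑ b, (((D a (g a) z * D a φ z + g a z * D a (D a φ) z) * (g b z * D b v z ^ 2)
          + g a z * D a φ z * (D a (g b) z * D b v z ^ 2
            + g b z * (2 * D b v z * D a (D b v) z)))
          - 2 * ((D a (g a) z * D a v z + g a z * D a (D a v) z) * (g b z * D b φ z * D b v z)
            + g a z * D a v z * ((D a (g b) z * D b φ z + g b z * D a (D b φ) z) * D b v z
              + g b z * D b φ z * D a (D b v) z)))
        - τ ^ 2 * (((D a (g a) z * D a φ z + g a z * D a (D a φ) z)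
              * (∑ b, g b z * D b φ z ^ 2)
            + g a z * D a φ z * (∑ b, (D a (g b) z * D b φ z ^ 2
              + g b z * (2 * D b φ z * D a (D b φ) z)))) * v z ^ 2
            + g a z * D a φ z * (∑ b, g b z * D b φ z ^ 2) * (2 * v z * D a v z))
        + ((D a h z * v z + h z * D a v z) * (g a z * D a v z)
          + h z * v z * (D a (g a) z * D a v z + g a z * D a (D a v) z)))) z := by
  have g' : ∀ b, HasD a (g b) (D a (g b) z) z := fun b =>
    hasD ((hg b).differentiable (by norm_num) z)
  have p' : ∀ b, HasD a (D b φ) (D a (D b φ) z) z := fun b =>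
    hasD ((contDiff_D (m := 2) hφ (by norm_num)).differentiable (by norm_num) z)
  have v' : ∀ b, HasD a (D b v) (D a (D b v) z) z := fun b =>
    hasD ((contDiff_D (m := 1) hv (by norm_num)).differentiable (by norm_num) z)
  have h' : HasD a h (D a h z) z := hasD (hh.differentiable (by norm_num) z)
  have w' : HasD a v (D a v z) z := hasD (hv.differentiable (by norm_num) z)
  exact ((HasD.sum fun b _ => (((g' a).mul (p' a)).mul ((g' b).mul (v' b).sq)).sub
    ((((g' a).mul (v' a)).mul (((g' b).mul (p' b)).mul (v' b))).const_mul 2)).sub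
    (((((g' a).mul (p' a)).mul (HasD.sum fun b _ => (g' b).mul (p' b).sq)).mul
      w'.sq).const_mul (τ ^ 2))).add ((h'.mul w').mul ((g' a).mul (v' a)))

theorem contDiff_flux {g : Fin 4 → Spacetime → ℝ} {φ h v : Spacetime → ℝ} (τ : ℝ) (a : Fin 4)
    (hg : ∀ a, ContDiff ℝ 1 (g a)) (hφ : ContDiff ℝ 3 φ) (hh : ContDiff ℝ 1 h)
    (hv : ContDiff ℝ 2 v) : ContDiff ℝ 1 (flux g φ h v τ a) := by
  have p' : ∀ b, ContDiff ℝ 1 (D b φ) := fun b =>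
    (contDiff_D (m := 2) hφ (by norm_num)).of_le (by norm_num)
  have v' : ∀ b, ContDiff ℝ 1 (D b v) := fun b => contDiff_D (m := 1) hv (by norm_num)
  have w' : ContDiff ℝ 1 v := hv.of_le (by norm_num)
  unfold flux
  fun_prop

/-- Conjugation of the operator `∑ g_a ∂_a²`, with coefficients frozen at `z`, by `e^{τφ}`. -/
theorem conj_identity {φ w : Spacetime → ℝ} (g : Fin 4 → ℝ) (τ : ℝ)
    (hφ : ContDiff ℝ 3 φ) (hw : ContDiff ℝ 2 w) (z : Spacetime) :
    let v : Spacetime → ℝ := fun z => Real.exp (τ * φ z) * w z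
    (∀ a, D a v z = Real.exp (τ * φ z) * D a w z + τ * D a φ z * v z) ∧
    Real.exp (τ * φ z) * ∑ a, g a * D a (D a w) z =
      (∑ a, g a * D a (D a v) z + τ ^ 2 * qf g (D · φ z) * v z)
        - 2 * τ * bf g (D · φ z) (D · v z)
        - τ * (∑ a, g a * D a (D a φ) z) * v z := by
  intro v
  have e' : ∀ y a, HasD a (fun z => Real.exp (τ * φ z)) (Real.exp (τ * φ y) * (τ * D a φ y)) y :=
    fun y a => ((hasD (hφ.differentiable (by norm_num) y)).const_mul τ).exp
  have v' : ∀ y a, HasD a v (Real.exp (τ * φ y) * (τ * D a φ y) * w y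
      + Real.exp (τ * φ y) * D a w y) y := fun y a =>
    (e' y a).mul (hasD (hw.differentiable (by norm_num) y))
  have vD : ∀ a, D a v = fun y => Real.exp (τ * φ y) * (τ * D a φ y) * w y
      + Real.exp (τ * φ y) * D a w y := fun a => funext fun y => (v' y a).2
  have vDD := fun a => (congrArg (fun f => D a f z) (vD a)).trans
    ((((e' z a).mul ((hasD ((contDiff_D (m := 2) hφ
      (by norm_num)).differentiable (by norm_num) z)).const_mul τ)).mul
      (hasD (hw.differentiable (by norm_num) z))).add ((e' z a).mul
      (hasD ((contDiff_D (m := 1) hw (by norm_num)).differentiable (by norm_num) z)))).2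
  refine ⟨fun a => by rw [vD]; ring, ?_⟩
  simp only [qf, bf, vDD]
  simp only [vD, v, Fin.sum_univ_four]
  ring

theorem exists_abs_le {X : Type*} [TopologicalSpace X] {K : Set X} (hK : IsCompact K)
    {f : X → ℝ} (hf : ContinuousOn f K) : ∃ M > 0, ∀ z ∈ K, |f z| ≤ M := by
  obtain ⟨M, hM⟩ := hK.exists_bound_of_continuousOn hf
  exact ⟨max M 1, by positivity, fun z hz => (hM z hz).trans (le_max_left _ _)⟩

/-- The pointwise form of the Carleman estimate. Here `E` is the conjugated operator, split into
`P` and `τ (h w - 2 X)` up to the term `τ k w`, `A` is a divergence, and `X` is the derivative along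
the gradient of the weight. Positivity of the form `Q` is needed only modulo `X²`, since `X²` occurs
with the factor `τ²` in the square of `τ (h w - 2 X)`. -/
theorem carleman_pointwise {P X A Q Z G S E w h k τ κ δ M : ℝ}
    (hδ : 0 < δ) (hM : 0 < M) (hτ1 : 1 ≤ τ) (hτκ : κ ≤ τ)
    (hτM : M ^ 2 / δ + 3 * M ^ 2 ≤ τ * δ)
    (hE : E = P + τ * (h * w - 2 * X) - τ * k * w)
    (hP : P * (h * w - 2 * X) = A + Q + τ ^ 2 * Z * w ^ 2 - w * G)
    (hQ : δ * S ≤ Q + κ * X ^ 2) (hZ : δ ≤ Z) (hh : |h| ≤ M) (hk : |k| ≤ M)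
    (hG : G ^ 2 ≤ M ^ 2 * S) :
    δ * (τ * S + τ ^ 3 * w ^ 2) ≤ 2 * E ^ 2 - 2 * τ * A := by
  have h2 : h ^ 2 ≤ M ^ 2 := sq_le_sq' (abs_le.1 hh).1 (abs_le.1 hh).2
  have k2 : k ^ 2 ≤ M ^ 2 := sq_le_sq' (abs_le.1 hk).1 (abs_le.1 hk).2
  have hw := sq_nonneg w
  -- the square of the two main parts of the conjugated operator
  have e1 : 2 * τ * (P * (h * w - 2 * X)) + τ ^ 2 * (h * w - 2 * X) ^ 2
      ≤ 2 * E ^ 2 + 2 * τ ^ 2 * k ^ 2 * w ^ 2 := by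
    have e : P + τ * (h * w - 2 * X) = E + τ * k * w := by rw [hE]; ring
    nlinarith [sq_nonneg P, sq_nonneg (E - τ * k * w), congrArg (· ^ 2) e]
  have e2 : 2 * X ^ 2 - h ^ 2 * w ^ 2 ≤ (h * w - 2 * X) ^ 2 := by
    nlinarith [sq_nonneg (X - h * w)]
  have e3 : τ ^ 2 * (2 * X ^ 2 - h ^ 2 * w ^ 2) ≤ τ ^ 2 * (h * w - 2 * X) ^ 2 := by gcongr
  have e4 : 2 * (w * G) ≤ δ * S + M ^ 2 / δ * w ^ 2 := by
    have : 2 * (w * G) ≤ δ / M ^ 2 * G ^ 2 + M ^ 2 / δ * w ^ 2 := by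
      have := sq_nonneg (δ * G - M ^ 2 * w)
      have e : δ / M ^ 2 * G ^ 2 + M ^ 2 / δ * w ^ 2 - 2 * (w * G)
          = (δ * G - M ^ 2 * w) ^ 2 / (δ * M ^ 2) := by field_simp; ring
      have : 0 ≤ (δ * G - M ^ 2 * w) ^ 2 / (δ * M ^ 2) := by positivity
      linarith
    have h3 : δ / M ^ 2 * G ^ 2 ≤ δ / M ^ 2 * (M ^ 2 * S) := by gcongr
    have h4 : δ / M ^ 2 * (M ^ 2 * S) = δ * S := by field_simp
    linarith
  have e5 : τ * (2 * (w * G)) ≤ τ * (δ * S + M ^ 2 / δ * w ^ 2) := by gcongr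
  have e6 : τ * (κ * X ^ 2) ≤ τ * (τ * X ^ 2) := by gcongr
  have e7 : τ * (δ * S) ≤ τ * (Q + κ * X ^ 2) := by gcongr
  have e8 : τ ^ 3 * w ^ 2 * δ ≤ τ ^ 3 * w ^ 2 * Z := by gcongr
  have e9 : τ ^ 2 * w ^ 2 * (M ^ 2 / δ + 3 * M ^ 2) ≤ τ ^ 2 * w ^ 2 * (τ * δ) := by gcongr
  have e10 : τ ^ 2 * w ^ 2 * h ^ 2 ≤ τ ^ 2 * w ^ 2 * M ^ 2 := by gcongr
  have e11 : τ ^ 2 * w ^ 2 * k ^ 2 ≤ τ ^ 2 * w ^ 2 * M ^ 2 := by gcongr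
  have e12 : τ * (M ^ 2 / δ * w ^ 2) ≤ τ ^ 2 * w ^ 2 * (M ^ 2 / δ) := by
    have : τ * (M ^ 2 / δ * w ^ 2) ≤ τ * (τ * (M ^ 2 / δ * w ^ 2)) := by
      refine mul_le_mul_of_nonneg_left (le_mul_of_one_le_left (by positivity) hτ1) (by linarith)
    linarith
  rw [hP] at e1
  nlinarith

/-! ### The scalar Carleman estimate -/

/-- The metric `g` and the weight `φ` satisfy the quantitative strong pseudoconvexity condition
on `K`, with the auxiliary multiplier `k`: the form `{q, B} - k q` is positive definite modulo
`B²`, and `{q, B} + k q` is positive at `ξ = ∇φ`. For every `a`, the entry `g_a` must not depend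
on the variable with the same index, so that `∑ g_a ∂_a²` has divergence form. -/
structure Pseudoconvex (g : Fin 4 → Spacetime → ℝ) (φ k : Spacetime → ℝ) (K : Set Spacetime)
    (κ δ : ℝ) : Prop where
  g_C1 : ∀ a, ContDiff ℝ 1 (g a)
  D_g_self : ∀ a z, D a (g a) z = 0
  φ_C3 : ContDiff ℝ 3 φ
  k_C1 : ContDiff ℝ 1 k
  δ_pos : 0 < δ
  form_ge : ∀ z ∈ K, ∀ ξ : Fin 4 → ℝ, δ * ∑ a, ξ a ^ 2 ≤
    commForm (g · z) (fun a b => D a (g b) z) (D · φ z) (fun a b => D a (D b φ) z) ξ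
      - k z * qf (g · z) ξ + κ * bf (g · z) (D · φ z) ξ ^ 2
  zero_ge : ∀ z ∈ K, δ ≤
    commForm (g · z) (fun a b => D a (g b) z) (D · φ z) (fun a b => D a (D b φ) z) (D · φ z)
      + k z * qf (g · z) (D · φ z)

theorem continuous_D {f : Spacetime → ℝ} (hf : ContDiff ℝ 1 f) (a : Fin 4) :
    Continuous (D a f) :=
  (contDiff_D (m := 0) hf (by norm_num)).continuous

set_option maxHeartbeats 800000 in
/-- The Carleman estimate for the scalar wave operator `∑ g_a ∂_a²`. -/
theorem Pseudoconvex.carleman {g : Fin 4 → Spacetime → ℝ} {φ k : Spacetime → ℝ}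
    {K : Set Spacetime} {κ δ : ℝ} (H : Pseudoconvex g φ k K κ δ) (hK : IsCompact K) :
    ∃ τs > 0, ∃ C > 0, ∀ τ ≥ τs, ∀ w : Spacetime → ℝ, ContDiff ℝ 2 w → tsupport w ⊆ K →
      ∫ z, (τ * ∑ a, D a w z ^ 2 + τ ^ 3 * w z ^ 2) * Real.exp (2 * τ * φ z)
        ≤ C * ∫ z, (∑ a, g a z * D a (D a w) z) ^ 2 * Real.exp (2 * τ * φ z) := by
  set h : Spacetime → ℝ := fun z => k z - ∑ a, g a z * D a (D a φ) z with hdef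
  have hgC := H.g_C1
  have hkC := H.k_C1
  have hφ := H.φ_C3
  have hφ1 : ContDiff ℝ 1 φ := hφ.of_le (by norm_num)
  have hφD : ∀ a, ContDiff ℝ 2 (D a φ) := fun a => contDiff_D hφ (by norm_num)
  have hφDD : ∀ a b, ContDiff ℝ 1 (D a (D b φ)) := fun a b =>
    contDiff_D (hφD b) (by norm_num)
  have hh : ContDiff ℝ 1 h := by rw [hdef]; fun_prop
  have hg0 : ∀ a, Continuous (g a) := fun a => (hgC a).continuous
  obtain ⟨M₁, hM₁, hM₁'⟩ := exists_abs_le hK (f := h) hh.continuous.continuousOn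
  obtain ⟨M₂, hM₂, hM₂'⟩ := exists_abs_le hK (f := k) hkC.continuous.continuousOn
  obtain ⟨M₃, hM₃, hM₃'⟩ := exists_abs_le hK (f := fun z => ∑ a, (g a z * D a h z) ^ 2) (by
    have := fun a => continuous_D hh a
    fun_prop)
  obtain ⟨M₄, hM₄, hM₄'⟩ := exists_abs_le hK (f := fun z => ∑ a, (D a φ z) ^ 2) (by
    have := fun a => continuous_D hφ1 a
    fun_prop)
  set M := M₁ + M₂ + M₃ + 1 with hM
  have hδ := H.δ_pos
  have hMpos : 0 < M := by positivity
  set τs := 1 + |κ| + (M ^ 2 / δ + 3 * M ^ 2) / δ with hτs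
  have hquot : 0 ≤ (M ^ 2 / δ + 3 * M ^ 2) / δ := by positivity
  refine ⟨τs, by positivity, 2 * ((2 * M₄ + 3) / δ), by positivity, fun τ hτ w hw hwK => ?_⟩
  have hτ1 : 1 ≤ τ := by linarith [abs_nonneg κ]
  have hτ0 : 0 < τ := by linarith
  have hτκ : κ ≤ τ := by linarith [le_abs_self κ]
  have hτM : M ^ 2 / δ + 3 * M ^ 2 ≤ τ * δ := by
    rw [← div_le_iff₀ hδ]; linarith [abs_nonneg κ]
  set v : Spacetime → ℝ := fun z => Real.exp (τ * φ z) * w z with hv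
  have hφ2 : ContDiff ℝ 2 φ := hφ.of_le (by norm_num)
  have hvC : ContDiff ℝ 2 v := by rw [hv]; fun_prop
  have hvK : tsupport v ⊆ K := (closure_mono (Function.support_mul_subset_right _ _)).trans hwK
  have hwD := fun a => continuous_D (hw.of_le (by norm_num)) a
  have hwD1 : ∀ a, ContDiff ℝ 1 (D a w) := fun a => contDiff_D hw (by norm_num)
  have hwDD := fun a => continuous_D (hwD1 a) a
  have hzw : ∀ z ∉ K, w z = 0 := fun z hz => image_eq_zero_of_notMem_tsupport fun h => hz (hwK h)
  have hzD : ∀ a, ∀ z ∉ K, D a w z = 0 := fun a z hz =>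
    D_eq_zero_of_notMem fun h => hz (hwK h)
  have hzDD : ∀ a, ∀ z ∉ K, D a (D a w) z = 0 := fun a z hz =>
    D_eq_zero_of_notMem fun h => hz (hwK (tsupport_D_subset h))
  -- the flux vanishes off `K`
  have hJ0 : ∀ a, tsupport (flux g φ h v τ a) ⊆ K := fun a => by
    refine closure_minimal (fun z hz => ?_) hK.isClosed
    by_contra hzK
    have hv0 : v z = 0 := image_eq_zero_of_notMem_tsupport fun h => hzK (hvK h)
    have hD0 : ∀ b, D b v z = 0 := fun b => D_eq_zero_of_notMem fun h => hzK (hvK h)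
    exact hz (by simp [flux, hv0, hD0])
  have hJC := fun a => contDiff_flux τ a hgC hφ hh hvC
  have hJ := fun a => integral_D_eq_zero (a := a) (hJC a)
    (HasCompactSupport.intro hK fun z hz =>
      image_eq_zero_of_notMem_tsupport fun h => hz (hJ0 a h))
  have hJD := fun a => continuous_D (hJC a) a
  have hJDi : ∀ a, Integrable (D a (flux g φ h v τ a)) := fun a =>
    (hJD a).integrable_of_hasCompactSupport
      (HasCompactSupport.intro hK fun z hz => D_eq_zero_of_notMem fun h => hz (hJ0 a h))
  have hφc := hφ.continuous
  have hwc := hw.continuous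
  have hRi : Integrable fun z => (∑ a, g a z * D a (D a w) z) ^ 2 * Real.exp (2 * τ * φ z) := by
    refine Continuous.integrable_of_hasCompactSupport (by fun_prop)
      (HasCompactSupport.intro hK fun z hz => ?_)
    simp [hzDD _ z hz]
  have hLi : Integrable fun z => (τ * ∑ a, D a w z ^ 2 + τ ^ 3 * w z ^ 2)
      * Real.exp (2 * τ * φ z) := by
    refine Continuous.integrable_of_hasCompactSupport (by fun_prop)
      (HasCompactSupport.intro hK fun z hz => ?_)
    simp [hzw z hz, hzD _ z hz]
  have hsum : Integrable fun z => ∑ a, D a (flux g φ h v τ a) z :=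
    integrable_finsetSum _ fun a _ => hJDi a
  have hint : ∫ z, ∑ a, D a (flux g φ h v τ a) z = 0 := by
    rw [integral_finsetSum _ fun a _ => hJDi a]
    exact Finset.sum_eq_zero fun a _ => hJ a
  have key : ∀ z, (τ * ∑ a, D a w z ^ 2 + τ ^ 3 * w z ^ 2) * Real.exp (2 * τ * φ z)
      ≤ 2 * ((2 * M₄ + 3) / δ) * ((∑ a, g a z * D a (D a w) z) ^ 2 * Real.exp (2 * τ * φ z))
        - 2 * τ * ((2 * M₄ + 3) / δ) * ∑ a, D a (flux g φ h v τ a) z := by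
    intro z
    by_cases hz : z ∈ K
    swap
    · have : ∀ a, D a (flux g φ h v τ a) z = 0 := fun a =>
        D_eq_zero_of_notMem fun h => hz (hJ0 a h)
      simp [hzw z hz, hzD _ z hz, hzDD _ z hz, this]
    have hee : Real.exp (2 * τ * φ z) = Real.exp (τ * φ z) ^ 2 := by
      rw [← Real.exp_nat_mul]; congr 1; push_cast; ring
    obtain ⟨c1, c2⟩ := conj_identity (g · z) τ hφ hw z
    have alg := flux_algebra (g · z) (D · φ z) (D · v z) (fun a b => D a (g b) z)
      (fun a b => D a (D b φ) z) (fun a b => D a (D b v) z) (D · h z) (h z) (k z) τ (v z)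
      (fun a => H.D_g_self a z) (fun a b => D_comm hφ2.contDiffAt)
      (fun a b => D_comm hvC.contDiffAt) rfl
    have hfl : ∑ a, D a (flux g φ h v τ a) z = _ :=
      Finset.sum_congr rfl fun a _ => (hasD_flux τ a hgC hφ hh hvC z).2
    rw [← hfl] at alg
    have hG : (∑ a, g a z * D a h z * D a v z) ^ 2 ≤ M ^ 2 * ∑ a, D a v z ^ 2 := by
      refine (Finset.sum_mul_sq_le_sq_mul_sq _ _ _).trans ?_
      refine mul_le_mul_of_nonneg_right ?_ (Finset.sum_nonneg fun _ _ => sq_nonneg _)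
      refine ((le_abs_self _).trans (hM₃' z hz)).trans ?_
      nlinarith
    have pw := carleman_pointwise (E := Real.exp (τ * φ z) * ∑ a, g a z * D a (D a w) z)
      (X := bf (g · z) (D · φ z) (D · v z)) (k := k z)
      (Q := commForm (g · z) (fun a b => D a (g b) z) (D · φ z) (fun a b => D a (D b φ) z)
        (D · v z) - k z * qf (g · z) (D · v z)) (κ := κ)
      (w := v z) (S := ∑ a, D a v z ^ 2) (h := h z) hδ hMpos hτ1 hτκ hτM
      (by rw [c2]; simp only [hdef]; ring)
      (alg.trans (by ring)) (H.form_ge z hz (D · v z))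
      (H.zero_ge z hz) ((hM₁' z hz).trans (by rw [hM]; linarith))
      ((hM₂' z hz).trans (by rw [hM]; linarith)) hG
    have hgrad : ∑ a, (Real.exp (τ * φ z) * D a w z) ^ 2
        ≤ 2 * ∑ a, D a v z ^ 2 + 2 * τ ^ 2 * M₄ * v z ^ 2 := by
      have : ∑ a, (Real.exp (τ * φ z) * D a w z) ^ 2
          ≤ ∑ a, (2 * D a v z ^ 2 + 2 * τ ^ 2 * v z ^ 2 * D a φ z ^ 2) := by
        refine Finset.sum_le_sum fun a _ => ?_
        have e : Real.exp (τ * φ z) * D a w z = D a v z - τ * D a φ z * v z := by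
          rw [c1 a]; ring
        rw [e]; nlinarith [sq_nonneg (D a v z + τ * D a φ z * v z)]
      rw [Finset.sum_add_distrib, ← Finset.mul_sum, ← Finset.mul_sum] at this
      have h4 : ∑ a, D a φ z ^ 2 ≤ M₄ := (le_abs_self _).trans (hM₄' z hz)
      have : 2 * τ ^ 2 * v z ^ 2 * ∑ a, D a φ z ^ 2 ≤ 2 * τ ^ 2 * v z ^ 2 * M₄ := by gcongr
      linarith
    have hL : (τ * ∑ a, D a w z ^ 2 + τ ^ 3 * w z ^ 2) * Real.exp (2 * τ * φ z)
        = τ * ∑ a, (Real.exp (τ * φ z) * D a w z) ^ 2 + τ ^ 3 * v z ^ 2 := by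
      simp only [hv, mul_pow, ← Finset.mul_sum, hee]; ring
    have hS : 0 ≤ ∑ a, D a v z ^ 2 := Finset.sum_nonneg fun _ _ => sq_nonneg _
    rw [hL]
    calc _ ≤ τ * (2 * ∑ a, D a v z ^ 2 + 2 * τ ^ 2 * M₄ * v z ^ 2) + τ ^ 3 * v z ^ 2 := by
          gcongr
      _ ≤ (2 * M₄ + 3) * (τ * ∑ a, D a v z ^ 2 + τ ^ 3 * v z ^ 2) := by
          have : 0 ≤ τ * ∑ a, D a v z ^ 2 := by positivity
          have : 0 ≤ τ ^ 3 * v z ^ 2 := by positivity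
          nlinarith
      _ = (2 * M₄ + 3) / δ * (δ * (τ * ∑ a, D a v z ^ 2 + τ ^ 3 * v z ^ 2)) := by
          field_simp
      _ ≤ (2 * M₄ + 3) / δ * (2 * (Real.exp (τ * φ z) * ∑ a, g a z * D a (D a w) z) ^ 2
            - 2 * τ * ∑ a, D a (flux g φ h v τ a) z) :=
          mul_le_mul_of_nonneg_left pw (by positivity)
      _ = _ := by rw [hee]; ring
  calc _ ≤ ∫ z, (2 * ((2 * M₄ + 3) / δ) * ((∑ a, g a z * D a (D a w) z) ^ 2
        * Real.exp (2 * τ * φ z))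
        - 2 * τ * ((2 * M₄ + 3) / δ) * ∑ a, D a (flux g φ h v τ a) z) :=
        integral_mono hLi ((hRi.const_mul _).sub (hsum.const_mul _)) key
    _ = _ := by
        rw [integral_sub (hRi.const_mul _) (hsum.const_mul _), integral_const_mul,
          integral_const_mul, hint]
        ring

/-! ### The metric and the weight -/

theorem dir_sp (i : Fin 3) : dir (sp i) = (EuclideanSpace.single i 1, 0) := by
  simp [dir]

theorem dir_tm : dir tm = (0, 1) := by simp [dir]

theorem sum_fin_four (f : Fin 4 → ℝ) :
    ∑ a, f a = f (sp 0) + f (sp 1) + f (sp 2) + f tm := by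
  rw [Fin.sum_univ_castSucc, Fin.sum_univ_three]

theorem hasD_sp {c : Space → ℝ} {z : Spacetime} (hc : DifferentiableAt ℝ c z.1) (i : Fin 3) :
    HasD (sp i) (fun z => c z.1) (pd c i z.1) z := by
  have h : HasFDerivAt (fun z : Spacetime => c z.1)
      ((fderiv ℝ c z.1).comp (ContinuousLinearMap.fst ℝ Space ℝ)) z :=
    HasFDerivAt.comp z hc.hasFDerivAt hasFDerivAt_fst
  refine ⟨h.differentiableAt, ?_⟩
  rw [D, h.fderiv, dir_sp]; rfl

theorem hasD_tm {c : Space → ℝ} {z : Spacetime} (hc : DifferentiableAt ℝ c z.1) :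
    HasD tm (fun z => c z.1) 0 z := by
  have h : HasFDerivAt (fun z : Spacetime => c z.1)
      ((fderiv ℝ c z.1).comp (ContinuousLinearMap.fst ℝ Space ℝ)) z :=
    HasFDerivAt.comp z hc.hasFDerivAt hasFDerivAt_fst
  refine ⟨h.differentiableAt, ?_⟩
  rw [D, h.fderiv, dir_tm]; simp

/-- The coefficients of the operator `c(x) ∂_t² - Δ`, as a diagonal metric. The wave operator with
speed coefficient `b` corresponds to `c = 1 / b`. -/
def metric (c : Space → ℝ) (a : Fin 4) (z : Spacetime) : ℝ :=
  Fin.lastCases (motive := fun _ => ℝ) (c z.1) (fun _ => -1) a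

@[simp] theorem metric_sp (c : Space → ℝ) (i : Fin 3) : metric c (sp i) = fun _ => -1 := by
  ext; simp [metric]

@[simp] theorem metric_tm (c : Space → ℝ) : metric c tm = fun z => c z.1 := by
  ext; simp [metric]

/-- The coordinates of `z - (x₀, 0)`. -/
def coord (x₀ : Space) (a : Fin 4) (z : Spacetime) : ℝ :=
  Fin.lastCases (motive := fun _ => ℝ) z.2 (fun i => z.1 i - x₀ i) a

@[simp] theorem coord_sp (x₀ : Space) (i : Fin 3) :
    coord x₀ (sp i) = fun z => z.1 i - x₀ i := by
  ext; simp [coord]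

@[simp] theorem coord_tm (x₀ : Space) : coord x₀ tm = fun z => z.2 := by
  ext; simp [coord]

/-- The diagonal entries of the Hessian of `|x - x₀|² - β t²`, which is diagonal. -/
def hess (β : ℝ) (a : Fin 4) : ℝ :=
  Fin.lastCases (motive := fun _ => ℝ) (-2 * β) (fun _ => 2) a

@[simp] theorem hess_sp (β : ℝ) (i : Fin 3) : hess β (sp i) = 2 := by simp [hess]

@[simp] theorem hess_tm (β : ℝ) : hess β tm = -2 * β := by simp [hess]

theorem hasD_coord (x₀ : Space) (a b : Fin 4) (z : Spacetime) :
    HasD a (coord x₀ b) (if a = b then 1 else 0) z := by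
  induction b using Fin.lastCases with
  | last =>
    rw [coord_tm]
    have h : HasFDerivAt (fun z : Spacetime => z.2) (ContinuousLinearMap.snd ℝ Space ℝ) z :=
      hasFDerivAt_snd
    refine ⟨h.differentiableAt, ?_⟩
    rw [D, h.fderiv]
    induction a using Fin.lastCases with
    | last => rw [dir_tm]; simp
    | cast i => rw [dir_sp]; simp [Fin.castSucc_ne_last, -Fin.reduceLast]
  | cast j =>
    rw [coord_sp]
    have h : HasFDerivAt (fun z : Spacetime => z.1 j - x₀ j)
        ((EuclideanSpace.proj j : Space →L[ℝ] ℝ).comp (ContinuousLinearMap.fst ℝ Space ℝ)) z :=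
      (HasFDerivAt.comp z (EuclideanSpace.proj j : Space →L[ℝ] ℝ).hasFDerivAt
        hasFDerivAt_fst).sub_const _
    refine ⟨h.differentiableAt, ?_⟩
    rw [D, h.fderiv]
    induction a using Fin.lastCases with
    | last => rw [dir_tm]; simp [(Fin.castSucc_ne_last j).symm, -Fin.reduceLast]
    | cast i => rw [dir_sp]; simp [eq_comm]

theorem phi_eq (x₀ : Space) (β γ : ℝ) :
    phi x₀ β γ = fun z => Real.exp (γ * ∑ a, hess β a / 2 * coord x₀ a z ^ 2) := by
  ext z
  rw [phi, sum_fin_four, EuclideanSpace.norm_sq_eq, Fin.sum_univ_three]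
  simp only [hess_sp, hess_tm, coord_sp, coord_tm, Real.norm_eq_abs, sq_abs, PiLp.sub_apply]
  congr 1
  ring

theorem hasD_phi (x₀ : Space) (β γ : ℝ) (a : Fin 4) (z : Spacetime) :
    HasD a (phi x₀ β γ) (γ * phi x₀ β γ z * (hess β a * coord x₀ a z)) z := by
  have h := ((HasD.sum (s := Finset.univ) fun b _ =>
    (hasD_coord x₀ a b z).sq.const_mul (hess β b / 2)).const_mul γ).exp
  rw [phi_eq]
  refine h.congr ?_
  simp
  ring

theorem D_phi (x₀ : Space) (β γ : ℝ) (a : Fin 4) :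
    D a (phi x₀ β γ) = fun z => γ * phi x₀ β γ z * (hess β a * coord x₀ a z) :=
  funext fun z => (hasD_phi x₀ β γ a z).2

theorem DD_phi (x₀ : Space) (β γ : ℝ) (a b : Fin 4) (z : Spacetime) :
    D a (D b (phi x₀ β γ)) z = γ * phi x₀ β γ z * ((if a = b then hess β b else 0)
      + γ * (hess β a * coord x₀ a z) * (hess β b * coord x₀ b z)) := by
  rw [D_phi]
  have := ((hasD_phi x₀ β γ a z).const_mul γ).mul ((hasD_coord x₀ a b z).const_mul (hess β b))
  rw [this.2]
  split_ifs <;> ring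

theorem contDiff_coord (x₀ : Space) (a : Fin 4) {n : WithTop ℕ∞} : ContDiff ℝ n (coord x₀ a) := by
  induction a using Fin.lastCases with
  | last => rw [coord_tm]; exact contDiff_snd
  | cast i =>
    rw [coord_sp]
    exact ((EuclideanSpace.proj i : Space →L[ℝ] ℝ).contDiff.comp contDiff_fst).sub contDiff_const

theorem contDiff_phi (x₀ : Space) (β γ : ℝ) {n : WithTop ℕ∞} : ContDiff ℝ n (phi x₀ β γ) := by
  rw [phi_eq]
  have := fun a => contDiff_coord x₀ a (n := n)
  fun_prop

/-! ### Elementary inequalities -/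

/-- The form `{q, B} + 4 σ q` is positive definite at `(ξ, s)`, for the weight
`|x - x₀|² - β t²` and the metric `a ds² - |ξ|²`. Here `X = |ξ|²`, `A = ∇a · ξ` and
`Y = ∇a · (x - x₀)`. -/
theorem space_form_pos {a X A Y s m θ β ω t σ : ℝ} (ha : 0 < a) (hω : 0 < ω) (hσ : σ = 1 - ω)
    (hb : β * a ≤ θ - 2 * ω) (hY : -(2 * (1 - θ) * a) ≤ Y) (hA : A ^ 2 ≤ (m * a ^ 2) ^ 2 * X)
    (hE : β ^ 2 * t ^ 2 * m ^ 2 * a ^ 3 < 4 * ω ^ 2) (hX : 0 ≤ X) (h0 : 0 < X ∨ s ≠ 0) :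
    0 < 4 * X - 4 * β * a ^ 2 * s ^ 2 + 4 * β * t * s * A + 2 * Y * s ^ 2
      + 4 * σ * (a * s ^ 2 - X) := by
  have h1 : a * ω * s ^ 2 ≤ a * (θ - β * a - ω) * s ^ 2 := by gcongr; linarith
  have h2 : -(2 * (1 - θ) * a) * s ^ 2 ≤ Y * s ^ 2 := by gcongr
  suffices 0 < ω * X + a * ω * s ^ 2 + β * t * s * A by subst hσ; nlinarith
  -- completing the square, with `(βtA)² ≤ X a (β²t²m²a³)`
  have h3 : (β * t * A) ^ 2 ≤ a * (β ^ 2 * t ^ 2 * m ^ 2 * a ^ 3) * X := by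
    calc (β * t * A) ^ 2 = (β * t) ^ 2 * A ^ 2 := by ring
      _ ≤ (β * t) ^ 2 * ((m * a ^ 2) ^ 2 * X) := by gcongr
      _ = _ := by ring
  rcases hX.eq_or_lt with h | h
  · have hA0 : β * t * A = 0 := by
      rw [← h, mul_zero] at h3
      exact pow_eq_zero_iff two_ne_zero |>.1 (le_antisymm h3 (sq_nonneg _))
    have hs : s ≠ 0 := h0.resolve_left (by rw [← h]; exact lt_irrefl _)
    have : β * t * s * A = 0 := by rw [mul_right_comm, hA0, zero_mul]
    rw [this, ← h]; positivity
  · have h4 : a * (β ^ 2 * t ^ 2 * m ^ 2 * a ^ 3) * X < a * (4 * ω ^ 2) * X := by gcongr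
    have h5 : 0 < 4 * (a * ω) * (ω * X + a * ω * s ^ 2 + β * t * s * A) := by
      nlinarith [sq_nonneg (2 * (a * ω) * s + β * t * A)]
    exact pos_of_mul_pos_right h5 (by positivity)

/-- The form `{q, B} - 4 σ q` is positive at the gradient of the weight `|x - x₀|² - β t²`, where
this gradient is not timelike. Here `X = |x - x₀|²` and `Y = ∇a · (x - x₀)`. -/
theorem zero_form_pos {a X Y m θ β ω t σ : ℝ} (ha : 0 < a) (hω : 0 < ω)
    (hθ : θ < 1) (hσ0 : 0 < σ)
    (hb : β * a ≤ θ - 2 * ω) (hβ : 0 < β) (hY : Y ^ 2 ≤ (m * a ^ 2) ^ 2 * X)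
    (hE : β ^ 2 * t ^ 2 * m ^ 2 * a ^ 3 < 4 * ω ^ 2) (hX : 0 < X)
    (hp : 4 * a * β ^ 2 * t ^ 2 - 4 * X ≤ 0) :
    0 < 16 * X - 16 * β ^ 3 * a ^ 2 * t ^ 2 - 8 * β ^ 2 * t ^ 2 * Y
      - 4 * σ * (4 * a * β ^ 2 * t ^ 2 - 4 * X) := by
  have h1 : (β ^ 2 * t ^ 2 * Y) ^ 2 ≤ (2 * ω * X) ^ 2 := by
    calc (β ^ 2 * t ^ 2 * Y) ^ 2 = (β ^ 2 * t ^ 2) ^ 2 * Y ^ 2 := by ring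
      _ ≤ (β ^ 2 * t ^ 2) ^ 2 * ((m * a ^ 2) ^ 2 * X) := by gcongr
      _ = (a * β ^ 2 * t ^ 2) * (β ^ 2 * t ^ 2 * m ^ 2 * a ^ 3) * X := by ring
      _ ≤ X * (4 * ω ^ 2) * X := by
          gcongr
          · linarith
      _ = _ := by ring
  have h2 : β ^ 2 * t ^ 2 * Y ≤ 2 * ω * X := (abs_le_of_sq_le_sq' h1 (by positivity)).2
  have h3 : β * a * (a * β ^ 2 * t ^ 2) ≤ β * a * X := by gcongr; linarith
  have h4 : σ * (a * β ^ 2 * t ^ 2) ≤ σ * X := by gcongr; linarith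
  have h5 : β * a * X ≤ (θ - 2 * ω) * X := by gcongr
  have h6 : 0 < (1 - θ + ω) * X := by
    have : 0 < 1 - θ + ω := by linarith
    positivity
  nlinarith

/-- The reverse Cauchy–Schwarz inequality for a Lorentzian form and a timelike vector. -/
theorem reverse_cauchy_schwarz {a x₀ x₁ x₂ s y₀ y₁ y₂ r : ℝ} (ha : 0 < a)
    (hp : 0 < a * r ^ 2 - (y₀ ^ 2 + y₁ ^ 2 + y₂ ^ 2)) :
    (a * r ^ 2 - (y₀ ^ 2 + y₁ ^ 2 + y₂ ^ 2)) * (a * s ^ 2 - (x₀ ^ 2 + x₁ ^ 2 + x₂ ^ 2))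
      ≤ (a * r * s - (y₀ * x₀ + y₁ * x₁ + y₂ * x₂)) ^ 2 := by
  have hr : 0 < r ^ 2 := by
    by_contra h
    have : a * r ^ 2 ≤ 0 := by nlinarith
    nlinarith [sq_nonneg y₀, sq_nonneg y₁, sq_nonneg y₂]
  set w₀ := r * x₀ - s * y₀ with h₀
  set w₁ := r * x₁ - s * y₁ with h₁
  set w₂ := r * x₂ - s * y₂ with h₂
  -- Lagrange's identity, after the shift `x ↦ x - (s / r) y`
  have key : r ^ 2 * ((a * r * s - (y₀ * x₀ + y₁ * x₁ + y₂ * x₂)) ^ 2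
      - (a * r ^ 2 - (y₀ ^ 2 + y₁ ^ 2 + y₂ ^ 2)) * (a * s ^ 2 - (x₀ ^ 2 + x₁ ^ 2 + x₂ ^ 2)))
      = (a * r ^ 2 - (y₀ ^ 2 + y₁ ^ 2 + y₂ ^ 2)) * (w₀ ^ 2 + w₁ ^ 2 + w₂ ^ 2)
        + (y₀ * w₀ + y₁ * w₁ + y₂ * w₂) ^ 2 := by
    rw [h₀, h₁, h₂]; ring
  have : 0 ≤ r ^ 2 * ((a * r * s - (y₀ * x₀ + y₁ * x₁ + y₂ * x₂)) ^ 2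
      - (a * r ^ 2 - (y₀ ^ 2 + y₁ ^ 2 + y₂ ^ 2)) * (a * s ^ 2 - (x₀ ^ 2 + x₁ ^ 2 + x₂ ^ 2))) := by
    rw [key]; positivity
  linarith [nonneg_of_mul_nonneg_right this hr]

/-- Passing from the weight `ψ` to `φ = e^{γψ}`, where `f = γ φ`, adds the square of `B`. -/
theorem commForm_scale (g : Fin 4 → ℝ) (dg : Fin 4 → Fin 4 → ℝ) (p : Fin 4 → ℝ)
    (pp : Fin 4 → Fin 4 → ℝ) (f γ : ℝ) (ξ : Fin 4 → ℝ) :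
    commForm g dg (fun a => f * p a) (fun a b => f * (pp a b + γ * p a * p b)) ξ
      = f * (commForm g dg p pp ξ + 2 * γ * bf g p ξ ^ 2) := by
  simp only [commForm, bf, Fin.sum_univ_four]; ring

/-- Continuous families of positive definite forms are uniformly positive over a compact set. -/
theorem exists_pos_form_lower {X : Type*} [TopologicalSpace X] {K : Set X} (hK : IsCompact K)
    (F : X → (Fin 4 → ℝ) → ℝ) (hF : Continuous fun p : X × (Fin 4 → ℝ) => F p.1 p.2)
    (hom : ∀ z r ξ, F z (fun a => r * ξ a) = r ^ 2 * F z ξ)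
    (hpos : ∀ z ∈ K, ∀ ξ, ξ ≠ 0 → 0 < F z ξ) :
    ∃ δ > 0, ∀ z ∈ K, ∀ ξ, δ * ∑ a, ξ a ^ 2 ≤ F z ξ := by
  set S : Set (Fin 4 → ℝ) := {ξ | ∑ a, ξ a ^ 2 = 1} with hS
  have hSc : IsCompact S := by
    refine Metric.isCompact_of_isClosed_isBounded (isClosed_eq (by fun_prop) continuous_const) ?_
    refine (Metric.isBounded_closedBall (x := (0 : Fin 4 → ℝ)) (r := 1)).subset fun ξ hξ => ?_
    rw [mem_closedBall_zero_iff, pi_norm_le_iff_of_nonneg zero_le_one]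
    intro a
    rw [Real.norm_eq_abs, ← sq_le_one_iff_abs_le_one, ← show ∑ a, ξ a ^ 2 = 1 from hξ]
    exact Finset.single_le_sum (f := fun a => ξ a ^ 2) (fun _ _ => sq_nonneg _) (Finset.mem_univ a)
  have hδ : ∃ δ > 0, ∀ p ∈ K ×ˢ S, δ ≤ F p.1 p.2 := by
    rcases (K ×ˢ S).eq_empty_or_nonempty with h | h
    · exact ⟨1, one_pos, by simp [h]⟩
    · obtain ⟨p, hp, hmin⟩ := (hK.prod hSc).exists_isMinOn h hF.continuousOn
      refine ⟨F p.1 p.2, hpos _ hp.1 _ fun h0 => ?_, fun q hq => hmin hq⟩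
      have := hp.2
      simp [hS, h0] at this
  obtain ⟨δ, hδ, H⟩ := hδ
  refine ⟨δ, hδ, fun z hz ξ => ?_⟩
  have hn : 0 ≤ ∑ a, ξ a ^ 2 := Finset.sum_nonneg fun _ _ => sq_nonneg _
  rcases hn.eq_or_lt with h | h
  · have : ξ = fun a => 0 * ξ a := by
      ext a
      have := (Finset.sum_eq_zero_iff_of_nonneg (fun a _ => sq_nonneg (ξ a))).1 h.symm a
        (Finset.mem_univ a)
      simpa using this
    rw [← h, this, hom]; simp
  · set r := √(∑ a, ξ a ^ 2) with hr
    have hr2 : r ^ 2 = ∑ a, ξ a ^ 2 := Real.sq_sqrt hn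
    have hr0 : 0 < r := Real.sqrt_pos.2 h
    have h1 := H (z, fun a => r⁻¹ * ξ a) ⟨hz, by
      simp only [hS, mem_ofPred_eq, mul_pow, ← Finset.mul_sum, ← hr2]; field_simp⟩
    rw [hom] at h1
    rw [← hr2]
    calc δ * r ^ 2 ≤ (r⁻¹ ^ 2 * F z ξ) * r ^ 2 := by gcongr
      _ = F z ξ := by field_simp

theorem exists_pos_lower {X : Type*} [TopologicalSpace X] {K : Set X} (hK : IsCompact K)
    {f : X → ℝ} (hf : ContinuousOn f K) (hpos : ∀ z ∈ K, 0 < f z) :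
    ∃ δ > 0, ∀ z ∈ K, δ ≤ f z := by
  rcases K.eq_empty_or_nonempty with h | h
  · exact ⟨1, one_pos, by simp [h]⟩
  · obtain ⟨p, hp, hmin⟩ := hK.exists_isMinOn h hf
    exact ⟨f p, hpos _ hp, fun q hq => hmin hq⟩

/-! ### Strong pseudoconvexity of the weight -/

theorem D_metric_sp (c : Space → ℝ) (a : Fin 4) (i : Fin 3) (z : Spacetime) :
    D a (metric c (sp i)) z = 0 := by
  rw [metric_sp]; exact (HasD.const _).2

theorem D_metric_tm_tm {c : Space → ℝ} (hc : Differentiable ℝ c) (z : Spacetime) :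
    D tm (metric c tm) z = 0 := by
  rw [metric_tm]; exact (hasD_tm (hc _)).2

/-- The form `{q, B}` for the metric `c dt² - |dx|²` and the weight `|x - x₀|² - β t²`. -/
theorem commForm_metric {c : Space → ℝ} (hc : Differentiable ℝ c) (x₀ : Space) (β : ℝ)
    (z : Spacetime) (ξ : Fin 4 → ℝ) :
    commForm (metric c · z) (fun a b => D a (metric c b) z) (fun b => hess β b * coord x₀ b z)
      (fun a b => if a = b then hess β b else 0) ξ
      = 4 * (∑ i, ξ (sp i) ^ 2) - 4 * β * c z.1 ^ 2 * ξ tm ^ 2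
        + 4 * β * z.2 * ξ tm * (∑ i, pd c i z.1 * ξ (sp i))
        + 2 * (∑ i, pd c i z.1 * (z.1 i - x₀ i)) * ξ tm ^ 2 := by
  have e1 : sp 0 ≠ sp 1 := by decide
  have e2 : sp 0 ≠ sp 2 := by decide
  have e3 : sp 1 ≠ sp 2 := by decide
  have f : ∀ i : Fin 3, sp i ≠ tm := fun i => (Fin.castSucc_lt_last i).ne
  have d0 : ∀ a, D a (fun _ => (-1 : ℝ)) z = 0 := fun a => (HasD.const _).2
  have d1 : D tm (fun z => c z.1) z = 0 := (hasD_tm (hc _)).2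
  have d2 : ∀ i, D (sp i) (fun z => c z.1) z = pd c i z.1 := fun i => (hasD_sp (hc _) i).2
  simp only [commForm, sum_fin_four, Fin.sum_univ_three, d0, d1, d2, metric_sp, metric_tm,
    hess_sp, hess_tm, coord_sp, coord_tm, e1, e2, e3, e1.symm, e2.symm, e3.symm, f, (f _).symm,
    if_true, if_false]
  ring

theorem qf_metric (c : Space → ℝ) (z : Spacetime) (ξ : Fin 4 → ℝ) :
    qf (metric c · z) ξ
      = c z.1 * ξ tm ^ 2 - (ξ (sp 0) ^ 2 + ξ (sp 1) ^ 2 + ξ (sp 2) ^ 2) := by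
  simp only [qf, sum_fin_four, metric_sp, metric_tm]
  ring

theorem bf_metric (c : Space → ℝ) (z : Spacetime) (ξ η : Fin 4 → ℝ) :
    bf (metric c · z) ξ η = c z.1 * ξ tm * η tm
      - (ξ (sp 0) * η (sp 0) + ξ (sp 1) * η (sp 1) + ξ (sp 2) * η (sp 2)) := by
  simp only [bf, sum_fin_four, metric_sp, metric_tm]
  ring

theorem fderiv_eq_sum_pd (c : Space → ℝ) (x v : Space) :
    fderiv ℝ c x v = ∑ i, pd c i x * v i := by
  have : v = ∑ i, v i • EuclideanSpace.single i (1 : ℝ) := by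
    ext j; simp [Pi.single_apply]
  conv_lhs => rw [this]
  simp [pd, mul_comm]

theorem sum_pd_mul_sq_le (c : Space → ℝ) (x : Space) {M : ℝ} (h : ‖fderiv ℝ c x‖ ≤ M)
    (ξ : Fin 3 → ℝ) : (∑ i, pd c i x * ξ i) ^ 2 ≤ M ^ 2 * ∑ i, ξ i ^ 2 := by
  have e := fderiv_eq_sum_pd c x (WithLp.toLp 2 ξ)
  simp only at e
  rw [← e, ← sq_abs]
  have h1 : |fderiv ℝ c x (WithLp.toLp 2 ξ)| ≤ M * ‖WithLp.toLp 2 ξ‖ :=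
    (ContinuousLinearMap.le_opNorm _ _).trans (mul_le_mul_of_nonneg_right h (norm_nonneg _))
  calc _ ≤ (M * ‖WithLp.toLp 2 ξ‖) ^ 2 := by gcongr
    _ = _ := by rw [mul_pow, EuclideanSpace.norm_sq_eq]; simp

/-- The smallness of `|t|`, in terms of the reciprocal `a ≤ 1 / c₀` of the speed and in the form in
which it bounds the cross terms `2 β t s (∇a · ξ)`. -/
theorem speed_time_bound {m β t c₀ ω a : ℝ} (hm : 0 < m) (hβ : 0 < β) (hc₀ : 0 < c₀) (ha : 0 < a)
    (hac : a * c₀ ≤ 1) (h : m / √c₀ * (β * |t|) < 2 * ω * c₀) :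
    β ^ 2 * t ^ 2 * m ^ 2 * a ^ 3 < 4 * ω ^ 2 := by
  have hs : 0 < √c₀ := Real.sqrt_pos.2 hc₀
  have h1 : m * (β * |t|) < 2 * ω * c₀ * √c₀ := by
    rwa [div_mul_eq_mul_div, div_lt_iff₀ hs] at h
  have h2 : (m * (β * |t|)) ^ 2 < (2 * ω * c₀ * √c₀) ^ 2 := by
    gcongr
  have h3 : (2 * ω * c₀ * √c₀) ^ 2 = 4 * ω ^ 2 * c₀ ^ 3 := by
    rw [mul_pow, Real.sq_sqrt hc₀.le]; ring
  have h4 : (m * (β * |t|)) ^ 2 = m ^ 2 * β ^ 2 * t ^ 2 := by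
    rw [mul_pow, mul_pow, sq_abs]; ring
  rw [h3, h4] at h2
  calc β ^ 2 * t ^ 2 * m ^ 2 * a ^ 3 = m ^ 2 * β ^ 2 * t ^ 2 * a ^ 3 := by ring
    _ < 4 * ω ^ 2 * c₀ ^ 3 * a ^ 3 := by gcongr
    _ = 4 * ω ^ 2 * (a * c₀) ^ 3 := by ring
    _ ≤ 4 * ω ^ 2 * 1 := by
        gcongr
        exact pow_le_one₀ (by positivity) hac
    _ = _ := mul_one _

set_option maxHeartbeats 1000000 in
/-- Strong pseudoconvexity of `φ = e^{γψ}`, `ψ = |x - x₀|² - β t²`, for the operator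
`c ∂_t² - Δ`; the hypotheses are stated for the reciprocal speed `c`. Up to the positive factor
`γ φ` the multiplier is `k = -4σ + N p χ(p)`, where `p = q(∇ψ)`, `σ = 1 - ω`, `2ω = θ - β / c₀` and
`χ` is a smooth cutoff supported in `p ≥ 0`. The constant part makes `{q, B} - k q` positive
definite, and makes `{q, B} + k q` positive at `∇ψ` where `p ≤ 0`. Where `p > 0` the second
condition holds for `N` large, and the first one survives modulo `B²` because there
`p q(ξ) ≤ B(ξ)²`, by the reverse Cauchy–Schwarz inequality. No largeness of `γ` is needed. -/
theorem exists_pseudoconvex {c : Space → ℝ} (hc : ContDiff ℝ 1 c) {K : Set Spacetime}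
    (hK : IsCompact K) {x₀ : Space} {m θ β γ c₀ : ℝ} (hm : 0 < m) (hθ : θ < 1) (hβ : 0 < β)
    (hγ : 0 < γ) (hc₀ : 0 < c₀) (hβθ : β < θ * c₀)
    (h1 : ∀ z ∈ K, 0 < c z.1 ∧ c z.1 * c₀ ≤ 1)
    (h2 : ∀ z ∈ K, ‖fderiv ℝ c z.1‖ ≤ m * c z.1 ^ 2)
    (h3 : ∀ z ∈ K, -(2 * (1 - θ) * c z.1) ≤ fderiv ℝ c z.1 (z.1 - x₀))
    (h4 : ∀ z ∈ K, β + m / √c₀ * (β * |z.2|) < θ * c₀)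
    (h5 : ∀ z ∈ K, z.1 ≠ x₀) :
    ∃ k κ δ, Pseudoconvex (metric c) (phi x₀ β γ) k K κ δ := by
  have hcd : Differentiable ℝ c := hc.differentiable (by norm_num)
  have hcc := hc.continuous
  set ω := (θ - β / c₀) / 2 with hω
  have hω0 : 0 < ω := by
    have : β / c₀ < θ := by rwa [div_lt_iff₀ hc₀]
    rw [hω]; linarith
  have hω2 : 2 * ω * c₀ = θ * c₀ - β := by rw [hω]; field_simp
  have hβc : β / c₀ = θ - 2 * ω := by rw [hω]; ring
  have hβc0 : 0 < β / c₀ := by positivity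
  set σ := 1 - ω with hσ
  have hσ0 : 0 < σ := by rw [hσ]; linarith
  have hb : ∀ z ∈ K, β * c z.1 ≤ θ - 2 * ω := fun z hz => by
    rw [← hβc, le_div_iff₀ hc₀]
    nlinarith [(h1 z hz).2]
  have hE : ∀ z ∈ K, β ^ 2 * z.2 ^ 2 * m ^ 2 * c z.1 ^ 3 < 4 * ω ^ 2 := fun z hz =>
    speed_time_bound hm hβ hc₀ (h1 z hz).1 (h1 z hz).2 (by linarith [h4 z hz])
  -- first derivatives, and the form, for the function `|x - x₀|² - β t²` in the exponent
  set ψ' : Spacetime → Fin 4 → ℝ := fun z b => hess β b * coord x₀ b z with hψ'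
  set Q : Spacetime → (Fin 4 → ℝ) → ℝ := fun z ξ =>
    4 * (∑ i, ξ (sp i) ^ 2) - 4 * β * c z.1 ^ 2 * ξ tm ^ 2
        + 4 * β * z.2 * ξ tm * (∑ i, pd c i z.1 * ξ (sp i))
        + 2 * (∑ i, pd c i z.1 * (z.1 i - x₀ i)) * ξ tm ^ 2 with hQ
  have hφ0 : ∀ z, 0 < γ * phi x₀ β γ z := fun z => mul_pos hγ (Real.exp_pos _)
  have hcomm : ∀ z ξ, commForm (metric c · z) (fun a b => D a (metric c b) z)
      (D · (phi x₀ β γ) z) (fun a b => D a (D b (phi x₀ β γ)) z) ξ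
      = γ * phi x₀ β γ z * (Q z ξ + 2 * γ * bf (metric c · z) (ψ' z) ξ ^ 2) := by
    intro z ξ
    rw [hQ]
    simp only
    rw [← commForm_metric hcd, ← commForm_scale]
    simp only [DD_phi]
    simp only [D_phi]
  set p : Spacetime → ℝ := fun z => qf (metric c · z) (ψ' z) with hp
  have hp' : ∀ z, p z = 4 * c z.1 * β ^ 2 * z.2 ^ 2 - 4 * ∑ i, (z.1 i - x₀ i) ^ 2 := by
    intro z
    simp only [hp, hψ', qf_metric, Fin.sum_univ_three, hess_sp, hess_tm, coord_sp, coord_tm]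
    ring
  have hx1 : ∀ i : Fin 3, ContDiff ℝ 1 fun z : Spacetime => z.1 i - x₀ i := fun i => by
    have := contDiff_coord x₀ (sp i) (n := 1); rwa [coord_sp] at this
  have hc1 : ContDiff ℝ 1 fun z : Spacetime => c z.1 := hc.comp contDiff_fst
  have hpC : ContDiff ℝ 1 p := by
    rw [funext hp']
    have : ContDiff ℝ 1 fun z : Spacetime => z.2 := contDiff_snd
    fun_prop
  have hpdC : ∀ i, Continuous (pd c i) := fun i =>
    (hc.continuous_fderiv (by norm_num)).clm_apply continuous_const
  have hφC : ContDiff ℝ 3 (phi x₀ β γ) := contDiff_phi x₀ β γ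
  have hφC1 : ContDiff ℝ 1 (phi x₀ β γ) := contDiff_phi x₀ β γ
  have hφc := hφC.continuous
  have hQC : Continuous fun q : Spacetime × (Fin 4 → ℝ) => Q q.1 q.2 := by
    have := hx1 0 |>.continuous
    have := hx1 1 |>.continuous
    have := hx1 2 |>.continuous
    simp only [hQ, Fin.sum_univ_three]
    fun_prop
  have hψC : ∀ b, Continuous fun z => ψ' z b := fun b =>
    continuous_const.mul (contDiff_coord x₀ b (n := 0)).continuous
  -- the zero-order condition for the constant part of the multiplier: positive where the gradient
  -- of the weight is not timelike
  set S₀ : Spacetime → ℝ := fun z => Q z (ψ' z) - 4 * σ * p z + 2 * γ * p z ^ 2 with hS₀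
  have hS₀C : Continuous S₀ := by
    have h1 : Continuous fun z => Q z (ψ' z) :=
      hQC.comp (f := fun z => (z, ψ' z)) (continuous_id.prodMk (continuous_pi hψC))
    have := hpC.continuous
    fun_prop
  have hy0 : ∀ z ∈ K, 0 < ∑ i, (z.1 i - x₀ i) ^ 2 := fun z hz => by
    have : 0 < ‖z.1 - x₀‖ ^ 2 := by
      have := norm_pos_iff.2 (sub_ne_zero.2 (h5 z hz)); positivity
    rw [EuclideanSpace.norm_sq_eq] at this
    simpa using this
  have hS₀pos : ∀ z ∈ K, p z ≤ 0 → 0 < S₀ z := by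
    intro z hz hpz
    have hY := sum_pd_mul_sq_le c z.1 (h2 z hz) fun i => z.1 i - x₀ i
    have := zero_form_pos (h1 z hz).1 hω0 hθ hσ0 (hb z hz) hβ hY (hE z hz) (hy0 z hz)
      (by rw [← hp']; exact hpz)
    have hγp : 0 ≤ 2 * γ * p z ^ 2 := by positivity
    have e : Q z (ψ' z) - 4 * σ * p z = 16 * (∑ i, (z.1 i - x₀ i) ^ 2)
        - 16 * β ^ 3 * c z.1 ^ 2 * z.2 ^ 2
        - 8 * β ^ 2 * z.2 ^ 2 * (∑ i, pd c i z.1 * (z.1 i - x₀ i))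
        - 4 * σ * (4 * c z.1 * β ^ 2 * z.2 ^ 2 - 4 * (∑ i, (z.1 i - x₀ i) ^ 2)) := by
      rw [hp']
      simp only [hQ, hψ', hess_sp, hess_tm, coord_sp, coord_tm, Fin.sum_univ_three]
      ring
    simp only [hS₀]
    linarith
  have hform : ∀ z ∈ K, ∀ ξ, ξ ≠ 0 → 0 < Q z ξ + 4 * σ * qf (metric c · z) ξ := by
    intro z hz ξ hξ
    have hA := sum_pd_mul_sq_le c z.1 (h2 z hz) fun i => ξ (sp i)
    have hY : -(2 * (1 - θ) * c z.1) ≤ ∑ i, pd c i z.1 * (z.1 i - x₀ i) := by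
      have := h3 z hz
      rw [fderiv_eq_sum_pd] at this
      simpa using this
    have hX : 0 ≤ ∑ i : Fin 3, ξ (sp i) ^ 2 := Finset.sum_nonneg fun _ _ => sq_nonneg _
    have := space_form_pos (s := ξ tm) (h1 z hz).1 hω0 hσ (hb z hz) hY hA (hE z hz) hX (by
      by_contra hcon
      push Not at hcon
      apply hξ
      have hz0 := (Finset.sum_eq_zero_iff_of_nonneg (fun i _ => sq_nonneg (ξ (sp i)))).1
        (le_antisymm hcon.1 hX)
      ext b
      induction b using Fin.lastCases with
      | last => exact hcon.2
      | cast i => simpa using hz0 i (Finset.mem_univ i))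
    simp only [hQ, qf_metric]
    simp only [Fin.sum_univ_three] at this ⊢
    linarith
  -- the second part of the multiplier, supported in the timelike region
  set χ : Spacetime → ℝ := fun z => expNegInvGlue (p z) with hχ
  have hχC : ContDiff ℝ 1 χ := expNegInvGlue.contDiff.comp hpC
  have hχ0 : ∀ z, 0 ≤ χ z := fun z => expNegInvGlue.nonneg _
  obtain ⟨M, hM, hM'⟩ := exists_abs_le hK hS₀C.continuousOn
  have hKS : IsCompact (K ∩ {z | S₀ z ≤ 0}) :=
    hK.inter_right (isClosed_le hS₀C continuous_const)
  obtain ⟨ε, hε, hε'⟩ := exists_pos_lower hKS (f := fun z => p z ^ 2 * χ z)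
    (by have := hpC.continuous; have := hχC.continuous; fun_prop) (by
      rintro z ⟨hz, hz0⟩
      have hpz : 0 < p z := by
        by_contra h
        exact absurd (hS₀pos z hz (not_lt.1 h)) (not_lt.2 hz0)
      have : 0 < χ z := expNegInvGlue.pos_of_pos hpz
      positivity)
  set N := (M + 1) / ε with hN
  have hN0 : 0 < N := by positivity
  have hzero : ∀ z ∈ K, 0 < S₀ z + N * (p z ^ 2 * χ z) := by
    intro z hz
    by_cases h : S₀ z ≤ 0
    · have h7 := hε' z ⟨hz, h⟩
      have h8 : M + 1 ≤ N * (p z ^ 2 * χ z) := by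
        calc M + 1 = N * ε := by rw [hN]; field_simp
          _ ≤ _ := by gcongr
      linarith [(abs_le.1 (hM' z hz)).1]
    · have := hχ0 z
      have : 0 ≤ N * (p z ^ 2 * χ z) := by positivity
      linarith
  obtain ⟨M₂, hM₂, hM₂'⟩ := exists_abs_le hK hχC.continuous.continuousOn
  obtain ⟨f₀, hf₀, hf₀'⟩ := exists_pos_lower hK (f := fun z => γ * phi x₀ β γ z)
    (by fun_prop) fun z _ => hφ0 z
  set κ := N * M₂ / f₀ with hκ
  have hκ0 : 0 < κ := by positivity
  set k : Spacetime → ℝ := fun z => γ * phi x₀ β γ z * (-4 * σ + N * (p z * χ z)) with hk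
  set F : Spacetime → (Fin 4 → ℝ) → ℝ := fun z ξ =>
    γ * phi x₀ β γ z * (Q z ξ + 2 * γ * bf (metric c · z) (ψ' z) ξ ^ 2)
      - k z * qf (metric c · z) ξ
      + κ * (γ * phi x₀ β γ z * bf (metric c · z) (ψ' z) ξ) ^ 2 with hF
  have hkC : ContDiff ℝ 1 k := by rw [hk]; fun_prop
  have hFC : Continuous fun q : Spacetime × (Fin 4 → ℝ) => F q.1 q.2 := by
    have := hkC.continuous
    have := hψC
    simp only [hF, qf_metric, bf_metric]
    fun_prop
  have hFhom : ∀ z r ξ, F z (fun a => r * ξ a) = r ^ 2 * F z ξ := by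
    intro z r ξ
    simp only [hF, hQ, qf_metric, bf_metric, Fin.sum_univ_three]
    ring
  have hFpos : ∀ z ∈ K, ∀ ξ, ξ ≠ 0 → 0 < F z ξ := by
    intro z hz ξ hξ
    have hf := hφ0 z
    set f := γ * phi x₀ β γ z with hfdef
    set B := bf (metric c · z) (ψ' z) ξ with hB
    set q := qf (metric c · z) ξ with hq
    have hrev : p z * χ z * q ≤ χ z * B ^ 2 := by
      by_cases hpz : 0 < p z
      · have : p z * q ≤ B ^ 2 := by
          have e : p z = _ := qf_metric c z (ψ' z)
          rw [hq, hB, e, qf_metric, bf_metric]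
          exact reverse_cauchy_schwarz (h1 z hz).1 (by rw [← e]; exact hpz)
        calc p z * χ z * q = χ z * (p z * q) := by ring
          _ ≤ _ := by have := hχ0 z; gcongr
      · have : χ z = 0 := expNegInvGlue.zero_of_nonpos (not_lt.1 hpz)
        rw [this]; simp
    have hκB : N * (χ z * B ^ 2) ≤ κ * f * B ^ 2 := by
      have e1 : χ z ≤ M₂ := (le_abs_self _).trans (hM₂' z hz)
      have e2 : N * M₂ ≤ κ * f := by
        calc N * M₂ = κ * f₀ := by rw [hκ]; field_simp
          _ ≤ κ * f := by gcongr; exact hf₀' z hz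
      calc N * (χ z * B ^ 2) ≤ N * (M₂ * B ^ 2) := by gcongr
        _ = (N * M₂) * B ^ 2 := by ring
        _ ≤ _ := by gcongr
    have h10 : N * (p z * χ z * q) ≤ N * (χ z * B ^ 2) := by gcongr
    have h11 := hform z hz ξ hξ
    have e : F z ξ = f * ((Q z ξ + 4 * σ * q) + 2 * γ * B ^ 2
        + (κ * f * B ^ 2 - N * (p z * χ z * q))) := by
      simp only [hF, hk]; ring
    rw [e]
    have : 0 ≤ 2 * γ * B ^ 2 := by positivity
    exact mul_pos hf (by linarith)
  obtain ⟨δ₁, hδ₁, hδ₁'⟩ := exists_pos_form_lower hK F hFC hFhom hFpos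
  obtain ⟨δ₂, hδ₂, hδ₂'⟩ := exists_pos_lower hK
    (f := fun z => (γ * phi x₀ β γ z) ^ 3 * (S₀ z + N * (p z ^ 2 * χ z)))
    (by have := hpC.continuous; have := hχC.continuous; fun_prop)
    fun z hz => mul_pos (pow_pos (hφ0 z) 3) (hzero z hz)
  have hDφ : ∀ z, (fun a => D a (phi x₀ β γ) z) = fun a => γ * phi x₀ β γ z * ψ' z a := by
    intro z; ext a; rw [D_phi]
  refine ⟨k, κ, min δ₁ δ₂, ?_, ?_, hφC, hkC, lt_min hδ₁ hδ₂, ?_, ?_⟩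
  · intro b
    induction b using Fin.lastCases with
    | last => rw [metric_tm]; exact hc1
    | cast i => rw [metric_sp]; exact contDiff_const
  · intro b z
    induction b using Fin.lastCases with
    | last => exact D_metric_tm_tm hcd z
    | cast i => exact D_metric_sp c _ i z
  · intro z hz ξ
    rw [hcomm]
    refine (mul_le_mul_of_nonneg_right (min_le_left _ _)
      (Finset.sum_nonneg fun _ _ => sq_nonneg _)).trans ((hδ₁' z hz ξ).trans_eq ?_)
    simp only [hF]
    rw [hDφ z]
    congr 3
    simp only [bf_metric]; ring
  · intro z hz
    rw [hcomm]
    refine (min_le_right _ _).trans ((hδ₂' z hz).trans_eq ?_)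
    have e1 : Q z (fun a => D a (phi x₀ β γ) z) = (γ * phi x₀ β γ z) ^ 2 * Q z (ψ' z) := by
      rw [hDφ z]; simp only [hQ, Fin.sum_univ_three]; ring
    have e2 : bf (metric c · z) (ψ' z) (fun a => D a (phi x₀ β γ) z)
        = γ * phi x₀ β γ z * p z := by
      rw [hDφ z]; simp only [hp, bf_metric, qf_metric]; ring
    have e3 : qf (metric c · z) (fun a => D a (phi x₀ β γ) z)
        = (γ * phi x₀ β γ z) ^ 2 * p z := by
      rw [hDφ z]; simp only [hp, qf_metric]; ring
    rw [e1, e2, e3]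
    simp only [hS₀, hk]
    ring

/-! ### Cutoffs -/

theorem exists_cutoff {E : Type*} [NormedAddCommGroup E] [NormedSpace ℝ E]
    [FiniteDimensional ℝ E] {K U : Set E} (hK : IsCompact K) (hU : IsOpen U) (hKU : K ⊆ U) :
    ∃ χ : E → ℝ, ContDiff ℝ (⊤ : ℕ∞) χ ∧ HasCompactSupport χ ∧ tsupport χ ⊆ U ∧
      ∀ x ∈ K, χ =ᶠ[nhds x] fun _ => 1 := by
  obtain ⟨L, hL, hKL, hLU⟩ := exists_compact_between hK hU hKU
  obtain ⟨f, hf1, hf0, -⟩ := exists_contMDiffMap_one_nhds_of_subset_interior (n := (⊤ : ℕ∞))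
    (modelWithCornersSelf ℝ E) hK.isClosed hKL
  have hs : tsupport (f : E → ℝ) ⊆ L := by
    refine closure_minimal (fun x hx => ?_) hL.isClosed
    by_contra h
    exact hx (hf0 x h)
  exact ⟨f, f.contMDiff.contDiff, hL.of_isClosed_subset (isClosed_tsupport _) hs, hs.trans hLU,
    fun x hx => (Filter.eventually_of_mem hf1 fun _ h => h).filter_mono
      (nhds_le_nhdsSet hx)⟩

/-- A function of class `C^n` on an open set agrees, near a given compact subset, with a
compactly supported function of class `C^n` on the whole space. -/
theorem exists_contDiff_extension {E : Type*} [NormedAddCommGroup E] [NormedSpace ℝ E]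
    [FiniteDimensional ℝ E] {n : ℕ∞} {K U : Set E} (hK : IsCompact K) (hU : IsOpen U)
    (hKU : K ⊆ U) {c : E → ℝ} (hc : ∀ x ∈ U, ContDiffAt ℝ n c x) :
    ∃ c' : E → ℝ, ContDiff ℝ n c' ∧ HasCompactSupport c' ∧ ∀ x ∈ K, c' =ᶠ[nhds x] c := by
  obtain ⟨χ, hχ, hχc, hχU, hχ1⟩ := exists_cutoff hK hU hKU
  refine ⟨fun x => χ x * c x, contDiff_iff_contDiffAt.2 fun x => ?_,
    hχc.mul_right, fun x hx => ?_⟩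
  · by_cases hx : x ∈ U
    · exact (hχ.contDiffAt.of_le (by exact_mod_cast le_top)).mul (hc x hx)
    · have : (fun x => χ x * c x) =ᶠ[nhds x] fun _ => 0 := by
        filter_upwards [notMem_tsupport_iff_eventuallyEq.1 fun h => hx (hχU h)] with y hy
        simp [hy]
      exact contDiffAt_const.congr_of_eventuallyEq this
  · filter_upwards [hχ1 x hx] with y hy
    simp [hy]

/-! ### The wave operator with a variable speed -/

/-- The spatial Laplacian. -/
def lap (f : Spacetime → ℝ) (z : Spacetime) : ℝ := ∑ j, D (sp j) (D (sp j) f) z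

/-- The scalar Carleman estimate on `K`, for the operator `∂_t² - c Δ`. The equation enters only
through a pointwise bound `f` of its square on `K`, which leaves room for terms in `w` itself and in
the other unknowns of a coupled system. -/
def WaveCarleman (K : Set Spacetime) (φ : Spacetime → ℝ) (c : Space → ℝ) : Prop :=
  ∃ τs > 0, ∃ C > 0, ∀ τ ≥ τs, ∀ w : Spacetime → ℝ, ContDiff ℝ 2 w → tsupport w ⊆ K →
    ∀ f : Spacetime → ℝ, Integrable (fun z => f z * Real.exp (2 * τ * φ z)) →
      (∀ z, 0 ≤ f z) → (∀ z ∈ K, (D tm (D tm w) z - c z.1 * lap w z) ^ 2 ≤ f z) →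
      ∫ z, (τ * ∑ a, D a w z ^ 2 + τ ^ 3 * w z ^ 2) * Real.exp (2 * τ * φ z)
        ≤ C * ∫ z, f z * Real.exp (2 * τ * φ z)

/-- The Carleman estimate for a wave speed of the given class: the operator is divided by `c`, and
the conditions on `c` turn into those on `1 / c` in `exists_pseudoconvex`. -/
theorem waveCarleman_of_speedClass {Ω : Set Space} (hΩ : IsOpen Ω) {x₀ : Space} (hx₀ : x₀ ∉ Ω)
    {m θ cs c₀ β γ : ℝ} {c : Space → ℝ} (h : SpeedClass Ω x₀ m θ cs c) (hm : 0 < m) (hθ : θ < 1)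
    (hβ : 0 < β) (hγ : 0 < γ) (hc₀ : 0 < c₀) (hcs : c₀ ≤ cs) (hβθ : β < θ * c₀)
    {K : Set Spacetime} (hK : IsCompact K) (hKΩ : ∀ z ∈ K, z.1 ∈ Ω)
    (hKt : ∀ z ∈ K, β + m / √c₀ * (β * |z.2|) < θ * c₀) :
    WaveCarleman K (phi x₀ β γ) c := by
  have hcΩ : ∀ x ∈ Ω, c₀ < c x := fun x hx => hcs.trans_lt (h.lower x (subset_closure hx))
  have hcC : ∀ x ∈ Ω, ContDiffAt ℝ 2 c x := fun x hx => h.isC2.1.contDiffAt (hΩ.mem_nhds hx)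
  have hc1 : ∀ x ∈ Ω, ContDiffAt ℝ ((1 : ℕ∞) : WithTop ℕ∞) (fun x => (c x)⁻¹) x := fun x hx =>
    ((hcC x hx).of_le (by norm_num)).inv (hc₀.trans (hcΩ x hx)).ne'
  have hK1 : IsCompact (Prod.fst '' K) := hK.image continuous_fst
  have hKΩ1 : Prod.fst '' K ⊆ Ω := by rintro _ ⟨z, hz, rfl⟩; exact hKΩ z hz
  obtain ⟨a, haC, -, ha⟩ := exists_contDiff_extension hK1 hΩ hKΩ1 hc1
  have haC : ContDiff ℝ 1 a := haC
  have ha1 : ∀ z ∈ K, a z.1 = (c z.1)⁻¹ := fun z hz => (ha z.1 ⟨z, hz, rfl⟩).self_of_nhds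
  have ha' : ∀ z ∈ K, fderiv ℝ a z.1 = -(c z.1 ^ 2)⁻¹ • fderiv ℝ c z.1 := fun z hz => by
    rw [(ha z.1 ⟨z, hz, rfl⟩).fderiv_eq]
    have hd := ((hcC z.1 (hKΩ z hz)).differentiableAt (by norm_num)).hasFDerivAt
    have hne := (hc₀.trans (hcΩ z.1 (hKΩ z hz))).ne'
    exact ((hasDerivAt_inv hne).comp_hasFDerivAt z.1 hd).fderiv
  obtain ⟨k, κ, δ, H⟩ := exists_pseudoconvex (x₀ := x₀) (γ := γ) haC hK hm hθ hβ hγ hc₀ hβθ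
    (fun z hz => by
      have := hcΩ z.1 (hKΩ z hz)
      have h0 := hc₀.trans this
      rw [ha1 z hz]
      refine ⟨by positivity, ?_⟩
      rw [inv_mul_le_one₀ h0]; exact this.le)
    (fun z hz => by
      have h0 := hc₀.trans (hcΩ z.1 (hKΩ z hz))
      have := h.norm_le 1 (by norm_num) z.1 (hKΩ z hz)
      rw [norm_iteratedFDeriv_one] at this
      rw [ha' z hz, norm_smul, ha1 z hz, norm_neg, Real.norm_of_nonneg (by positivity), inv_pow,
        mul_comm]
      gcongr)
    (fun z hz => by
      have h0 := hc₀.trans (hcΩ z.1 (hKΩ z hz))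
      have := h.radial z.1 (hKΩ z hz)
      rw [div_le_iff₀ (by positivity)] at this
      rw [ha' z hz, ha1 z hz]
      simp only [smul_apply, smul_eq_mul, neg_mul]
      rw [neg_le_neg_iff]
      calc _ ≤ (c z.1 ^ 2)⁻¹ * ((1 - θ) * (2 * c z.1)) := by gcongr
        _ = _ := by field_simp)
    hKt (fun z hz hx => hx₀ (hx ▸ hKΩ z hz))
  obtain ⟨τs, hτs, C, hC, main⟩ := H.carleman hK
  refine ⟨τs, hτs, C * (1 / c₀ ^ 2), by positivity, fun τ hτ w hw hwK f hfi hf0 hf => ?_⟩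
  refine (main τ hτ w hw hwK).trans ?_
  rw [mul_assoc]
  refine mul_le_mul_of_nonneg_left ?_ hC.le
  rw [← integral_const_mul]
  refine integral_mono_of_nonneg (Filter.Eventually.of_forall fun z => by positivity)
    (hfi.const_mul _) (Filter.Eventually.of_forall fun z => ?_)
  simp only
  rw [← mul_assoc]
  refine mul_le_mul_of_nonneg_right ?_ (Real.exp_pos _).le
  by_cases hz : z ∈ K
  · have hz0 := hcΩ z.1 (hKΩ z hz)
    have h0 := hc₀.trans hz0
    have e : ∑ b, metric a b z * D b (D b w) z
        = (c z.1)⁻¹ * (D tm (D tm w) z - c z.1 * lap w z) := by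
      simp only [lap, sum_fin_four, Fin.sum_univ_three, metric_sp, metric_tm, ha1 z hz]
      field_simp
      ring
    rw [e, mul_pow, inv_pow, one_div]
    gcongr
    exact hf z hz
  · have : ∀ b, D b (D b w) z = 0 := fun b =>
      D_eq_zero_of_notMem fun h => hz (hwK (tsupport_D_subset h))
    simp only [this]
    simpa using mul_nonneg (by positivity) (hf0 z)

/-! ### Smooth fields -/

/-- `f` is of class `C^∞` on space-time. -/
abbrev Smooth (f : Spacetime → ℝ) : Prop := ContDiff ℝ (⊤ : ℕ∞) f

theorem Smooth.of_nat {f : Spacetime → ℝ} (hf : Smooth f) (n : ℕ) : ContDiff ℝ n f :=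
  contDiff_infty.1 hf n

theorem Smooth.D {f : Spacetime → ℝ} (hf : Smooth f) (a : Fin 4) : Smooth (D a f) :=
  contDiff_D hf (by simp)

theorem Smooth.hasD {f : Spacetime → ℝ} (hf : Smooth f) (a : Fin 4) (z : Spacetime) :
    HasD a f (Biot.D a f z) z :=
  Biot.hasD (hf.differentiable (by simp) z)

theorem Smooth.D_comm {f : Spacetime → ℝ} (hf : Smooth f) (a b : Fin 4) :
    Biot.D a (Biot.D b f) = Biot.D b (Biot.D a f) :=
  funext fun _ => Biot.D_comm (hf.of_nat 2).contDiffAt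

theorem Smooth.lap {f : Spacetime → ℝ} (hf : Smooth f) : Smooth (lap f) :=
  ContDiff.sum fun j _ => (hf.D (sp j)).D (sp j)

theorem Smooth.D_sum {ι : Type*} {s : Finset ι} {f : ι → Spacetime → ℝ}
    (hf : ∀ i, Smooth (f i)) (a : Fin 4) :
    Biot.D a (fun z => ∑ i ∈ s, f i z) = fun z => ∑ i ∈ s, Biot.D a (f i) z :=
  funext fun z => (HasD.sum fun i _ => (hf i).hasD a z).2

theorem Smooth.D_sub {f g : Spacetime → ℝ} (hf : Smooth f) (hg : Smooth g) (a : Fin 4) :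
    Biot.D a (fun z => f z - g z) = fun z => Biot.D a f z - Biot.D a g z :=
  funext fun z => ((hf.hasD a z).sub (hg.hasD a z)).2

theorem Smooth.D_lap {f : Spacetime → ℝ} (hf : Smooth f) (a : Fin 4) :
    Biot.D a (Biot.lap f) = Biot.lap (Biot.D a f) := by
  have : Biot.lap f = fun z => ∑ j, Biot.D (sp j) (Biot.D (sp j) f) z := rfl
  rw [this, Smooth.D_sum fun j => (hf.D _).D _]
  ext z
  refine Finset.sum_congr rfl fun j _ => ?_
  rw [(hf.D _).D_comm, hf.D_comm a]

theorem lap_sum {ι : Type*} {s : Finset ι} {f : ι → Spacetime → ℝ}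
    (hf : ∀ i, Smooth (f i)) (z : Spacetime) :
    lap (fun z => ∑ i ∈ s, f i z) z = ∑ i ∈ s, lap (f i) z := by
  simp only [lap]
  rw [Finset.sum_comm]
  refine Finset.sum_congr rfl fun j _ => ?_
  rw [Smooth.D_sum hf, Smooth.D_sum fun i => (hf i).D _]

theorem lap_sub {f g : Spacetime → ℝ} (hf : Smooth f) (hg : Smooth g) (z : Spacetime) :
    lap (fun z => f z - g z) z = lap f z - lap g z := by
  simp only [lap]
  rw [← Finset.sum_sub_distrib]
  refine Finset.sum_congr rfl fun j _ => ?_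
  rw [hf.D_sub hg, (hf.D _).D_sub (hg.D _)]

/-- A pair of smooth vector fields supported in `K`; `u 0` and `u 1` stand for the solid and the
fluid displacement. -/
structure SmoothPair (K : Set Spacetime) where
  u : Fin 2 → Fin 3 → Spacetime → ℝ
  smooth : ∀ r i, Smooth (u r i)
  supp : ∀ r i, tsupport (u r i) ⊆ K

namespace SmoothPair

variable {K : Set Spacetime} (u : SmoothPair K)

/-- The divergence of the `r`-th field. -/
def V (r : Fin 2) (z : Spacetime) : ℝ := ∑ j, D (sp j) (u.u r j) z

/-- The curl of the solid displacement, as an antisymmetric matrix. -/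
def W (k i : Fin 3) (z : Spacetime) : ℝ := D (sp k) (u.u 0 i) z - D (sp i) (u.u 0 k) z

theorem smooth_V (r : Fin 2) : Smooth (u.V r) := ContDiff.sum fun j _ => (u.smooth r j).D _

theorem smooth_W (k i : Fin 3) : Smooth (u.W k i) := ((u.smooth 0 i).D _).sub ((u.smooth 0 k).D _)

theorem D_V (r : Fin 2) (a : Fin 4) :
    D a (u.V r) = fun z => ∑ j, D a (D (sp j) (u.u r j)) z :=
  Smooth.D_sum (fun j => (u.smooth r j).D _) a

theorem D_W (k i : Fin 3) (a : Fin 4) :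
    D a (u.W k i) = fun z => D a (D (sp k) (u.u 0 i)) z - D a (D (sp i) (u.u 0 k)) z :=
  ((u.smooth 0 i).D _).D_sub ((u.smooth 0 k).D _) a

theorem DD_V (r : Fin 2) (a b : Fin 4) :
    D a (D b (u.V r)) = fun z => ∑ j, D a (D b (D (sp j) (u.u r j))) z := by
  rw [D_V]; exact Smooth.D_sum (fun j => ((u.smooth r j).D _).D _) a

theorem DD_W (k i : Fin 3) (a b : Fin 4) :
    D a (D b (u.W k i))
      = fun z => D a (D b (D (sp k) (u.u 0 i))) z - D a (D b (D (sp i) (u.u 0 k))) z := by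
  rw [D_W]; exact (((u.smooth 0 i).D _).D _).D_sub (((u.smooth 0 k).D _).D _) a

/-- The Laplacian in terms of the divergence and the curl. -/
theorem lap_eq (i : Fin 3) (z : Spacetime) :
    lap (u.u 0 i) z = (∑ j, D (sp j) (u.W j i) z) + D (sp i) (u.V 0) z := by
  simp only [D_W, D_V, lap]
  rw [← Finset.sum_add_distrib]
  refine Finset.sum_congr rfl fun j _ => ?_
  rw [(u.smooth 0 j).D_comm (sp i)]; ring

theorem lap_V (r : Fin 2) (z : Spacetime) :
    lap (u.V r) z = ∑ j, D (sp j) (lap (u.u r j)) z := by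
  have := lap_sum (s := Finset.univ) (fun j => (u.smooth r j).D (sp j)) z
  simp only [(u.smooth r _).D_lap]
  exact this

theorem lap_W (k i : Fin 3) (z : Spacetime) :
    lap (u.W k i) z = D (sp k) (lap (u.u 0 i)) z - D (sp i) (lap (u.u 0 k)) z := by
  rw [(u.smooth 0 i).D_lap, (u.smooth 0 k).D_lap]
  exact lap_sub ((u.smooth 0 i).D _) ((u.smooth 0 k).D _) z

theorem tt_V (r : Fin 2) (z : Spacetime) :
    D tm (D tm (u.V r)) z = ∑ j, D (sp j) (D tm (D tm (u.u r j))) z := by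
  rw [DD_V]
  refine Finset.sum_congr rfl fun j _ => ?_
  rw [(u.smooth r j).D_comm tm (sp j), ((u.smooth r j).D tm).D_comm tm (sp j)]

theorem tt_W (k i : Fin 3) (z : Spacetime) :
    D tm (D tm (u.W k i)) z = D (sp k) (D tm (D tm (u.u 0 i))) z
      - D (sp i) (D tm (D tm (u.u 0 k))) z := by
  rw [DD_W]
  rw [(u.smooth 0 i).D_comm tm (sp k), ((u.smooth 0 i).D tm).D_comm tm (sp k),
    (u.smooth 0 k).D_comm tm (sp i), ((u.smooth 0 k).D tm).D_comm tm (sp i)]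

theorem tsupport_V (hK : IsClosed K) (r : Fin 2) : tsupport (u.V r) ⊆ K := by
  refine closure_minimal (fun z hz => ?_) hK
  by_contra h
  refine hz (Finset.sum_eq_zero fun j _ => D_eq_zero_of_notMem fun h' => h (u.supp _ _ h'))

theorem tsupport_W (hK : IsClosed K) (k i : Fin 3) : tsupport (u.W k i) ⊆ K := by
  refine closure_minimal (fun z hz => ?_) hK
  by_contra h
  refine hz ?_
  rw [W, D_eq_zero_of_notMem fun h' => h (u.supp _ _ h'),
    D_eq_zero_of_notMem fun h' => h (u.supp _ _ h'), sub_zero]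

end SmoothPair

/-! ### Control of squares, uniformly in the field -/

/-- `f²` is bounded on `K` by a multiple of `E`, uniformly in the field. This is the calculus in
which lower-order terms are discarded: `Ctl E` is closed under sums and under multiplication by
bounded coefficients. -/
def Ctl {K : Set Spacetime} (E f : SmoothPair K → Spacetime → ℝ) : Prop :=
  ∃ C ≥ 0, ∀ u, ∀ z ∈ K, f u z ^ 2 ≤ C * E u z

namespace Ctl

variable {K : Set Spacetime} {E E' f g : SmoothPair K → Spacetime → ℝ}

theorem of_le (h : ∀ u, ∀ z ∈ K, f u z ^ 2 ≤ E u z) : Ctl E f :=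
  ⟨1, zero_le_one, fun u z hz => by rw [one_mul]; exact h u z hz⟩

theorem congr (hg : Ctl E g) (h : ∀ u, ∀ z ∈ K, f u z = g u z) : Ctl E f := by
  obtain ⟨C, hC, H⟩ := hg
  exact ⟨C, hC, fun u z hz => by rw [h u z hz]; exact H u z hz⟩

theorem add (hf : Ctl E f) (hg : Ctl E g) : Ctl E fun u z => f u z + g u z := by
  obtain ⟨C, hC, H⟩ := hf
  obtain ⟨C', hC', H'⟩ := hg
  refine ⟨2 * C + 2 * C', by positivity, fun u z hz => ?_⟩
  nlinarith [H u z hz, H' u z hz, sq_nonneg (f u z - g u z)]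

theorem neg (hf : Ctl E f) : Ctl E fun u z => - f u z := by
  obtain ⟨C, hC, H⟩ := hf
  exact ⟨C, hC, fun u z hz => by rw [neg_sq]; exact H u z hz⟩

theorem sub (hf : Ctl E f) (hg : Ctl E g) : Ctl E fun u z => f u z - g u z := by
  simpa only [sub_eq_add_neg] using hf.add hg.neg

theorem zero (hE : ∀ u, ∀ z ∈ K, 0 ≤ E u z) : Ctl E fun _ _ => 0 :=
  of_le fun u z hz => by simpa using hE u z hz

theorem sum (hE : ∀ u, ∀ z ∈ K, 0 ≤ E u z) {ι : Type*} {s : Finset ι}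
    {f : ι → SmoothPair K → Spacetime → ℝ} (h : ∀ i ∈ s, Ctl E (f i)) :
    Ctl E fun u z => ∑ i ∈ s, f i u z := by
  classical
  induction s using Finset.induction_on with
  | empty => simpa using zero hE
  | insert i s hi ih =>
    simp only [Finset.sum_insert hi]
    exact (h i (Finset.mem_insert_self _ _)).add
      (ih fun j hj => h j (Finset.mem_insert_of_mem hj))

theorem coef {c : Space → ℝ} (hc : ∃ M, ∀ z ∈ K, |c z.1| ≤ M) (hf : Ctl E f) :
    Ctl E fun u z => c z.1 * f u z := by
  obtain ⟨C, hC, H⟩ := hf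
  obtain ⟨M, hM⟩ := hc
  refine ⟨M ^ 2 * C, by positivity, fun u z hz => ?_⟩
  have : c z.1 ^ 2 ≤ M ^ 2 := sq_le_sq' (abs_le.1 (hM z hz)).1 (abs_le.1 (hM z hz)).2
  calc (c z.1 * f u z) ^ 2 = c z.1 ^ 2 * f u z ^ 2 := by ring
    _ ≤ M ^ 2 * (C * E u z) := by gcongr; exact H u z hz
    _ = _ := by ring

theorem trans (hf : Ctl E f) (h : ∃ C ≥ 0, ∀ u, ∀ z ∈ K, E u z ≤ C * E' u z) : Ctl E' f := by
  obtain ⟨C, hC, H⟩ := hf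
  obtain ⟨C', hC', H'⟩ := h
  refine ⟨C * C', by positivity, fun u z hz => (H u z hz).trans ?_⟩
  rw [mul_assoc]
  exact mul_le_mul_of_nonneg_left (H' u z hz) hC

end Ctl

/-- A coefficient of class `C¹` near `K`. -/
def C1On (K : Set Spacetime) (c : Space → ℝ) : Prop := ∀ z ∈ K, ContDiffAt ℝ 1 c z.1

namespace C1On

variable {K : Set Spacetime} {c d : Space → ℝ}

theorem bdd (hc : C1On K c) (hK : IsCompact K) : ∃ M, ∀ z ∈ K, |c z.1| ≤ M := by
  obtain ⟨M, -, hM⟩ := exists_abs_le hK (f := fun z => c z.1) fun z hz =>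
    ((hc z hz).continuousAt.comp continuousAt_fst).continuousWithinAt
  exact ⟨M, hM⟩

theorem bdd_pd (hc : C1On K c) (hK : IsCompact K) (k : Fin 3) :
    ∃ M, ∀ z ∈ K, |pd c k z.1| ≤ M := by
  obtain ⟨M, -, hM⟩ := exists_abs_le hK (f := fun z => pd c k z.1) fun z hz => by
    have h : ContinuousAt (fderiv ℝ c) z.1 :=
      ((hc z hz).fderiv_right (m := 0) (by norm_num)).continuousAt
    exact ((h.clm_apply continuousAt_const).comp continuousAt_fst).continuousWithinAt
  exact ⟨M, hM⟩

theorem hasD (hc : C1On K c) {z : Spacetime} (hz : z ∈ K) (k : Fin 3) :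
    HasD (sp k) (fun z => c z.1) (pd c k z.1) z :=
  hasD_sp ((hc z hz).differentiableAt (by norm_num)) k

end C1On

/-! ### The system solved for the second time derivatives -/

/-- The coefficients of a system solved for the second time derivatives,
`∂_t² u^r = m_r Δu^0 + ∑_s (al_rs ∇ div u^s + b_rs div u^s) + (∇u^0 + (∇u^0)ᵀ) nu_r`. -/
structure Reduced where
  m : Fin 2 → Space → ℝ
  al : Fin 2 → Fin 2 → Space → ℝ
  b : Fin 2 → Fin 2 → Fin 3 → Space → ℝ
  nu : Fin 2 → Fin 3 → Space → ℝ

/-- The coefficients are of class `C¹` near `K`. -/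
structure Reduced.IsC1 (R : Reduced) (K : Set Spacetime) : Prop where
  m : ∀ r, C1On K (R.m r)
  al : ∀ r s, C1On K (R.al r s)
  b : ∀ r s i, C1On K (R.b r s i)
  nu : ∀ r j, C1On K (R.nu r j)

/-- The `i`-th component of the left-hand side of the `r`-th equation of the system solved for
the second time derivatives. -/
def Reduced.op (R : Reduced) {K : Set Spacetime} (u : SmoothPair K) (r : Fin 2) (i : Fin 3)
    (z : Spacetime) : ℝ :=
  D tm (D tm (u.u r i)) z - R.m r z.1 * lap (u.u 0 i) z
    - (∑ s, (R.al r s z.1 * D (sp i) (u.V s) z + R.b r s i z.1 * u.V s z))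
    - ∑ j, R.nu r j z.1 * (D (sp j) (u.u 0 i) z + D (sp i) (u.u 0 j) z)

/-- Control of the first derivatives of the unknowns of the principally diagonal system. -/
structure CtlBasic {K : Set Spacetime} (E : SmoothPair K → Spacetime → ℝ) : Prop where
  nonneg : ∀ u, ∀ z ∈ K, 0 ≤ E u z
  DU : ∀ i a, Ctl E fun u => D a (u.u 0 i)
  DW : ∀ k i a, Ctl E fun u => D a (u.W k i)
  DV : ∀ r a, Ctl E fun u => D a (u.V r)
  V : ∀ r, Ctl E fun u => u.V r

namespace CtlBasic

variable {K : Set Spacetime} {E : SmoothPair K → Spacetime → ℝ}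

/-- The Laplacian of the solid displacement is controlled, through the first derivatives of its
divergence and its curl. -/
theorem lap (hE : CtlBasic E) (i : Fin 3) : Ctl E fun u => lap (u.u 0 i) :=
  ((Ctl.sum hE.nonneg fun j _ => hE.DW j i (sp j)).add (hE.DV 0 (sp i))).congr
    fun u z _ => u.lap_eq i z

variable {R : Reduced}

/-- The derivative of the reduced operator: the principal part, and a controlled remainder. -/
theorem D_op (hE : CtlBasic E) (hK : IsCompact K) (hR : R.IsC1 K) (r : Fin 2) (i k : Fin 3) :
    (∀ u : SmoothPair K, ∀ z ∈ K, DifferentiableAt ℝ (R.op u r i) z) ∧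
    Ctl E fun u z => D (sp k) (R.op u r i) z - (D (sp k) (D tm (D tm (u.u r i))) z
      - R.m r z.1 * D (sp k) (Biot.lap (u.u 0 i)) z
      - (∑ s, R.al r s z.1 * D (sp k) (D (sp i) (u.V s)) z)
      - ∑ j, R.nu r j z.1 * (D (sp k) (D (sp j) (u.u 0 i)) z
        + D (sp k) (D (sp i) (u.u 0 j)) z)) := by
  have key : ∀ u : SmoothPair K, ∀ z ∈ K, HasD (sp k) (R.op u r i) _ z := fun u z hz =>
    ((((((u.smooth r i).D tm).D tm).hasD (sp k) z).sub
      (((hR.m r).hasD hz k).mul ((u.smooth 0 i).lap.hasD (sp k) z))).sub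
      (HasD.sum fun s _ => ((((hR.al r s).hasD hz k).mul (((u.smooth_V s).D (sp i)).hasD _ z)).add
        (((hR.b r s i).hasD hz k).mul ((u.smooth_V s).hasD _ z))))).sub
      (HasD.sum fun j _ => ((hR.nu r j).hasD hz k).mul
        ((((u.smooth 0 i).D (sp j)).hasD (sp k) z).add (((u.smooth 0 j).D (sp i)).hasD (sp k) z)))
  refine ⟨fun u z hz => (key u z hz).1, ?_⟩
  have c1 : Ctl E fun u z => -(pd (R.m r) k z.1 * Biot.lap (u.u 0 i) z)
      - (∑ s, (pd (R.al r s) k z.1 * D (sp i) (u.V s) z + (pd (R.b r s i) k z.1 * u.V s z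
        + R.b r s i z.1 * D (sp k) (u.V s) z)))
      - ∑ j, pd (R.nu r j) k z.1 * (D (sp j) (u.u 0 i) z + D (sp i) (u.u 0 j) z) :=
    (((Ctl.coef ((hR.m r).bdd_pd hK k) (hE.lap i)).neg).sub
      (Ctl.sum hE.nonneg fun s _ => (Ctl.coef ((hR.al r s).bdd_pd hK k) (hE.DV s _)).add
        ((Ctl.coef ((hR.b r s i).bdd_pd hK k) (hE.V s)).add
          (Ctl.coef ((hR.b r s i).bdd hK) (hE.DV s _))))).sub
      (Ctl.sum hE.nonneg fun j _ => Ctl.coef ((hR.nu r j).bdd_pd hK k)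
        ((hE.DU i _).add (hE.DU j _)))
  refine c1.congr fun u z hz => ?_
  rw [(key u z hz).2]
  simp only [Finset.sum_add_distrib]
  ring

/-- The components of the solid displacement solve wave equations. -/
theorem wave_U (hE : CtlBasic E) (hK : IsCompact K) (hR : R.IsC1 K) (i : Fin 3)
    (hop : ∀ i, Ctl E fun u => R.op u 0 i) :
    Ctl E fun u z => D tm (D tm (u.u 0 i)) z - R.m 0 z.1 * Biot.lap (u.u 0 i) z := by
  refine (((hop i).add (Ctl.sum (s := Finset.univ) hE.nonneg fun s _ =>
    (Ctl.coef ((hR.al 0 s).bdd hK) (hE.DV s (sp i))).add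
      (Ctl.coef ((hR.b 0 s i).bdd hK) (hE.V s)))).add
    (Ctl.sum (s := Finset.univ) hE.nonneg fun j _ => Ctl.coef ((hR.nu 0 j).bdd hK)
      ((hE.DU i (sp j)).add (hE.DU j (sp i))))).congr fun u z hz => ?_
  simp only [Reduced.op]
  ring

/-- The components of the curl solve wave equations: the gradient terms drop out, and the second
derivatives of `u^0` that stand with `nu` combine into first derivatives of the curl. -/
theorem wave_W (hE : CtlBasic E) (hK : IsCompact K) (hR : R.IsC1 K) (k i : Fin 3)
    (hop : ∀ i k, Ctl E fun u => D (sp k) (R.op u 0 i)) :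
    Ctl E fun u z => D tm (D tm (u.W k i)) z - R.m 0 z.1 * Biot.lap (u.W k i) z := by
  refine ((((hop i k).sub (hop k i)).sub
    ((hE.D_op hK hR 0 i k).2.sub (hE.D_op hK hR 0 k i).2)).add
    (Ctl.sum (s := Finset.univ) hE.nonneg fun j _ => Ctl.coef ((hR.nu 0 j).bdd hK)
      (hE.DW k i (sp j)))).congr fun u z hz => ?_
  rw [u.tt_W, u.lap_W]
  have e : ∀ j, D (sp j) (u.W k i) z = (D (sp k) (D (sp j) (u.u 0 i)) z
      + D (sp k) (D (sp i) (u.u 0 j)) z) - (D (sp i) (D (sp j) (u.u 0 k)) z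
      + D (sp i) (D (sp k) (u.u 0 j)) z) := fun j => by
    rw [u.D_W, (u.smooth 0 i).D_comm (sp j), (u.smooth 0 k).D_comm (sp j),
      (u.smooth 0 j).D_comm (sp i)]
    ring
  simp only [e, (u.smooth_V _).D_comm (sp i) (sp k), mul_sub, Finset.sum_sub_distrib]
  ring

/-- The divergences solve a system of wave equations, coupled in the principal part. -/
theorem wave_V (hE : CtlBasic E) (hK : IsCompact K) (hR : R.IsC1 K) (r : Fin 2)
    (hop : ∀ r i k, Ctl E fun u => D (sp k) (R.op u r i)) :
    Ctl E fun u z => D tm (D tm (u.V r)) z - R.m r z.1 * Biot.lap (u.V 0) z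
      - ∑ s, R.al r s z.1 * Biot.lap (u.V s) z := by
  refine ((Ctl.sum (s := Finset.univ) hE.nonneg fun i _ =>
      (hop r i i).sub (hE.D_op hK hR r i i).2).add
    (Ctl.sum (s := Finset.univ) hE.nonneg fun j _ => Ctl.coef ((hR.nu r j).bdd hK)
      ((hE.DV 0 (sp j)).add (hE.lap j)))).congr fun u z hz => ?_
  have e1 : ∀ s, Biot.lap (u.V s) z = ∑ i, D (sp i) (D (sp i) (u.V s)) z := fun s => rfl
  have e2 : ∀ j, D (sp j) (u.V 0) z = ∑ i, D (sp i) (D (sp j) (u.u 0 i)) z := fun j => by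
    rw [u.D_V]
    exact Finset.sum_congr rfl fun i _ => by rw [(u.smooth 0 i).D_comm]
  have e3 : ∀ j, Biot.lap (u.u 0 j) z = ∑ i, D (sp i) (D (sp i) (u.u 0 j)) z := fun j => rfl
  have e4 : ∀ c : ℝ, c * Biot.lap (u.V 0) z = ∑ j, c * D (sp j) (Biot.lap (u.u 0 j)) z :=
    fun c => by rw [u.lap_V, Finset.mul_sum]
  rw [u.tt_V, e4]
  simp only [e1, e2, e3]
  simp only [Fin.sum_univ_three, Fin.sum_univ_two]
  ring

/-- A linear combination of the divergences with coefficients along a left eigenvector of the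
principal part solves a wave equation. -/
theorem wave_Z (hE : CtlBasic E) (hK : IsCompact K) (hR : R.IsC1 K) (B : Fin 2 → Space → ℝ)
    (hB : ∀ s, ContDiff ℝ 2 (B s)) (c : Space → ℝ) (hc : C1On K c)
    (hBA : ∀ z ∈ K, ∀ t, ∑ s, B s z.1 * ((if t = 0 then R.m s z.1 else 0) + R.al s t z.1)
      = c z.1 * B t z.1)
    (hop : ∀ r i k, Ctl E fun u => D (sp k) (R.op u r i)) :
    Ctl E fun u z => D tm (D tm (fun z => ∑ s, B s z.1 * u.V s z)) z
      - c z.1 * Biot.lap (fun z => ∑ s, B s z.1 * u.V s z) z := by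
  have hB1 : ∀ s, C1On K (B s) := fun s z _ => ((hB s).of_le (by norm_num)).contDiffAt
  have hpB : ∀ s i, ContDiff ℝ 1 (pd (B s) i) := fun s i =>
    ((hB s).fderiv_right (by norm_num)).clm_apply contDiff_const
  have hpB1 : ∀ s i, C1On K (pd (B s) i) := fun s i z _ => (hpB s i).contDiffAt
  have hBd : ∀ s x, DifferentiableAt ℝ (B s) x := fun s => (hB s).differentiable (by norm_num)
  have hpBd : ∀ s i x, DifferentiableAt ℝ (pd (B s) i) x := fun s i =>
    (hpB s i).differentiable (by norm_num)
  have D1 : ∀ (u : SmoothPair K) i, D (sp i) (fun z => ∑ s, B s z.1 * u.V s z)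
      = fun z => ∑ s, (pd (B s) i z.1 * u.V s z + B s z.1 * D (sp i) (u.V s) z) :=
    fun u i => funext fun z =>
      (HasD.sum fun s _ => (hasD_sp (hBd s _) i).mul ((u.smooth_V s).hasD (sp i) z)).2
  have D2 : ∀ (u : SmoothPair K) i z, D (sp i) (D (sp i) (fun z => ∑ s, B s z.1 * u.V s z)) z
      = ∑ s, ((pd (pd (B s) i) i z.1 * u.V s z + pd (B s) i z.1 * D (sp i) (u.V s) z)
        + (pd (B s) i z.1 * D (sp i) (u.V s) z + B s z.1 * D (sp i) (D (sp i) (u.V s)) z)) :=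
    fun u i z => by
      rw [D1]
      exact (HasD.sum fun s _ => ((hasD_sp (hpBd s i _) i).mul
        ((u.smooth_V s).hasD (sp i) z)).add ((hasD_sp (hBd s _) i).mul
          (((u.smooth_V s).D (sp i)).hasD (sp i) z))).2
  have T1 : ∀ (u : SmoothPair K), D tm (fun z => ∑ s, B s z.1 * u.V s z)
      = fun z => ∑ s, B s z.1 * D tm (u.V s) z :=
    fun u => funext fun z =>
      ((HasD.sum fun s _ => (hasD_tm (hBd s _)).mul ((u.smooth_V s).hasD tm z)).congr
        (Finset.sum_congr rfl fun s _ => by ring)).2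
  have T2 : ∀ (u : SmoothPair K) z, D tm (D tm (fun z => ∑ s, B s z.1 * u.V s z)) z
      = ∑ s, B s z.1 * D tm (D tm (u.V s)) z := fun u z => by
    rw [T1]
    exact ((HasD.sum fun s _ => (hasD_tm (hBd s _)).mul (((u.smooth_V s).D tm).hasD tm z)).congr
        (Finset.sum_congr rfl fun s _ => by ring)).2
  refine ((Ctl.sum (s := Finset.univ) hE.nonneg fun s _ =>
      Ctl.coef ((hB1 s).bdd hK) (hE.wave_V hK hR s hop)).sub
    (Ctl.coef (hc.bdd hK) (Ctl.sum (s := Finset.univ) hE.nonneg fun i _ =>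
      (Ctl.sum (s := Finset.univ) hE.nonneg fun s _ =>
        (Ctl.coef ((hpB1 s i).bdd_pd hK i) (hE.V s)).add
          ((Ctl.coef ((hpB1 s i).bdd hK) (hE.DV s (sp i))).add
            (Ctl.coef ((hpB1 s i).bdd hK) (hE.DV s (sp i)))))))).congr fun u z hz => ?_
  rw [T2]
  have h0 := hBA z hz 0
  have h1 := hBA z hz 1
  simp only [Fin.sum_univ_two, if_true, one_ne_zero, if_false, zero_add] at h0 h1
  have l : ∀ s, Biot.lap (u.V s) z = ∑ i, D (sp i) (D (sp i) (u.V s)) z := fun s => rfl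
  have lz : Biot.lap (fun z => ∑ s, B s z.1 * u.V s z) z
      = (∑ i, ∑ s, (pd (pd (B s) i) i z.1 * u.V s z + (pd (B s) i z.1 * D (sp i) (u.V s) z
        + pd (B s) i z.1 * D (sp i) (u.V s) z))) + ∑ s, B s z.1 * Biot.lap (u.V s) z := by
    rw [Biot.lap]
    simp only [D2, l]
    simp only [Fin.sum_univ_three, Fin.sum_univ_two]
    ring
  rw [lz]
  simp only [Fin.sum_univ_two]
  linear_combination Biot.lap (u.V 0) z * h0 + Biot.lap (u.V 1) z * h1

end CtlBasic

/-! ### Absorption of the coupling -/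

theorem integrable_mul_exp {K : Set Spacetime} (hK : IsCompact K) {f φ : Spacetime → ℝ}
    (hf : Continuous f) (hφ : Continuous φ) (h0 : ∀ z ∉ K, f z = 0) (τ : ℝ) :
    Integrable fun z => f z * Real.exp (2 * τ * φ z) := by
  refine Continuous.integrable_of_hasCompactSupport (by fun_prop)
    (HasCompactSupport.intro hK fun z hz => by simp [h0 z hz])

/-- For a finite family of functions which solve wave equations up to a source and up to terms of
first order in the whole family, the Carleman estimates add up to an estimate by the source: the
first-order terms are absorbed on the left, which carries the factors `τ` and `τ³`. -/
theorem carleman_absorb {K : Set Spacetime} (hK : IsCompact K) {φ : Spacetime → ℝ}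
    (hφ : Continuous φ) {J : Type*} [Fintype J] (w : SmoothPair K → J → Spacetime → ℝ)
    (c : J → Space → ℝ) (hw : ∀ u j, ContDiff ℝ 2 (w u j)) (hwK : ∀ u j, tsupport (w u j) ⊆ K)
    (hC : ∀ j, WaveCarleman K φ (c j)) (S E : SmoothPair K → Spacetime → ℝ)
    (hS : ∀ u, Continuous (S u)) (hS0 : ∀ u z, 0 ≤ S u z) (hSK : ∀ u, ∀ z ∉ K, S u z = 0)
    (hL : ∀ j, Ctl E fun u z => D tm (D tm (w u j)) z - c j z.1 * lap (w u j) z)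
    (hE : ∃ C ≥ 0, ∀ u, ∀ z ∈ K,
      E u z ≤ C * (S u z + ∑ j, (∑ a, D a (w u j) z ^ 2 + w u j z ^ 2))) :
    ∃ τs ≥ 1, ∃ C > 0, ∀ τ ≥ τs, ∀ u,
      ∫ z, (∑ j, (τ * ∑ a, D a (w u j) z ^ 2 + τ ^ 3 * w u j z ^ 2)) * Real.exp (2 * τ * φ z)
        ≤ C * ∫ z, S u z * Real.exp (2 * τ * φ z) := by
  choose τj hτj Cj hCj main using hC
  choose Lj hLj hL' using hL
  obtain ⟨M, hM, hE'⟩ := hE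
  set C := ∑ j, Cj j * (Lj j * M) with hCdef
  have hC0 : 0 ≤ C := Finset.sum_nonneg fun j _ =>
    mul_nonneg (hCj j).le (mul_nonneg (hLj j) hM)
  have hτ0 : 0 ≤ ∑ j, τj j := Finset.sum_nonneg fun j _ => (hτj j).le
  refine ⟨1 + ∑ j, τj j + 2 * C, by linarith, 2 * C + 1, by positivity, fun τ hτ u => ?_⟩
  have hτ1 : 1 ≤ τ := by linarith
  set N : Spacetime → ℝ := fun z => ∑ j, (∑ a, D a (w u j) z ^ 2 + w u j z ^ 2) with hN
  have hwD : ∀ j a, Continuous (D a (w u j)) := fun j a =>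
    continuous_D ((hw u j).of_le (by norm_num)) a
  have hwc : ∀ j, Continuous (w u j) := fun j => (hw u j).continuous
  have hw0 : ∀ j, ∀ z ∉ K, w u j z = 0 := fun j z hz =>
    image_eq_zero_of_notMem_tsupport fun h => hz (hwK u j h)
  have hD0 : ∀ j a, ∀ z ∉ K, D a (w u j) z = 0 := fun j a z hz =>
    D_eq_zero_of_notMem fun h => hz (hwK u j h)
  have hNc : Continuous N := by rw [hN]; fun_prop
  have hN0 : ∀ z ∉ K, N z = 0 := fun z hz => by simp [hN, hw0 _ z hz, hD0 _ _ z hz]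
  have hNn : ∀ z, 0 ≤ N z := fun z => Finset.sum_nonneg fun j _ => by positivity
  have iN := integrable_mul_exp hK hNc hφ hN0 τ
  have iS := integrable_mul_exp hK (hS u) hφ (hSK u) τ
  have iJ : ∀ j, Integrable fun z => (τ * ∑ a, D a (w u j) z ^ 2 + τ ^ 3 * w u j z ^ 2)
      * Real.exp (2 * τ * φ z) := fun j =>
    integrable_mul_exp hK (by fun_prop) hφ (fun z hz => by simp [hw0 _ z hz, hD0 _ _ z hz]) τ
  set I := ∫ z, (∑ j, (τ * ∑ a, D a (w u j) z ^ 2 + τ ^ 3 * w u j z ^ 2))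
    * Real.exp (2 * τ * φ z) with hI
  have hIsum : I = ∑ j, ∫ z, (τ * ∑ a, D a (w u j) z ^ 2 + τ ^ 3 * w u j z ^ 2)
      * Real.exp (2 * τ * φ z) := by
    rw [hI, ← integral_finsetSum _ fun j _ => iJ j]
    simp only [Finset.sum_mul]
  have hj : ∀ j, ∫ z, (τ * ∑ a, D a (w u j) z ^ 2 + τ ^ 3 * w u j z ^ 2)
      * Real.exp (2 * τ * φ z) ≤ Cj j * (Lj j * M) *
        ((∫ z, S u z * Real.exp (2 * τ * φ z)) + ∫ z, N z * Real.exp (2 * τ * φ z)) := by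
    intro j
    have hτj' : τj j ≤ τ := by
      have := Finset.single_le_sum (f := τj) (fun i _ => (hτj i).le) (Finset.mem_univ j)
      linarith
    have e : (fun z => (Lj j * M) * (S u z + N z) * Real.exp (2 * τ * φ z))
        = fun z => (Lj j * M) * (S u z * Real.exp (2 * τ * φ z)
          + N z * Real.exp (2 * τ * φ z)) := by ext z; ring
    have h := main j τ hτj' (w u j) (hw u j) (hwK u j) (fun z => (Lj j * M) * (S u z + N z))
      (by rw [e]; exact (iS.add iN).const_mul _)
      (fun z => mul_nonneg (mul_nonneg (hLj j) hM) (add_nonneg (hS0 u z) (hNn z)))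
      (fun z hz => (hL' j u z hz).trans (by
        rw [mul_assoc]; exact mul_le_mul_of_nonneg_left (hE' u z hz) (hLj j)))
    refine h.trans_eq ?_
    rw [e, integral_const_mul, integral_add iS iN]
    ring
  have h1 : I ≤ C * ((∫ z, S u z * Real.exp (2 * τ * φ z))
      + ∫ z, N z * Real.exp (2 * τ * φ z)) := by
    rw [hIsum, hCdef, Finset.sum_mul]
    exact Finset.sum_le_sum fun j _ => hj j
  have h2 : τ * ∫ z, N z * Real.exp (2 * τ * φ z) ≤ I := by
    rw [← integral_const_mul]
    refine integral_mono (iN.const_mul _) ?_ fun z => ?_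
    · exact (integrable_finsetSum Finset.univ fun j _ => iJ j).congr
        (Filter.Eventually.of_forall fun z => by simp only [Finset.sum_mul])
    · rw [← mul_assoc]
      refine mul_le_mul_of_nonneg_right ?_ (Real.exp_pos _).le
      rw [hN, Finset.mul_sum]
      refine Finset.sum_le_sum fun j _ => ?_
      have : τ ≤ τ ^ 3 := le_self_pow₀ hτ1 (by norm_num)
      nlinarith [sq_nonneg (w u j z)]
  have hIS : 0 ≤ ∫ z, S u z * Real.exp (2 * τ * φ z) :=
    integral_nonneg fun z => mul_nonneg (hS0 u z) (Real.exp_pos _).le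
  have hIN : 0 ≤ ∫ z, N z * Real.exp (2 * τ * φ z) :=
    integral_nonneg fun z => mul_nonneg (hNn z) (Real.exp_pos _).le
  have h3 : 2 * C * ∫ z, N z * Real.exp (2 * τ * φ z)
      ≤ τ * ∫ z, N z * Real.exp (2 * τ * φ z) :=
    mul_le_mul_of_nonneg_right (by linarith) hIN
  nlinarith

/-! ### Biot's system for smooth fields -/

/-- The left-hand side of the `i`-th component of the first (`r = 0`) or second (`r = 1`) equation
of Biot's system, with classical derivatives. -/
def Coeffs.src (P : Coeffs) {K : Set Spacetime} (u : SmoothPair K) (r : Fin 2) (i : Fin 3)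
    (z : Spacetime) : ℝ :=
  ![P.rho11 z.1 * D tm (D tm (u.u 0 i)) z + P.rho12 z.1 * D tm (D tm (u.u 1 i)) z
      - (P.mu z.1 * lap (u.u 0 i) z + (P.mu z.1 + P.lam z.1) * D (sp i) (u.V 0) z
        + u.V 0 z * pd P.lam i z.1
        + ∑ j, (D (sp j) (u.u 0 i) z + D (sp i) (u.u 0 j) z) * pd P.mu j z.1)
      - (P.q z.1 * D (sp i) (u.V 1) z + u.V 1 z * pd P.q i z.1),
    P.rho12 z.1 * D tm (D tm (u.u 0 i)) z + P.rho22 z.1 * D tm (D tm (u.u 1 i)) z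
      - (P.q z.1 * D (sp i) (u.V 0) z + u.V 0 z * pd P.q i z.1)
      - (P.r z.1 * D (sp i) (u.V 1) z + u.V 1 z * pd P.r i z.1)] r

/-- The inverse of the mass matrix. -/
def Coeffs.massInv (P : Coeffs) (r s : Fin 2) (x : Space) : ℝ :=
  (P.rho x)⁻¹ * ![![P.rho22 x, -P.rho12 x], ![-P.rho12 x, P.rho11 x]] r s

/-- The coefficients of Biot's system, solved for the second time derivatives. -/
def Coeffs.reduced (P : Coeffs) : Reduced where
  m r x := P.massInv r 0 x * P.mu x
  al r s x := ![P.massInv r 0 x * (P.mu x + P.lam x) + P.massInv r 1 x * P.q x,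
    P.massInv r 0 x * P.q x + P.massInv r 1 x * P.r x] s
  b r s i x := ![P.massInv r 0 x * pd P.lam i x + P.massInv r 1 x * pd P.q i x,
    P.massInv r 0 x * pd P.q i x + P.massInv r 1 x * pd P.r i x] s
  nu r j x := P.massInv r 0 x * pd P.mu j x

theorem Coeffs.op_eq (P : Coeffs) {K : Set Spacetime} (u : SmoothPair K) (r : Fin 2) (i : Fin 3)
    {z : Spacetime} (hz : P.rho z.1 ≠ 0) :
    P.reduced.op u r i z = ∑ s, P.massInv r s z.1 * P.src u s i z := by
  have h : P.rho z.1 = P.rho11 z.1 * P.rho22 z.1 - P.rho12 z.1 ^ 2 := rfl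
  have h1 : (P.rho z.1)⁻¹ * P.rho11 z.1 * P.rho22 z.1
      - (P.rho z.1)⁻¹ * P.rho12 z.1 ^ 2 = 1 := by
    rw [mul_assoc, ← mul_sub, ← h, inv_mul_cancel₀ hz]
  fin_cases r
  · simp only [Reduced.op, Coeffs.reduced, Coeffs.massInv, Coeffs.src, Fin.sum_univ_two,
      Fin.sum_univ_three]
    simp
    linear_combination (-D tm (D tm (u.u 0 i)) z) * h1
  · simp only [Reduced.op, Coeffs.reduced, Coeffs.massInv, Coeffs.src, Fin.sum_univ_two,
      Fin.sum_univ_three]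
    simp
    linear_combination (-D tm (D tm (u.u 1 i)) z) * h1

/-- All coefficients are of class `C²` on the whole space. -/
structure Coeffs.IsC2 (P : Coeffs) : Prop where
  rho11 : ContDiff ℝ 2 P.rho11
  rho12 : ContDiff ℝ 2 P.rho12
  rho22 : ContDiff ℝ 2 P.rho22
  mu : ContDiff ℝ 2 P.mu
  lam : ContDiff ℝ 2 P.lam
  q : ContDiff ℝ 2 P.q
  r : ContDiff ℝ 2 P.r

namespace Coeffs.IsC2

variable {P : Coeffs}

theorem rho_C2 (hP : P.IsC2) : ContDiff ℝ 2 P.rho :=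
  (hP.rho11.mul hP.rho22).sub (hP.rho12.pow 2)

theorem massInv_C2 (hP : P.IsC2) {x : Space} (hx : P.rho x ≠ 0) (r s : Fin 2) :
    ContDiffAt ℝ 2 (P.massInv r s) x := by
  refine ((hP.rho_C2.contDiffAt (x := x)).inv hx).mul ?_
  fin_cases r <;> fin_cases s
  · exact hP.rho22.contDiffAt
  · exact hP.rho12.contDiffAt.neg
  · exact hP.rho12.contDiffAt.neg
  · exact hP.rho11.contDiffAt

theorem reduced_C1 (hP : P.IsC2) {K : Set Spacetime} (hK : ∀ z ∈ K, P.rho z.1 ≠ 0) :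
    P.reduced.IsC1 K := by
  have hn : ∀ z ∈ K, ∀ r s, ContDiffAt ℝ 1 (P.massInv r s) z.1 := fun z hz r s =>
    (hP.massInv_C2 (hK z hz) r s).of_le (by norm_num)
  have c1 : ∀ {c : Space → ℝ}, ContDiff ℝ 2 c → ∀ x, ContDiffAt ℝ 1 c x := fun h x =>
    (h.of_le (by norm_num)).contDiffAt
  have p1 : ∀ {c : Space → ℝ}, ContDiff ℝ 2 c → ∀ i x, ContDiffAt ℝ 1 (pd c i) x := fun h i x =>
    ((h.fderiv_right (by norm_num)).clm_apply contDiff_const).contDiffAt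
  refine ⟨fun r z hz => (hn z hz r 0).mul (c1 hP.mu _), fun r s z hz => ?_, fun r s i z hz => ?_,
    fun r j z hz => (hn z hz r 0).mul (p1 hP.mu j _)⟩
  · fin_cases s
    · exact ((hn z hz r 0).mul ((c1 hP.mu _).add (c1 hP.lam _))).add
        ((hn z hz r 1).mul (c1 hP.q _))
    · exact ((hn z hz r 0).mul (c1 hP.q _)).add ((hn z hz r 1).mul (c1 hP.r _))
  · fin_cases s
    · exact ((hn z hz r 0).mul (p1 hP.lam i _)).add ((hn z hz r 1).mul (p1 hP.q i _))
    · exact ((hn z hz r 0).mul (p1 hP.q i _)).add ((hn z hz r 1).mul (p1 hP.r i _))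

theorem src_C1 (hP : P.IsC2) {K : Set Spacetime} (u : SmoothPair K) (r : Fin 2) (i : Fin 3) :
    ContDiff ℝ 1 (P.src u r i) := by
  have c1 : ∀ {c : Space → ℝ}, ContDiff ℝ 2 c → ContDiff ℝ 1 (fun z : Spacetime => c z.1) :=
    fun h => (h.of_le (by norm_num)).comp contDiff_fst
  have p1 : ∀ {c : Space → ℝ}, ContDiff ℝ 2 c → ∀ i,
      ContDiff ℝ 1 (fun z : Spacetime => pd c i z.1) := fun h i =>
    ContDiff.comp ((h.fderiv_right (by norm_num)).clm_apply contDiff_const) contDiff_fst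
  have s1 : ∀ {f : Spacetime → ℝ}, Smooth f → ContDiff ℝ 1 f := fun h => h.of_nat 1
  have d2 := fun r i => s1 (((u.smooth r i).D tm).D tm)
  have hl := fun i => s1 (u.smooth 0 i).lap
  have hV := fun r => s1 (u.smooth_V r)
  have hDV := fun r i => s1 ((u.smooth_V r).D (sp i))
  have hDu := fun i j => s1 ((u.smooth 0 i).D (sp j))
  fin_cases r
  · exact ((((c1 hP.rho11).mul (d2 0 i)).add ((c1 hP.rho12).mul (d2 1 i))).sub
      (((((c1 hP.mu).mul (hl i)).add (((c1 hP.mu).add (c1 hP.lam)).mul (hDV 0 i))).add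
        ((hV 0).mul (p1 hP.lam i))).add
        (ContDiff.sum fun j _ => ((hDu i j).add (hDu j i)).mul (p1 hP.mu j)))).sub
      (((c1 hP.q).mul (hDV 1 i)).add ((hV 1).mul (p1 hP.q i)))
  · exact ((((c1 hP.rho12).mul (d2 0 i)).add ((c1 hP.rho22).mul (d2 1 i))).sub
      (((c1 hP.q).mul (hDV 0 i)).add ((hV 0).mul (p1 hP.q i)))).sub
      (((c1 hP.r).mul (hDV 1 i)).add ((hV 1).mul (p1 hP.r i)))

end Coeffs.IsC2

theorem tsupport_src {P : Coeffs} {K : Set Spacetime} (hK : IsClosed K) (u : SmoothPair K)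
    (r : Fin 2) (i : Fin 3) : tsupport (P.src u r i) ⊆ K := by
  refine closure_minimal (fun z hz => ?_) hK
  by_contra h
  have h1 : ∀ a r i, D a (u.u r i) z = 0 := fun a r i =>
    D_eq_zero_of_notMem fun h' => h (u.supp r i h')
  have h2 : ∀ a b r i, D a (D b (u.u r i)) z = 0 := fun a b r i =>
    D_eq_zero_of_notMem fun h' => h (u.supp r i (tsupport_D_subset h'))
  have h3 : ∀ r, u.V r z = 0 := fun r => Finset.sum_eq_zero fun j _ => h1 _ _ _
  have h4 : ∀ a r, D a (u.V r) z = 0 := fun a r =>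
    D_eq_zero_of_notMem fun h' => h (u.tsupport_V hK r h')
  have h5 : ∀ i, lap (u.u 0 i) z = 0 := fun i => Finset.sum_eq_zero fun j _ => h2 _ _ _ _
  refine hz ?_
  fin_cases r <;> simp [Coeffs.src, h1, h2, h3, h4, h5]

/-- The squares of the sources and of their spatial gradients. -/
def Coeffs.srcEnergy (P : Coeffs) {K : Set Spacetime} (u : SmoothPair K) (z : Spacetime) : ℝ :=
  ∑ r, ∑ i, (P.src u r i z ^ 2 + ∑ k, D (sp k) (P.src u r i) z ^ 2)

/-- The sum of the squares of the gradients of the solid displacement and of its curl, and of the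
divergences and their gradients. -/
def SmoothPair.energy {K : Set Spacetime} (u : SmoothPair K) (z : Spacetime) : ℝ :=
  (∑ i, ∑ a, D a (u.u 0 i) z ^ 2) + (∑ k, ∑ i, ∑ a, D a (u.W k i) z ^ 2)
    + ∑ r, (∑ a, D a (u.V r) z ^ 2 + u.V r z ^ 2)

theorem sq_le_sum {ι : Type*} [Fintype ι] {f : ι → ℝ} (hf : ∀ i, 0 ≤ f i) {x : ℝ} (i : ι)
    (h : x ≤ f i) : x ≤ ∑ i, f i :=
  h.trans (Finset.single_le_sum (f := f) (fun i _ => hf i) (Finset.mem_univ i))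

theorem srcEnergy_nonneg {P : Coeffs} {K : Set Spacetime} (u : SmoothPair K) (z : Spacetime) :
    0 ≤ P.srcEnergy u z := by unfold Coeffs.srcEnergy; positivity

theorem energy_nonneg {K : Set Spacetime} (u : SmoothPair K) (z : Spacetime) :
    0 ≤ u.energy z := by unfold SmoothPair.energy; positivity

theorem ctlBasic (P : Coeffs) (K : Set Spacetime) :
    CtlBasic (K := K) fun u z => P.srcEnergy u z + u.energy z := by
  have hS := fun (u : SmoothPair K) z => srcEnergy_nonneg (P := P) u z
  have n1 : ∀ (u : SmoothPair K) z, 0 ≤ ∑ i, ∑ a, D a (u.u 0 i) z ^ 2 := fun u z => by positivity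
  have n2 : ∀ (u : SmoothPair K) z, 0 ≤ ∑ k, ∑ i, ∑ a, D a (u.W k i) z ^ 2 :=
    fun u z => by positivity
  have n3 : ∀ (u : SmoothPair K) z, 0 ≤ ∑ r, (∑ a, D a (u.V r) z ^ 2 + u.V r z ^ 2) :=
    fun u z => by positivity
  refine ⟨fun u z _ => add_nonneg (hS u z) (energy_nonneg u z),
    fun i a => Ctl.of_le fun u z _ => ?_, fun k i a => Ctl.of_le fun u z _ => ?_,
    fun r a => Ctl.of_le fun u z _ => ?_,
    fun r => Ctl.of_le fun u z _ => ?_⟩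
  all_goals simp only [SmoothPair.energy]
  · have : D a (u.u 0 i) z ^ 2 ≤ ∑ i, ∑ a, D a (u.u 0 i) z ^ 2 :=
      sq_le_sum (fun i => by positivity) i (sq_le_sum (fun a => sq_nonneg _) a le_rfl)
    linarith [hS u z, n2 u z, n3 u z]
  · have : D a (u.W k i) z ^ 2 ≤ ∑ k, ∑ i, ∑ a, D a (u.W k i) z ^ 2 :=
      sq_le_sum (fun i => by positivity) k (sq_le_sum (fun i => by positivity) i
        (sq_le_sum (fun a => sq_nonneg _) a le_rfl))
    linarith [hS u z, n1 u z, n3 u z]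
  · have : D a (u.V r) z ^ 2 ≤ ∑ r, (∑ a, D a (u.V r) z ^ 2 + u.V r z ^ 2) :=
      sq_le_sum (fun i => by positivity) r ((sq_le_sum (f := fun a => D a (u.V r) z ^ 2)
        (fun a => sq_nonneg _) a le_rfl).trans (le_add_of_nonneg_right (sq_nonneg _)))
    linarith [hS u z, n1 u z, n2 u z]
  · have : u.V r z ^ 2 ≤ ∑ r, (∑ a, D a (u.V r) z ^ 2 + u.V r z ^ 2) :=
      sq_le_sum (fun i => by positivity) r (le_add_of_nonneg_left (by positivity))
    linarith [hS u z, n1 u z, n2 u z]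

/-- The reduced equations and their spatial derivatives are controlled, since they are combinations
of the sources with coefficients of class `C¹`. -/
theorem ctl_op {P : Coeffs} (hP : P.IsC2) {K : Set Spacetime} (hK : IsCompact K)
    (hρ : ∀ z ∈ K, P.rho z.1 ≠ 0) (r : Fin 2) (i : Fin 3) :
    (Ctl (K := K) (fun u z => P.srcEnergy u z + u.energy z) fun u => P.reduced.op u r i) ∧
    ∀ k, Ctl (K := K) (fun u z => P.srcEnergy u z + u.energy z)
      fun u => D (sp k) (P.reduced.op u r i) := by
  have hE := ctlBasic P K
  have hs : ∀ s i, Ctl (K := K) (fun u z => P.srcEnergy u z + u.energy z)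
      fun u => P.src u s i := fun s i => Ctl.of_le fun u z _ =>
    (sq_le_sum (fun r => by positivity) s (sq_le_sum (fun i => by positivity) i
      (le_add_of_nonneg_right (by positivity)))).trans
      (le_add_of_nonneg_right (energy_nonneg u z))
  have hds : ∀ s i k, Ctl (K := K) (fun u z => P.srcEnergy u z + u.energy z)
      fun u => D (sp k) (P.src u s i) := fun s i k => Ctl.of_le fun u z _ =>
    (sq_le_sum (fun r => by positivity) s (sq_le_sum (fun i => by positivity) i
      ((sq_le_sum (f := fun k => D (sp k) (P.src u s i) z ^ 2)
        (fun k => sq_nonneg _) k le_rfl).trans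
        (le_add_of_nonneg_left (sq_nonneg _))))).trans
      (le_add_of_nonneg_right (energy_nonneg u z))
  have hn : ∀ r s, C1On K (P.massInv r s) := fun r s z hz =>
    (hP.massInv_C2 (hρ z hz) r s).of_le (by norm_num)
  refine ⟨(Ctl.sum (s := Finset.univ) hE.nonneg fun s _ =>
    Ctl.coef ((hn r s).bdd hK) (hs s i)).congr fun u z hz => P.op_eq u r i (hρ z hz), fun k => ?_⟩
  refine (Ctl.sum (s := Finset.univ) hE.nonneg fun s _ =>
    (Ctl.coef ((hn r s).bdd_pd hK k) (hs s i)).add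
      (Ctl.coef ((hn r s).bdd hK) (hds s i k))).congr fun u z hz => ?_
  have hev : P.reduced.op u r i =ᶠ[nhds z] fun z => ∑ s, P.massInv r s z.1 * P.src u s i z := by
    have : ∀ᶠ y : Spacetime in nhds z, P.rho y.1 ≠ 0 :=
      (hP.rho_C2.continuous.continuousAt.comp continuousAt_fst).eventually_ne (hρ z hz)
    filter_upwards [this] with y hy using P.op_eq u r i hy
  rw [D_congr hev]
  exact (HasD.sum fun s _ => ((hn r s).hasD hz k).mul
    (hasD ((hP.src_C1 u s i).differentiable (by norm_num) z))).2

/-! ### The estimate for smooth fields -/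

/-- The principal matrix of the system of wave equations for the two divergences is `A`. -/
theorem Coeffs.A_apply (P : Coeffs) (x : Space) (s t : Fin 2) :
    P.A x s t = (if t = 0 then P.reduced.m s x else 0) + P.reduced.al s t x := by
  fin_cases s <;> fin_cases t <;>
    simp [Coeffs.A, Coeffs.reduced, Coeffs.massInv] <;> ring

theorem bound_sum {K : Set Spacetime} {N : SmoothPair K → Spacetime → ℝ} {ι : Type*} [Fintype ι]
    {f : ι → SmoothPair K → Spacetime → ℝ}
    (h : ∀ i, ∃ C ≥ 0, ∀ u, ∀ z ∈ K, f i u z ≤ C * N u z) :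
    ∃ C ≥ 0, ∀ u, ∀ z ∈ K, ∑ i, f i u z ≤ C * N u z := by
  choose C hC H using h
  refine ⟨∑ i, C i, Finset.sum_nonneg fun i _ => hC i, fun u z hz => ?_⟩
  rw [Finset.sum_mul]
  exact Finset.sum_le_sum fun i _ => H i u z hz

theorem bound_add {K : Set Spacetime} {N f g : SmoothPair K → Spacetime → ℝ}
    (hf : ∃ C ≥ 0, ∀ u, ∀ z ∈ K, f u z ≤ C * N u z)
    (hg : ∃ C ≥ 0, ∀ u, ∀ z ∈ K, g u z ≤ C * N u z) :
    ∃ C ≥ 0, ∀ u, ∀ z ∈ K, f u z + g u z ≤ C * N u z := by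
  obtain ⟨C, hC, H⟩ := hf
  obtain ⟨C', hC', H'⟩ := hg
  exact ⟨C + C', by positivity, fun u z hz => by
    rw [add_mul]; exact add_le_add (H u z hz) (H' u z hz)⟩

/-- The Carleman estimate for Biot's system and smooth fields, from the three scalar estimates. The
equation `∂_t² V = A Δ V + …` for the divergences `V` is multiplied by the rows of `A - c₃` and of
`A - c₂`. By the Cayley–Hamilton theorem, `(A - c₃) A = c₂ (A - c₃)` and `(A - c₂) A = c₃ (A - c₂)`,
so the components of `Z₂ = (A - c₃) V` and `Z₃ = (A - c₂) V` solve scalar wave equations with speeds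
`c₂` and `c₃`; moreover `Z₂ - Z₃ = (c₂ - c₃) V`. No eigenvectors have to be chosen. -/
theorem smooth_estimate {K : Set Spacetime} (hK : IsCompact K) {φ : Spacetime → ℝ}
    (hφ : Continuous φ) {P : Coeffs} (hP : P.IsC2) {c₂ c₃ : Space → ℝ} {U : Set Space}
    (hU : IsOpen U) (hKU : ∀ z ∈ K, z.1 ∈ U) (hρ : ∀ x ∈ U, P.rho x ≠ 0)
    (hc₂ : ∀ x ∈ U, ContDiffAt ℝ 2 c₂ x) (hc₃ : ∀ x ∈ U, ContDiffAt ℝ 2 c₃ x)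
    (hne : ∀ x ∈ U, c₂ x ≠ c₃ x)
    (htr : ∀ x ∈ U, P.A x 0 0 + P.A x 1 1 = c₂ x + c₃ x)
    (hdet : ∀ x ∈ U, P.A x 0 0 * P.A x 1 1 - P.A x 0 1 * P.A x 1 0 = c₂ x * c₃ x)
    (C₁ : WaveCarleman K φ P.mu1) (C₂ : WaveCarleman K φ c₂) (C₃ : WaveCarleman K φ c₃) :
    ∃ τs ≥ 1, ∃ C > 0, ∀ τ ≥ τs, ∀ u : SmoothPair K,
      ∫ z, (τ * ((∑ i, ∑ a, D a (u.u 0 i) z ^ 2) + ∑ r, ∑ a, D a (u.V r) z ^ 2)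
          + τ ^ 3 * ((∑ i, u.u 0 i z ^ 2) + ∑ r, u.V r z ^ 2)) * Real.exp (2 * τ * φ z)
        ≤ C * ∫ z, P.srcEnergy u z * Real.exp (2 * τ * φ z) := by
  have hρK : ∀ z ∈ K, P.rho z.1 ≠ 0 := fun z hz => hρ z.1 (hKU z hz)
  have hR := hP.reduced_C1 hρK
  have hE := ctlBasic P K
  have hop := fun r i => (ctl_op hP hK hρK r i).1
  have hDop := fun r i => (ctl_op hP hK hρK r i).2
  have hK1 : IsCompact (Prod.fst '' K) := hK.image continuous_fst
  have hKU1 : Prod.fst '' K ⊆ U := by rintro _ ⟨z, hz, rfl⟩; exact hKU z hz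
  -- the matrices `A - c₃` and `A - c₂`, whose rows are left eigenvectors of `A`
  have hA : ∀ x ∈ U, ∀ s t, ContDiffAt ℝ 2 (fun x => P.A x s t) x := by
    intro x hx s t
    have hn := hP.massInv_C2 (hρ x hx)
    have e : (fun x => P.A x s t) = fun x =>
        (if t = 0 then P.reduced.m s x else 0) + P.reduced.al s t x := by
      ext x; exact P.A_apply x s t
    rw [e]
    have a1 := hP.mu.contDiffAt (x := x)
    have a2 := hP.lam.contDiffAt (x := x)
    have a3 := hP.q.contDiffAt (x := x)
    have a4 := hP.r.contDiffAt (x := x)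
    fin_cases t
    · exact ((hn s 0).mul a1).add (((hn s 0).mul (a1.add a2)).add ((hn s 1).mul a3))
    · exact contDiffAt_const.add (((hn s 0).mul a3).add ((hn s 1).mul a4))
  have hext : ∀ c : Space → ℝ, (∀ x ∈ U, ContDiffAt ℝ 2 c x) → ∀ r s : Fin 2,
      ∃ B : Space → ℝ, ContDiff ℝ 2 B ∧ ∀ x ∈ Prod.fst '' K,
        B =ᶠ[nhds x] fun x => P.A x r s - if r = s then c x else 0 := by
    intro c hc r s
    have hd : ∀ x ∈ U, ContDiffAt ℝ ((2 : ℕ∞) : WithTop ℕ∞)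
        (fun x => P.A x r s - if r = s then c x else 0) x := fun x hx => by
      refine (hA x hx r s).sub ?_
      split_ifs
      · exact hc x hx
      · exact contDiffAt_const
    obtain ⟨B, hB, -, hB'⟩ := exists_contDiff_extension hK1 hU hKU1 hd
    exact ⟨B, hB, hB'⟩
  choose B₂ hB₂ hB₂' using hext c₃ hc₃
  choose B₃ hB₃ hB₃' using hext c₂ hc₂
  have hBA : ∀ (c d : Space → ℝ) (B : Fin 2 → Fin 2 → Space → ℝ),
      (∀ x ∈ U, P.A x 0 0 + P.A x 1 1 = c x + d x) →
      (∀ x ∈ U, P.A x 0 0 * P.A x 1 1 - P.A x 0 1 * P.A x 1 0 = c x * d x) →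
      (∀ r s, ∀ x ∈ Prod.fst '' K, B r s =ᶠ[nhds x] fun x => P.A x r s - if r = s then d x else 0) →
      ∀ r, ∀ z ∈ K, ∀ t, ∑ s, B r s z.1 * ((if t = 0 then P.reduced.m s z.1 else 0)
        + P.reduced.al s t z.1) = c z.1 * B r t z.1 := by
    intro c d B h1 h2 hB r z hz t
    have h1 := h1 z.1 (hKU z hz)
    have h2 := h2 z.1 (hKU z hz)
    simp only [← P.A_apply, (hB _ _ z.1 ⟨z, hz, rfl⟩).self_of_nhds, Fin.sum_univ_two]
    fin_cases r <;> fin_cases t <;> simp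
    · linear_combination P.A z.1 0 0 * h1 - h2
    · linear_combination P.A z.1 0 1 * h1
    · linear_combination P.A z.1 1 0 * h1
    · linear_combination P.A z.1 1 1 * h1 - h2
  have hc1 : ∀ c : Space → ℝ, (∀ x ∈ U, ContDiffAt ℝ 2 c x) → C1On K c := fun c hc z hz =>
    (hc z.1 (hKU z hz)).of_le (by norm_num)
  -- the unknowns of the principally diagonal system
  set Z₂ : SmoothPair K → Fin 2 → Spacetime → ℝ := fun u r z => ∑ s, B₂ r s z.1 * u.V s z with hZ₂
  set Z₃ : SmoothPair K → Fin 2 → Spacetime → ℝ := fun u r z => ∑ s, B₃ r s z.1 * u.V s z with hZ₃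
  have hZC : ∀ (B : Fin 2 → Fin 2 → Space → ℝ), (∀ r s, ContDiff ℝ 2 (B r s)) →
      ∀ (u : SmoothPair K) r, ContDiff ℝ 2 fun z : Spacetime => ∑ s, B r s z.1 * u.V s z :=
    fun B hB u r => ContDiff.sum fun s _ =>
      ((hB r s).comp contDiff_fst).mul ((u.smooth_V s).of_nat 2)
  have hZK : ∀ (B : Fin 2 → Fin 2 → Space → ℝ) (u : SmoothPair K) r,
      tsupport (fun z : Spacetime => ∑ s, B r s z.1 * u.V s z) ⊆ K := by
    intro B u r
    refine closure_minimal (fun z hz => ?_) hK.isClosed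
    by_contra h
    refine hz (Finset.sum_eq_zero fun s _ => ?_)
    rw [image_eq_zero_of_notMem_tsupport fun h' => h (u.tsupport_V hK.isClosed s h'), mul_zero]
  set w : SmoothPair K → (Fin 3 ⊕ (Fin 3 × Fin 3)) ⊕ (Fin 2 ⊕ Fin 2) → Spacetime → ℝ := fun u =>
    Sum.elim (Sum.elim (u.u 0) fun p => u.W p.1 p.2) (Sum.elim (Z₂ u) (Z₃ u)) with hw
  set c : (Fin 3 ⊕ (Fin 3 × Fin 3)) ⊕ (Fin 2 ⊕ Fin 2) → Space → ℝ :=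
    Sum.elim (fun _ => P.mu1) (Sum.elim (fun _ => c₂) fun _ => c₃) with hc
  set N₁ : SmoothPair K → Spacetime → ℝ := fun u z => ∑ j, ∑ a, D a (w u j) z ^ 2 with hN₁
  set N₀ : SmoothPair K → Spacetime → ℝ := fun u z => ∑ j, w u j z ^ 2 with hN₀
  have hN₁0 : ∀ u z, 0 ≤ N₁ u z := fun u z => by rw [hN₁]; positivity
  have hN₀0 : ∀ u z, 0 ≤ N₀ u z := fun u z => by rw [hN₀]; positivity
  have hN : ∀ u z, ∑ j, (∑ a, D a (w u j) z ^ 2 + w u j z ^ 2) = N₁ u z + N₀ u z :=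
    fun u z => Finset.sum_add_distrib
  have k0 : ∀ j, Ctl N₀ fun u => w u j := fun j => Ctl.of_le fun u z _ =>
    sq_le_sum (fun j => sq_nonneg _) j le_rfl
  have k1 : ∀ j a, Ctl (fun u z => N₁ u z + N₀ u z) fun u => D a (w u j) := fun j a =>
    Ctl.of_le fun u z _ => (sq_le_sum (f := fun j => ∑ a, D a (w u j) z ^ 2)
      (fun j => by positivity) j (sq_le_sum (f := fun a => D a (w u j) z ^ 2)
        (fun a => sq_nonneg _) a le_rfl)).trans (le_add_of_nonneg_right (hN₀0 u z))
  have k01 : ∀ j, Ctl (fun u z => N₁ u z + N₀ u z) fun u => w u j := fun j =>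
    (k0 j).trans ⟨1, zero_le_one, fun u z _ => by linarith [hN₁0 u z]⟩
  -- the divergences are recovered from the rows of `(A - c₃) V` and `(A - c₂) V`
  set e : Space → ℝ := fun x => (c₂ x - c₃ x)⁻¹ with he
  have heC : C1On K e := fun z hz =>
    (((hc₂ z.1 (hKU z hz)).sub (hc₃ z.1 (hKU z hz))).inv
      (sub_ne_zero.2 (hne z.1 (hKU z hz)))).of_le (by norm_num)
  have hVev : ∀ (u : SmoothPair K) r, ∀ z ∈ K,
      u.V r =ᶠ[nhds z] fun z => e z.1 * (Z₂ u r z - Z₃ u r z) := by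
    intro u r z hz
    have hb : ∀ s, ∀ᶠ y : Spacetime in nhds z,
        B₂ r s y.1 - B₃ r s y.1 = if r = s then c₂ y.1 - c₃ y.1 else 0 := by
      intro s
      have h1 := continuousAt_fst.eventually (hB₂' r s z.1 ⟨z, hz, rfl⟩)
      have h2 := continuousAt_fst.eventually (hB₃' r s z.1 ⟨z, hz, rfl⟩)
      filter_upwards [h1, h2] with y h1 h2
      rw [h1, h2]
      split_ifs <;> ring
    have hUz : ∀ᶠ y : Spacetime in nhds z, y.1 ∈ U :=
      continuousAt_fst.eventually (hU.mem_nhds (hKU z hz))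
    filter_upwards [hb 0, hb 1, hUz] with y h0 h1 hy
    have hny := sub_ne_zero.2 (hne y.1 hy)
    have : Z₂ u r y - Z₃ u r y = (c₂ y.1 - c₃ y.1) * u.V r y := by
      simp only [hZ₂, hZ₃, Fin.sum_univ_two]
      have : B₂ r 0 y.1 * u.V 0 y + B₂ r 1 y.1 * u.V 1 y
          - (B₃ r 0 y.1 * u.V 0 y + B₃ r 1 y.1 * u.V 1 y)
          = (B₂ r 0 y.1 - B₃ r 0 y.1) * u.V 0 y + (B₂ r 1 y.1 - B₃ r 1 y.1) * u.V 1 y := by ring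
      rw [this, h0, h1]
      fin_cases r <;> simp
    rw [this, he, inv_mul_cancel_left₀ hny]
  have kV : ∀ r, Ctl N₀ fun u => u.V r := fun r =>
    (Ctl.coef (heC.bdd hK) ((k0 (Sum.inr (Sum.inl r))).sub (k0 (Sum.inr (Sum.inr r))))).congr
      fun u z hz => (hVev u r z hz).self_of_nhds
  have kDV : ∀ r a, Ctl (fun u z => N₁ u z + N₀ u z) fun u => D a (u.V r) := by
    intro r a
    have hd : ∀ (u : SmoothPair K) z a, HasD a (Z₂ u r) (D a (Z₂ u r) z) z ∧
        HasD a (Z₃ u r) (D a (Z₃ u r) z) z := fun u z a =>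
      ⟨hasD ((hZC B₂ hB₂ u r).differentiable (by norm_num) z),
        hasD ((hZC B₃ hB₃ u r).differentiable (by norm_num) z)⟩
    induction a using Fin.lastCases with
    | last =>
      refine (Ctl.coef (heC.bdd hK) ((k1 (Sum.inr (Sum.inl r)) tm).sub
        (k1 (Sum.inr (Sum.inr r)) tm))).congr fun u z hz => ?_
      rw [D_congr (hVev u r z hz), ((hasD_tm ((heC z hz).differentiableAt (by norm_num))).mul
        ((hd u z tm).1.sub (hd u z tm).2)).2, zero_mul, zero_add]
      rfl
    | cast i =>
      refine ((Ctl.coef (heC.bdd_pd hK i) ((k01 (Sum.inr (Sum.inl r))).sub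
        (k01 (Sum.inr (Sum.inr r))))).add (Ctl.coef (heC.bdd hK)
          ((k1 (Sum.inr (Sum.inl r)) (sp i)).sub
        (k1 (Sum.inr (Sum.inr r)) (sp i))))).congr fun u z hz => ?_
      rw [D_congr (hVev u r z hz), ((heC.hasD hz i).mul
        ((hd u z (sp i)).1.sub (hd u z (sp i)).2)).2]
      rfl
  have kEn : ∃ C ≥ 0, ∀ u : SmoothPair K, ∀ z ∈ K, u.energy z ≤ C * (N₁ u z + N₀ u z) :=
    bound_add (bound_add (bound_sum fun i => bound_sum fun a => k1 (Sum.inl (Sum.inl i)) a)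
      (bound_sum fun k => bound_sum fun i => bound_sum fun a => k1 (Sum.inl (Sum.inr (k, i))) a))
      (bound_sum fun r => bound_add (bound_sum fun a => kDV r a)
        ((kV r).trans ⟨1, zero_le_one, fun u z _ => by linarith [hN₁0 u z]⟩))
  have hCarl : ∀ j, WaveCarleman K φ (c j) := by
    rintro ((i | p) | (r | r))
    exacts [C₁, C₁, C₂, C₃]
  have hwC : ∀ u j, ContDiff ℝ 2 (w u j) := by
    rintro u ((i | p) | (r | r))
    exacts [(u.smooth 0 i).of_nat 2, (u.smooth_W _ _).of_nat 2, hZC B₂ hB₂ u r, hZC B₃ hB₃ u r]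
  have hwK : ∀ u j, tsupport (w u j) ⊆ K := by
    rintro u ((i | p) | (r | r))
    exacts [u.supp 0 i, u.tsupport_W hK.isClosed _ _, hZK B₂ u r, hZK B₃ u r]
  have hmu : ∀ z ∈ K, P.reduced.m 0 z.1 = P.mu1 z.1 := fun z _ => rfl
  have hL : ∀ j, Ctl (fun u z => P.srcEnergy u z + u.energy z) fun u z =>
      D tm (D tm (w u j)) z - c j z.1 * lap (w u j) z := by
    rintro ((i | p) | (r | r))
    · exact hE.wave_U hK hR i fun i => hop 0 i
    · exact hE.wave_W hK hR p.1 p.2 fun i k => hDop 0 i k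
    · exact hE.wave_Z hK hR (B₂ r) (hB₂ r) c₂ (hc1 c₂ hc₂)
        (hBA c₂ c₃ B₂ htr hdet hB₂' r) hDop
    · exact hE.wave_Z hK hR (B₃ r) (hB₃ r) c₃ (hc1 c₃ hc₃)
        (hBA c₃ c₂ B₃ (fun x hx => by rw [htr x hx, add_comm])
          (fun x hx => by rw [hdet x hx, mul_comm]) hB₃' r) hDop
  have hsrcC : ∀ u : SmoothPair K, Continuous (P.srcEnergy u) := fun u => by
    have h1 := fun r i => (hP.src_C1 u r i).continuous
    have h2 := fun r i k => continuous_D (hP.src_C1 u r i) k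
    unfold Coeffs.srcEnergy
    fun_prop
  have hsrcK : ∀ u : SmoothPair K, ∀ z ∉ K, P.srcEnergy u z = 0 := fun u z hz => by
    have h1 : ∀ r i, P.src u r i z = 0 := fun r i =>
      image_eq_zero_of_notMem_tsupport fun h => hz (tsupport_src hK.isClosed u r i h)
    have h2 : ∀ r i k, D k (P.src u r i) z = 0 := fun r i k =>
      D_eq_zero_of_notMem fun h => hz (tsupport_src hK.isClosed u r i h)
    simp [Coeffs.srcEnergy, h1, h2]
  obtain ⟨τs, hτs, C, hC, main⟩ := carleman_absorb hK hφ w c hwC hwK hCarl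
    (fun u => P.srcEnergy u) (fun u z => P.srcEnergy u z + u.energy z) hsrcC
    (fun u z => srcEnergy_nonneg u z) hsrcK hL (by
      obtain ⟨M, hM, h⟩ := kEn
      refine ⟨M + 1, by positivity, fun u z hz => ?_⟩
      rw [hN]
      nlinarith [h u z hz, srcEnergy_nonneg (P := P) u z, hN₁0 u z, hN₀0 u z])
  obtain ⟨M₁, hM₁, h₁⟩ : ∃ C ≥ 0, ∀ u : SmoothPair K, ∀ z ∈ K,
      (∑ i, ∑ a, D a (u.u 0 i) z ^ 2) + ∑ r, ∑ a, D a (u.V r) z ^ 2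
        ≤ C * (N₁ u z + N₀ u z) :=
    bound_add (bound_sum fun i => bound_sum fun a => k1 (Sum.inl (Sum.inl i)) a)
      (bound_sum fun r => bound_sum fun a => kDV r a)
  obtain ⟨M₀, hM₀, h₀⟩ : ∃ C ≥ 0, ∀ u : SmoothPair K, ∀ z ∈ K,
      (∑ i, u.u 0 i z ^ 2) + ∑ r, u.V r z ^ 2 ≤ C * N₀ u z :=
    bound_add (bound_sum fun i => k0 (Sum.inl (Sum.inl i))) (bound_sum fun r => kV r)
  refine ⟨τs, hτs, (M₁ + M₀ + 1) * C, by positivity, fun τ hτ u => ?_⟩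
  have hτ1 : 1 ≤ τ := hτs.trans hτ
  rw [mul_assoc]
  refine le_trans ?_ (mul_le_mul_of_nonneg_left (main τ hτ u) (by positivity))
  rw [← integral_const_mul]
  have hwD : ∀ j a, Continuous (D a (w u j)) := fun j a =>
    continuous_D ((hwC u j).of_le (by norm_num)) a
  have hwc : ∀ j, Continuous (w u j) := fun j => (hwC u j).continuous
  have hw0 : ∀ j, ∀ z ∉ K, w u j z = 0 := fun j z hz =>
    image_eq_zero_of_notMem_tsupport fun h => hz (hwK u j h)
  have hD0 : ∀ j a, ∀ z ∉ K, D a (w u j) z = 0 := fun j a z hz =>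
    D_eq_zero_of_notMem fun h => hz (hwK u j h)
  refine integral_mono_of_nonneg (Filter.Eventually.of_forall fun z => by positivity)
    ((integrable_mul_exp hK (by fun_prop) hφ
      (fun z hz => by simp [hw0 _ z hz, hD0 _ _ z hz]) τ).const_mul _)
    (Filter.Eventually.of_forall fun z => ?_)
  simp only
  rw [← mul_assoc]
  refine mul_le_mul_of_nonneg_right ?_ (Real.exp_pos _).le
  have hsum : ∑ j, (τ * ∑ a, D a (w u j) z ^ 2 + τ ^ 3 * w u j z ^ 2)
      = τ * N₁ u z + τ ^ 3 * N₀ u z := by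
    rw [Finset.sum_add_distrib, ← Finset.mul_sum, ← Finset.mul_sum]
  rw [hsum]
  by_cases hz : z ∈ K
  · have hττ : τ ≤ τ ^ 3 := le_self_pow₀ hτ1 (by norm_num)
    have hτp : 0 < τ := by linarith
    calc _ ≤ τ * (M₁ * (N₁ u z + N₀ u z)) + τ ^ 3 * (M₀ * N₀ u z) := by
          gcongr
          · exact h₁ u z hz
          · exact h₀ u z hz
      _ = M₁ * (τ * N₁ u z) + M₁ * (τ * N₀ u z) + M₀ * (τ ^ 3 * N₀ u z) := by ring
      _ ≤ M₁ * (τ * N₁ u z) + M₁ * (τ ^ 3 * N₀ u z) + M₀ * (τ ^ 3 * N₀ u z) := by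
          have := hN₀0 u z
          gcongr
      _ ≤ _ := by
          have a1 : 0 ≤ τ * N₁ u z := mul_nonneg hτp.le (hN₁0 u z)
          have a2 : 0 ≤ τ ^ 3 * N₀ u z := mul_nonneg (by positivity) (hN₀0 u z)
          nlinarith [mul_nonneg hM₀ a1]
  · have h1 : ∀ i, u.u 0 i z = 0 := fun i => hw0 (Sum.inl (Sum.inl i)) z hz
    have h2 : ∀ i a, D a (u.u 0 i) z = 0 := fun i a => hD0 (Sum.inl (Sum.inl i)) a z hz
    have h3 : ∀ r, u.V r z = 0 := fun r =>
      image_eq_zero_of_notMem_tsupport fun h => hz (u.tsupport_V hK.isClosed r h)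
    have h4 : ∀ r a, D a (u.V r) z = 0 := fun r a =>
      D_eq_zero_of_notMem fun h => hz (u.tsupport_V hK.isClosed r h)
    have : 0 ≤ τ * N₁ u z + τ ^ 3 * N₀ u z :=
      add_nonneg (mul_nonneg (by linarith) (hN₁0 u z)) (mul_nonneg (by positivity) (hN₀0 u z))
    simp only [h1, h2, h3, h4]
    simpa using mul_nonneg (by positivity) this

/-! ### Continuity of translations and averaging kernels in `L²` -/

open Filter Topology in
/-- Translations are continuous in `L²`. -/
theorem tendsto_eLpNorm_translate {g : Spacetime → ℝ} (hg : MemLp g 2 volume) :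
    Tendsto (fun t : Spacetime => eLpNorm (fun z => g (z - t) - g z) 2 volume) (𝓝 0) (𝓝 0) := by
  have hm : ∀ t : Spacetime, MeasurePreserving (fun z : Spacetime => z - t) volume volume :=
    fun t => measurePreserving_sub_right volume t
  let G : Spacetime → C(Spacetime, Spacetime) := fun t => ⟨fun z => z - t, by fun_prop⟩
  have hG : Continuous G := ContinuousMap.continuous_of_continuous_uncurry _ (by
    simp only [G, Function.uncurry_def, ContinuousMap.coe_mk]; fun_prop)
  have h1 : Continuous fun t => Lp.compMeasurePreserving (G t) (hm t) hg.toLp :=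
    Continuous.compMeasurePreservingLp continuous_const hG (fun t => hm t) (by norm_num)
  have h2 := (h1.tendsto 0)
  rw [Lp.tendsto_Lp_iff_tendsto_eLpNorm'] at h2
  refine h2.congr fun t => eLpNorm_congr_ae ?_
  have e : ∀ t, ⇑(Lp.compMeasurePreserving (G t) (hm t) hg.toLp) =ᵐ[volume] fun z => g (z - t) :=
    fun t => (Lp.coeFn_compMeasurePreserving hg.toLp (hm t)).trans
      ((hm t).quasiMeasurePreserving.ae_eq hg.coeFn_toLp)
  filter_upwards [e t, e 0] with z h1 h2
  rw [Pi.sub_apply, h1, h2, sub_zero]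

theorem eLpNorm_two_sq {f : Spacetime → ℝ} : eLpNorm f 2 volume ^ 2 = ∫⁻ z, ‖f z‖ₑ ^ 2 := by
  have := eLpNorm_nnreal_pow_eq_lintegral (f := f) (μ := volume) (p := 2) (by norm_num)
  simpa using this

/-- The Cauchy–Schwarz inequality against the constant function `1`. -/
theorem lintegral_sq_le {α : Type*} [MeasurableSpace α] (μ : Measure α) {f : α → ENNReal}
    (hf : AEMeasurable f μ) : (∫⁻ t, f t ∂μ) ^ 2 ≤ μ univ * ∫⁻ t, f t ^ 2 ∂μ := by
  have h := ENNReal.lintegral_mul_le_Lp_mul_Lq μ Real.HolderConjugate.two_two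
    (f := fun _ => 1) (g := f) aemeasurable_const hf
  have e : ∀ x : ENNReal, (x ^ (1 / 2 : ℝ)) ^ 2 = x := fun x => by
    rw [← ENNReal.rpow_natCast, ← ENNReal.rpow_mul]; norm_num
  simp only [ENNReal.rpow_two, Pi.mul_apply, one_mul, one_pow, lintegral_const] at h
  calc (∫⁻ t, f t ∂μ) ^ 2 ≤ _ := pow_le_pow_left₀ zero_le h 2
    _ = _ := by rw [mul_pow, e, e]

open Metric in
/-- An average of translation differences over a small ball, with a kernel of the size of the
reciprocal of its volume, is controlled by the `L²` modulus of continuity. -/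
theorem eLpNorm_kernel_le {g : Spacetime → ℝ} (hg : AEStronglyMeasurable g volume) {κ r : ℝ}
    (hr : 0 < r)
    {k : Spacetime → Spacetime → ℝ} (hk : ∀ z t, |k z t| ≤ κ / volume.real (ball (0 : Spacetime) r))
    (hk0 : ∀ z, ∀ t ∉ ball (0 : Spacetime) r, k z t = 0) {ε : ENNReal}
    (hε : ∀ t ∈ ball (0 : Spacetime) r, eLpNorm (fun z => g (z - t) - g z) 2 volume ≤ ε) :
    eLpNorm (fun z => ∫ t, k z t * (g (z - t) - g z)) 2 volume ≤ ENNReal.ofReal κ * ε := by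
  set B := ball (0 : Spacetime) r
  set v := volume B
  have hv0 : v ≠ 0 := (measure_ball_pos volume _ hr).ne'
  have hv1 : v ≠ ⊤ := measure_ball_lt_top.ne
  have hvp : 0 < volume.real B := ENNReal.toReal_pos hv0 hv1
  have hgs : AEStronglyMeasurable (fun p : Spacetime × Spacetime => g (p.1 - p.2) - g p.1)
      (volume.prod (volume.restrict B)) :=
    (hg.comp_quasiMeasurePreserving
      (quasiMeasurePreserving_sub_of_right_invariant volume (volume.restrict B))).sub hg.comp_fst
  have hgz : ∀ z, AEStronglyMeasurable (fun t => g (z - t) - g z) (volume.restrict B) := fun z =>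
    ((hg.comp_quasiMeasurePreserving
      (quasiMeasurePreserving_sub_left_of_right_invariant volume z)).sub
        aestronglyMeasurable_const).restrict
  have hpt : ∀ z, ‖∫ t, k z t * (g (z - t) - g z)‖ₑ ^ 2
      ≤ ENNReal.ofReal κ ^ 2 * v⁻¹ * ∫⁻ t in B, ‖g (z - t) - g z‖ₑ ^ 2 := fun z => by
    have h1 : ‖∫ t, k z t * (g (z - t) - g z)‖ₑ
        ≤ ENNReal.ofReal κ * v⁻¹ * ∫⁻ t in B, ‖g (z - t) - g z‖ₑ := by
      refine (enorm_integral_le_lintegral_enorm _).trans ?_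
      rw [← lintegral_const_mul'' _ (hgz z).enorm, ← lintegral_indicator measurableSet_ball]
      refine lintegral_mono fun t => ?_
      by_cases ht : t ∈ B
      · rw [indicator_of_mem ht, enorm_mul]
        gcongr
        rw [← ofReal_norm, Real.norm_eq_abs]
        refine (ENNReal.ofReal_le_ofReal (hk z t)).trans_eq ?_
        rw [ENNReal.ofReal_div_of_pos hvp, div_eq_mul_inv, Measure.real,
          ENNReal.ofReal_toReal hv1]
      · simp [hk0 z t ht]
    calc _ ≤ (ENNReal.ofReal κ * v⁻¹ * ∫⁻ t in B, ‖g (z - t) - g z‖ₑ) ^ 2 := by gcongr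
      _ ≤ (ENNReal.ofReal κ * v⁻¹) ^ 2 * (v * ∫⁻ t in B, ‖g (z - t) - g z‖ₑ ^ 2) := by
          rw [mul_pow]
          gcongr
          simpa using lintegral_sq_le (volume.restrict B) (hgz z).enorm
      _ = ENNReal.ofReal κ ^ 2 * v⁻¹ * (v⁻¹ * v) * ∫⁻ t in B, ‖g (z - t) - g z‖ₑ ^ 2 := by ring
      _ = _ := by rw [ENNReal.inv_mul_cancel hv0 hv1, mul_one]
  rw [← ENNReal.pow_le_pow_left_iff two_ne_zero, eLpNorm_two_sq]
  calc _ ≤ ∫⁻ z, ENNReal.ofReal κ ^ 2 * v⁻¹ * ∫⁻ t in B, ‖g (z - t) - g z‖ₑ ^ 2 :=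
        lintegral_mono hpt
    _ = ENNReal.ofReal κ ^ 2 * v⁻¹ * ∫⁻ t in B, ∫⁻ z, ‖g (z - t) - g z‖ₑ ^ 2 := by
        rw [lintegral_const_mul' _ _ (by finiteness), lintegral_lintegral_swap]
        exact hgs.enorm.pow_const 2
    _ ≤ ENNReal.ofReal κ ^ 2 * v⁻¹ * ∫⁻ t in B, ε ^ 2 := by
        refine mul_le_mul_right ?_ _
        refine setLIntegral_mono' measurableSet_ball fun t ht => ?_
        rw [← eLpNorm_two_sq]
        gcongr
        exact hε t ht
    _ = (ENNReal.ofReal κ * ε) ^ 2 * (v⁻¹ * v) := by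
        rw [setLIntegral_const]; ring
    _ = _ := by rw [ENNReal.inv_mul_cancel hv0 hv1, mul_one]

/-! ### Mollification -/

/-- The convolution of a kernel `η` with a function `g` on space-time. -/
def conv (η g : Spacetime → ℝ) (z : Spacetime) : ℝ := ∫ t, η t * g (z - t)

section conv

variable {η g : Spacetime → ℝ}

theorem conv_eq_convolution (η g : Spacetime → ℝ) :
    conv η g = convolution η g (ContinuousLinearMap.lsmul ℝ ℝ) volume := rfl

theorem integrable_conv (hη : Continuous η) (hc : HasCompactSupport η)
    (hg : LocallyIntegrable g volume) (z : Spacetime) : Integrable fun t => η t * g (z - t) :=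
  hc.convolutionExists_left (ContinuousLinearMap.lsmul ℝ ℝ) hη hg z

theorem smooth_conv (hη : Smooth η) (hc : HasCompactSupport η) (hg : LocallyIntegrable g volume) :
    Smooth (conv η g) :=
  hc.contDiff_convolution_left (ContinuousLinearMap.lsmul ℝ ℝ) hη hg

theorem D_conv (hη : Smooth η) (hc : HasCompactSupport η) (hg : LocallyIntegrable g volume)
    (a : Fin 4) : D a (conv η g) = conv (D a η) g := by
  ext z
  have h := hc.hasFDerivAt_convolution_left (ContinuousLinearMap.lsmul ℝ ℝ)
    (hη.of_nat 1) hg z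
  have hi : Integrable (fun t => ContinuousLinearMap.precompL Spacetime
      (ContinuousLinearMap.lsmul ℝ ℝ (E := ℝ)) (fderiv ℝ η t) (g (z - t))) volume :=
    (hc.fderiv ℝ).convolutionExists_left _ (hη.continuous_fderiv (by simp)) hg z
  have e := ContinuousLinearMap.integral_apply hi (dir a)
  rw [D, conv_eq_convolution, h.fderiv]
  refine e.trans (integral_congr_ae (Filter.Eventually.of_forall fun t => ?_))
  simp only [ContinuousLinearMap.precompL_apply, ContinuousLinearMap.lsmul_apply, smul_eq_mul, D]

theorem conv_swap (η g : Spacetime → ℝ) (z : Spacetime) :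
    conv η g z = ∫ t, η (z - t) * g t := by
  rw [conv, ← integral_sub_left_eq_self _ volume z]
  simp

/-- A weak derivative may be moved onto the smooth kernel of a convolution. -/
theorem conv_D_of_weak {f : Spacetime → ℝ} {a : Fin 4} (h : IsWeakPartial univ a f g)
    (hη : Smooth η) (hc : HasCompactSupport η) : conv (D a η) f = conv η g := by
  ext z
  have hs : Smooth fun t => η (z - t) := hη.comp (contDiff_const.sub contDiff_id)
  have hcs : HasCompactSupport fun t => η (z - t) := hc.comp_homeomorph (Homeomorph.subLeft z)
  have e : ∀ t, fderiv ℝ (fun t => η (z - t)) t (dir a) = - D a η (z - t) := fun t => by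
    have h1 := ((hη.of_nat 1).differentiable (by norm_num) (z - t)).hasFDerivAt.comp t
      ((hasFDerivAt_const z t).sub (hasFDerivAt_id t))
    have h2 : fderiv ℝ (fun t => η (z - t)) t = _ := h1.fderiv
    rw [h2]
    simp [D]
  have := h _ hs hcs (subset_univ _)
  simp only [e, setIntegral_univ, mul_neg, integral_neg, neg_inj] at this
  rw [conv_swap, conv_swap]
  simpa only [mul_comm] using this

/-- A classical derivative is a weak derivative. -/
theorem isWeakPartial_of_contDiff {f : Spacetime → ℝ} (hf : ContDiff ℝ 1 f) (a : Fin 4) :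
    IsWeakPartial univ a f (D a f) := by
  intro ζ hζ hc _
  have h1 : ContDiff ℝ 1 ζ := Smooth.of_nat hζ 1
  have := integral_D_eq_zero (a := a) (hf.mul h1) hc.mul_left
  have e : ∀ z, D a (fun z => f z * ζ z) z = D a f z * ζ z + f z * D a ζ z := fun z =>
    ((Biot.hasD (hf.differentiable (by norm_num) z)).mul
      (Biot.hasD (h1.differentiable (by norm_num) z))).2
  have hcD : HasCompactSupport (D a ζ) := hc.mono' ((subset_tsupport _).trans tsupport_D_subset)
  have i1 : Integrable fun z => D a f z * ζ z :=
    ((continuous_D hf a).mul h1.continuous).integrable_of_hasCompactSupport hc.mul_left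
  have i2 : Integrable fun z => f z * D a ζ z :=
    (hf.continuous.mul (continuous_D h1 a)).integrable_of_hasCompactSupport hcD.mul_left
  rw [integral_congr_ae (Filter.Eventually.of_forall e), integral_add i1 i2] at this
  simp only [setIntegral_univ]
  change ∫ z, f z * D a ζ z = _
  linarith

end conv

/-! ### The standard mollifiers -/

/-- A smooth bump of integral one, supported in the unit ball. -/
def bump : Spacetime → ℝ :=
  (⟨1 / 2, 1, by norm_num, by norm_num⟩ : ContDiffBump (0 : Spacetime)).normed volume

theorem smooth_bump : Smooth bump := ContDiffBump.contDiff_normed _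

theorem support_bump : Function.support bump = Metric.ball 0 1 :=
  ContDiffBump.support_normed_eq _

theorem hasCompactSupport_bump : HasCompactSupport bump := ContDiffBump.hasCompactSupport_normed _

/-- The dimension of space-time. -/
abbrev dim : ℕ := Module.finrank ℝ Spacetime

/-- The bump rescaled to the ball of radius `r`. -/
def kern (r : ℝ) (t : Spacetime) : ℝ := (r ^ dim)⁻¹ * bump (r⁻¹ • t)

section kern

variable {r : ℝ}

theorem smooth_kern : Smooth (kern r) :=
  contDiff_const.mul (smooth_bump.comp (contDiff_const_smul _))

theorem support_kern (hr : 0 < r) : Function.support (kern r) ⊆ Metric.ball 0 r := by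
  intro t ht
  have h : r⁻¹ • t ∈ Function.support bump := fun h => ht (by simp [kern, h])
  rw [support_bump, mem_ball_zero_iff, norm_smul, norm_inv, Real.norm_of_nonneg hr.le,
    inv_mul_lt_one₀ hr] at h
  simpa using h

theorem tsupport_kern (hr : 0 < r) : tsupport (kern r) ⊆ Metric.closedBall 0 r :=
  closure_minimal ((support_kern hr).trans Metric.ball_subset_closedBall) Metric.isClosed_closedBall

theorem hasCompactSupport_kern (hr : 0 < r) : HasCompactSupport (kern r) :=
  (isCompact_closedBall 0 r).of_isClosed_subset (isClosed_tsupport _) (tsupport_kern hr)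

theorem kern_nonneg (hr : 0 < r) (t : Spacetime) : 0 ≤ kern r t :=
  mul_nonneg (inv_nonneg.2 (pow_nonneg hr.le _)) (ContDiffBump.nonneg_normed _ _)

theorem integral_kern (hr : 0 < r) : ∫ t, kern r t = 1 := by
  simp only [kern]
  rw [integral_const_mul, Measure.integral_comp_inv_smul, abs_of_pos (by positivity),
    bump, ContDiffBump.integral_normed]
  simp [hr.ne']

theorem D_kern (a : Fin 4) (t : Spacetime) :
    D a (kern r) t = (r ^ dim)⁻¹ * (r⁻¹ * D a bump (r⁻¹ • t)) := by
  have h := ((smooth_bump.of_nat 1).differentiable (by norm_num) (r⁻¹ • t)).hasFDerivAt.comp t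
    ((hasFDerivAt_id t).const_smul r⁻¹)
  have h' := h.const_mul (r ^ dim)⁻¹
  have e : fderiv ℝ (kern r) t = _ := h'.fderiv
  rw [D, e]
  simp [D]

theorem volume_ball_eq (hr : 0 < r) : volume.real (Metric.ball (0 : Spacetime) r)
    = r ^ dim * volume.real (Metric.ball (0 : Spacetime) 1) := by
  rw [Measure.real, Measure.addHaar_ball _ _ hr.le, ENNReal.toReal_mul,
    ENNReal.toReal_ofReal (by positivity)]
  rfl

theorem exists_bound {f : Spacetime → ℝ} (hf : Continuous f) (hc : HasCompactSupport f) :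
    ∃ M ≥ 0, ∀ z, |f z| ≤ M := by
  obtain ⟨M, hM⟩ := hf.bounded_above_of_compact_support hc
  exact ⟨M, (norm_nonneg _).trans (hM 0), hM⟩

theorem exists_kern_le : ∃ κ, ∀ r > 0, ∀ t,
    |kern r t| ≤ κ / volume.real (Metric.ball (0 : Spacetime) r) := by
  obtain ⟨M, hM, h⟩ := exists_bound smooth_bump.continuous hasCompactSupport_bump
  refine ⟨M * volume.real (Metric.ball (0 : Spacetime) 1), fun r hr t => ?_⟩
  have hv : 0 < volume.real (Metric.ball (0 : Spacetime) 1) :=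
    ENNReal.toReal_pos (Metric.measure_ball_pos _ _ one_pos).ne' measure_ball_lt_top.ne
  rw [volume_ball_eq hr, mul_div_mul_right _ _ hv.ne', kern, abs_mul, div_eq_inv_mul,
    abs_of_pos (by positivity)]
  gcongr
  exact h _

theorem exists_D_kern_le (a : Fin 4) : ∃ κ, ∀ r > 0, ∀ t,
    |D a (kern r) t| * r ≤ κ / volume.real (Metric.ball (0 : Spacetime) r) := by
  obtain ⟨M, hM, h⟩ := exists_bound (smooth_bump.D a).continuous
    (hasCompactSupport_bump.mono' ((subset_tsupport _).trans tsupport_D_subset))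
  refine ⟨M * volume.real (Metric.ball (0 : Spacetime) 1), fun r hr t => ?_⟩
  have hv : 0 < volume.real (Metric.ball (0 : Spacetime) 1) :=
    ENNReal.toReal_pos (Metric.measure_ball_pos _ _ one_pos).ne' measure_ball_lt_top.ne
  rw [volume_ball_eq hr, mul_div_mul_right _ _ hv.ne', D_kern, abs_mul, abs_mul,
    abs_of_pos (show 0 < r⁻¹ by positivity),
    div_eq_inv_mul, abs_of_pos (show 0 < (r ^ dim)⁻¹ by positivity)]
  calc _ = (r ^ dim)⁻¹ * |D a bump (r⁻¹ • t)| := by field_simp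
    _ ≤ _ := by gcongr; exact h _

theorem hasCompactSupport_D_kern (hr : 0 < r) (a : Fin 4) : HasCompactSupport (D a (kern r)) :=
  (hasCompactSupport_kern hr).mono' ((subset_tsupport _).trans tsupport_D_subset)

theorem D_kern_eq_zero (hr : 0 < r) (a : Fin 4) {t : Spacetime}
    (ht : t ∉ Metric.ball (0 : Spacetime) r) : D a (kern r) t = 0 := by
  have : r⁻¹ • t ∉ Metric.ball (0 : Spacetime) 1 := fun h => ht (by
    rw [mem_ball_zero_iff, norm_smul, norm_inv, Real.norm_of_nonneg hr.le,
      inv_mul_lt_one₀ hr] at h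
    simpa using h)
  -- outside the open ball, its boundary included, the bump attains its minimum `0`
  have hmin : IsLocalMin bump (r⁻¹ • t) := Filter.Eventually.of_forall fun y => by
    have : bump (r⁻¹ • t) = 0 := by
      rw [← support_bump] at this; simpa using this
    rw [this]; exact ContDiffBump.nonneg_normed _ _
  rw [D_kern, D, hmin.fderiv_eq_zero]
  simp

end kern

/-! ### Convergence of mollifications and Friedrichs' lemma -/

open Filter Topology

/-- The mollification of `g` at scale `r`. -/
def moll (r : ℝ) (g : Spacetime → ℝ) : Spacetime → ℝ := conv (kern r) g

/-- `G r → g` in `L²`, as `r → 0+`. -/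
def TendstoL2 (G : ℝ → Spacetime → ℝ) (g : Spacetime → ℝ) : Prop :=
  Tendsto (fun r => eLpNorm (fun z => G r z - g z) 2 volume) (𝓝[>] 0) (𝓝 0)

section TendstoL2

variable {G H : ℝ → Spacetime → ℝ} {g h : Spacetime → ℝ}

theorem TendstoL2.congr (hG : TendstoL2 G g) (e : ∀ r > 0, G r = H r) : TendstoL2 H g :=
  Tendsto.congr' (eventually_mem_nhdsWithin.mono fun r hr => by simp only [e r hr]) hG

theorem TendstoL2.congr_ae (hG : TendstoL2 G g) (e : g =ᵐ[volume] h) : TendstoL2 G h := by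
  refine Tendsto.congr (fun r => eLpNorm_congr_ae ?_) hG
  filter_upwards [e] with z hz
  rw [hz]

theorem TendstoL2.add (hG : TendstoL2 G g) (hH : TendstoL2 H h)
    (mG : ∀ r > 0, AEStronglyMeasurable (G r) volume)
    (mH : ∀ r > 0, AEStronglyMeasurable (H r) volume)
    (mg : AEStronglyMeasurable g volume) (mh : AEStronglyMeasurable h volume) :
    TendstoL2 (fun r z => G r z + H r z) (fun z => g z + h z) := by
  have h0 := Tendsto.add hG hH
  rw [add_zero] at h0
  refine tendsto_of_tendsto_of_tendsto_of_le_of_le' tendsto_const_nhds h0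
    (Eventually.of_forall fun _ => zero_le) (eventually_mem_nhdsWithin.mono fun r hr => ?_)
  have := eLpNorm_add_le ((mG r hr).sub mg) ((mH r hr).sub mh) (p := 2) (by norm_num)
  refine le_trans (le_of_eq ?_) this
  congr 1; ext z; simp only [Pi.add_apply, Pi.sub_apply]; ring

theorem TendstoL2.bdd_mul {a : Spacetime → ℝ} {M : ℝ} (ha : ∀ z, |a z| ≤ M)
    (hG : TendstoL2 G g) : TendstoL2 (fun r z => a z * G r z) fun z => a z * g z := by
  have h0 := ENNReal.Tendsto.const_mul hG (a := ENNReal.ofReal M) (Or.inr ENNReal.ofReal_ne_top)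
  rw [mul_zero] at h0
  refine tendsto_of_tendsto_of_tendsto_of_le_of_le tendsto_const_nhds h0
    (fun _ => zero_le) (fun r => ?_)
  refine eLpNorm_le_mul_eLpNorm_of_ae_le_mul (Eventually.of_forall fun z => ?_) 2
  rw [← mul_sub, norm_mul]
  gcongr
  exact ha z

/-- Uniform convergence times a function of `L²`. -/
theorem TendstoL2.mul_of_uniform (hg : MemLp g 2 volume) {A : ℝ → Spacetime → ℝ}
    {a : Spacetime → ℝ} (hA : ∀ ε > 0, ∀ᶠ r in 𝓝[>] (0 : ℝ), ∀ z, |A r z - a z| ≤ ε) :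
    TendstoL2 (fun r z => g z * A r z) fun z => g z * a z := by
  have hb : ∀ ε > 0, ∀ᶠ r in 𝓝[>] (0 : ℝ), eLpNorm (fun z => g z * A r z - g z * a z) 2 volume
      ≤ ENNReal.ofReal ε * eLpNorm g 2 volume := fun ε hε => by
    filter_upwards [hA ε hε] with r hr
    refine eLpNorm_le_mul_eLpNorm_of_ae_le_mul (Eventually.of_forall fun z => ?_) 2
    rw [← mul_sub, norm_mul, mul_comm]
    gcongr
    exact hr z
  refine ENNReal.tendsto_nhds_zero.2 fun δ hδ => ?_
  have hlim : Tendsto (fun ε : ℝ => ENNReal.ofReal ε * eLpNorm g 2 volume) (𝓝[>] 0) (𝓝 0) := by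
    have h1 : Tendsto (fun ε : ℝ => ENNReal.ofReal ε) (𝓝[>] 0) (𝓝 0) := by
      have := (ENNReal.continuous_ofReal.tendsto 0).mono_left (nhdsWithin_le_nhds (s := Ioi 0))
      simpa using this
    simpa using ENNReal.Tendsto.mul_const h1 (Or.inr hg.2.ne)
  obtain ⟨ε, h1, h2⟩ := ((ENNReal.tendsto_nhds_zero.1 hlim δ hδ).and
    eventually_mem_nhdsWithin).exists
  exact (hb ε h2).mono fun r hr => hr.trans h1

end TendstoL2

/-- Kernels of the size of the reciprocal volume of a shrinking ball, acting on translation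
differences of a function of `L²`, tend to zero. -/
theorem tendsto_kernel {g : Spacetime → ℝ} (hg : MemLp g 2 volume) {κ : ℝ}
    {k : ℝ → Spacetime → Spacetime → ℝ}
    (hk : ∀ r > 0, ∀ z t, |k r z t| ≤ κ / volume.real (Metric.ball (0 : Spacetime) r))
    (hk0 : ∀ r > 0, ∀ z, ∀ t ∉ Metric.ball (0 : Spacetime) r, k r z t = 0) :
    TendstoL2 (fun r z => ∫ t, k r z t * (g (z - t) - g z)) fun _ => 0 := by
  simp only [TendstoL2, sub_zero]
  refine ENNReal.tendsto_nhds_zero.2 fun δ hδ => ?_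
  have hlim := ENNReal.Tendsto.const_mul (tendsto_eLpNorm_translate hg)
    (a := ENNReal.ofReal κ) (Or.inr ENNReal.ofReal_ne_top)
  rw [mul_zero] at hlim
  obtain ⟨ε, hε, hε'⟩ : ∃ ε > 0, ENNReal.ofReal κ * ε ≤ δ := by
    rcases eq_or_ne (ENNReal.ofReal κ) 0 with h | h
    · exact ⟨1, one_pos, by simp [h]⟩
    · exact ⟨δ / ENNReal.ofReal κ, ENNReal.div_pos hδ.ne' ENNReal.ofReal_ne_top,
        ENNReal.mul_div_le⟩
  obtain ⟨s, hs, hs'⟩ := Metric.eventually_nhds_iff_ball.1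
    (ENNReal.tendsto_nhds_zero.1 (tendsto_eLpNorm_translate hg) ε hε)
  filter_upwards [Ioo_mem_nhdsGT hs] with r hr
  exact (eLpNorm_kernel_le hg.1 hr.1 (hk r hr.1) (hk0 r hr.1) fun t ht =>
    hs' t (Metric.ball_subset_ball hr.2.le ht)).trans hε'

section moll

variable {g : Spacetime → ℝ} {r : ℝ}

theorem smooth_moll (hr : 0 < r) (hg : LocallyIntegrable g volume) : Smooth (moll r g) :=
  smooth_conv smooth_kern (hasCompactSupport_kern hr) hg

theorem D_moll (hr : 0 < r) {f : Spacetime → ℝ} (hf : LocallyIntegrable f volume) {a : Fin 4}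
    (h : IsWeakPartial univ a f g) : D a (moll r f) = moll r g := by
  rw [moll, D_conv smooth_kern (hasCompactSupport_kern hr) hf,
    conv_D_of_weak h smooth_kern (hasCompactSupport_kern hr), moll]

theorem moll_sub (hr : 0 < r) (hg : LocallyIntegrable g volume) (z : Spacetime) :
    moll r g z - g z = ∫ t, kern r t * (g (z - t) - g z) := by
  have h1 := integrable_conv smooth_kern.continuous (hasCompactSupport_kern hr) hg z
  have h2 : Integrable fun t => kern r t * g z :=
    (smooth_kern.continuous.integrable_of_hasCompactSupport (hasCompactSupport_kern hr)).mul_const _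
  simp only [mul_sub]
  rw [integral_sub h1 h2, integral_mul_const, integral_kern hr, one_mul]
  rfl

theorem tendsto_moll (hg : MemLp g 2 volume) : TendstoL2 (fun r => moll r g) g := by
  obtain ⟨κ, hκ⟩ := exists_kern_le
  have h := tendsto_kernel hg (k := fun r _ t => kern r t) (fun r hr _ => hκ r hr)
    (fun r hr _ t ht => by
      by_contra h
      exact ht (support_kern hr h))
  refine Tendsto.congr' (eventually_mem_nhdsWithin.mono fun r hr => ?_) h
  simp only [sub_zero, moll_sub hr (hg.locallyIntegrable (by norm_num))]

theorem moll_uniform {a : Spacetime → ℝ} (ha : UniformContinuous a) :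
    ∀ ε > 0, ∀ᶠ r in 𝓝[>] (0 : ℝ), ∀ z, |moll r a z - a z| ≤ ε := by
  intro ε hε
  obtain ⟨δ, hδ, h⟩ := Metric.uniformContinuous_iff.1 ha ε hε
  filter_upwards [Ioo_mem_nhdsGT hδ] with r hr z
  refine dist_convolution_le hε.le (support_kern hr.1) (kern_nonneg hr.1) (integral_kern hr.1)
    ha.continuous.aestronglyMeasurable fun x hx => (h ?_).le
  exact (Metric.mem_ball.1 hx).trans hr.2

theorem memLp_mul {a : Spacetime → ℝ} (ha : Continuous a) {M : ℝ} (hM : ∀ z, |a z| ≤ M)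
    (hg : MemLp g 2 volume) : MemLp (fun z => a z * g z) 2 volume :=
  hg.of_le_mul (c := M) (ha.aestronglyMeasurable.mul hg.1) (Eventually.of_forall fun z => by
    rw [norm_mul]
    gcongr
    exact hM z)

/-- Friedrichs' lemma: the commutator of a mollification and a first-order operator with a
coefficient of class `C¹` tends to zero in `L²`. -/
theorem friedrichs {a : Spacetime → ℝ} (ha : ContDiff ℝ 1 a) {Ma : ℝ} (hMab : ∀ z, |a z| ≤ Ma)
    {L : NNReal} (hL : LipschitzWith L a) {j : Fin 4} {M : ℝ} (hMb : ∀ z, |D j a z| ≤ M)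
    (hDu : UniformContinuous (D j a)) (hg : MemLp g 2 volume) :
    TendstoL2 (fun r z => D j (fun z => a z * moll r g z) z - D j (moll r fun z => a z * g z) z)
      fun _ => 0 := by
  have hgl : LocallyIntegrable g volume := hg.locallyIntegrable (by norm_num)
  have hDa : Continuous (D j a) := continuous_D ha j
  have hag : LocallyIntegrable (fun z => a z * g z) volume :=
    (memLp_mul ha.continuous hMab hg).locallyIntegrable (by norm_num)
  obtain ⟨κ, hκ⟩ := exists_D_kern_le j
  let k : ℝ → Spacetime → Spacetime → ℝ := fun r z t => D j (kern r) t * (a z - a (z - t))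
  have T1 := tendsto_kernel hg (k := k) (κ := κ * L) (fun r hr z t => by
      by_cases ht : t ∈ Metric.ball (0 : Spacetime) r
      · have h1 : |a z - a (z - t)| ≤ L * r := by
          have := hL.dist_le_mul z (z - t)
          rw [Real.dist_eq, dist_eq_norm, sub_sub_cancel] at this
          rw [mem_ball_zero_iff] at ht
          exact this.trans (by gcongr)
        calc |k r z t| = |D j (kern r) t| * |a z - a (z - t)| := abs_mul _ _
          _ ≤ |D j (kern r) t| * (L * r) := by gcongr
          _ = |D j (kern r) t| * r * L := by ring
          _ ≤ _ := by
            rw [mul_div_right_comm]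
            gcongr
            exact hκ r hr t
      · simp only [k, D_kern_eq_zero hr j ht, zero_mul, abs_zero]
        have := hκ r hr 0
        have h2 : 0 ≤ κ / volume.real (Metric.ball (0 : Spacetime) r) :=
          le_trans (by positivity) this
        rw [mul_div_right_comm]
        positivity)
    (fun r hr z t ht => by simp only [k, D_kern_eq_zero hr j ht, zero_mul])
  have T2 : TendstoL2 (fun r z => D j a z * moll r g z) fun z => D j a z * g z :=
    (tendsto_moll hg).bdd_mul hMb
  have T3 : TendstoL2 (fun r z => (-g z) * moll r (D j a) z) fun z => (-g z) * D j a z :=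
    TendstoL2.mul_of_uniform hg.neg (moll_uniform hDu)
  have hDal : LocallyIntegrable (D j a) volume := hDa.locallyIntegrable
  -- the commutator is an integral against `D j (kern r)`, which has integral zero; subtracting
  -- `g z` from `g (z - t)` leaves two terms which converge to `± (D j a) g`
  have key : ∀ r > 0, ∀ z, D j (fun z => a z * moll r g z) z - D j (moll r fun z => a z * g z) z
      = (D j a z * moll r g z + (-g z) * moll r (D j a) z)
        + ∫ t, k r z t * (g (z - t) - g z) := fun r hr z => by
    have cs := hasCompactSupport_D_kern hr j
    have cc : Continuous (D j (kern r)) := (smooth_kern.D j).continuous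
    rw [((hasD (ha.differentiable (by norm_num) z)).mul ((smooth_moll hr hgl).hasD j z)).2,
      moll, moll, D_conv smooth_kern (hasCompactSupport_kern hr) hgl,
      D_conv smooth_kern (hasCompactSupport_kern hr) hag, moll,
      ← conv_D_of_weak (isWeakPartial_of_contDiff ha j) smooth_kern (hasCompactSupport_kern hr)]
    have i1 := integrable_conv cc cs hgl z
    have i2 := integrable_conv cc cs hag z
    have i3 := integrable_conv cc cs ha.continuous.locallyIntegrable z
    have i4 : ∫ t, D j (kern r) t = 0 :=
      integral_D_eq_zero (smooth_kern.of_nat 1) (hasCompactSupport_kern hr)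
    have i5 : Integrable (D j (kern r)) := cc.integrable_of_hasCompactSupport cs
    have e : ∀ t, k r z t * (g (z - t) - g z) = a z * (D j (kern r) t * g (z - t))
        - D j (kern r) t * (a (z - t) * g (z - t)) - a z * g z * D j (kern r) t
        + g z * (D j (kern r) t * a (z - t)) := fun t => by simp only [k]; ring
    have j1 : Integrable fun t => a z * (D j (kern r) t * g (z - t)) := i1.const_mul _
    have j5 : Integrable fun t => a z * g z * D j (kern r) t := i5.const_mul _
    have j3 : Integrable fun t => g z * (D j (kern r) t * a (z - t)) := i3.const_mul _
    simp only [e]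
    rw [integral_add (by exact (j1.sub i2).sub j5) j3, integral_sub (by exact j1.sub i2) j5,
      integral_sub j1 i2]
    simp only [integral_const_mul, i4, conv]
    ring
  have mm : ∀ r > 0, ∀ f : Spacetime → ℝ, LocallyIntegrable f volume →
      AEStronglyMeasurable (moll r f) volume := fun r hr f hf =>
    (smooth_moll hr hf).continuous.aestronglyMeasurable
  have m2 : ∀ r > 0, AEStronglyMeasurable (fun z => D j a z * moll r g z) volume := fun r hr =>
    hDa.aestronglyMeasurable.mul (mm r hr g hgl)
  have m3 : ∀ r > 0, AEStronglyMeasurable (fun z => (-g z) * moll r (D j a) z) volume :=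
    fun r hr => hg.1.neg.mul (mm r hr _ hDal)
  have T4 := T2.add T3 m2 m3 (hDa.aestronglyMeasurable.mul hg.1)
    (hg.1.neg.mul hDa.aestronglyMeasurable)
  have T5 := T4.add T1 (fun r hr => (m2 r hr).add (m3 r hr)) (fun r hr => by
      have e : (fun z => ∫ t, k r z t * (g (z - t) - g z)) = fun z =>
          (D j (fun z => a z * moll r g z) z - D j (moll r fun z => a z * g z) z)
          - (D j a z * moll r g z + (-g z) * moll r (D j a) z) := by
        ext z; rw [key r hr z]; ring
      rw [e]
      refine AEStronglyMeasurable.sub ?_ ((m2 r hr).add (m3 r hr))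
      exact ((continuous_D (ha.mul ((smooth_moll hr hgl).of_nat 1)) j).sub
        ((smooth_moll hr hag).D j).continuous).aestronglyMeasurable)
    ((hDa.aestronglyMeasurable.mul hg.1).add (hg.1.neg.mul hDa.aestronglyMeasurable))
    aestronglyMeasurable_const
  refine (T5.congr fun r hr => funext fun z => (key r hr z).symm).congr_ae
    (Eventually.of_forall fun z => ?_)
  simp only; ring

end moll

/-! ### Mollified right-hand sides -/

/-- The functions `G r` are of class `C¹`, converge to `g` in `L²`, and their spatial gradients
differ from those of the mollifications of `g` by functions which tend to zero in `L²`. -/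
structure Approx (G : ℝ → Spacetime → ℝ) (g : Spacetime → ℝ) : Prop where
  memLp : MemLp g 2 volume
  C1 : ∀ r > 0, ContDiff ℝ 1 (G r)
  lim : TendstoL2 G g
  comm : ∀ k : Fin 3, TendstoL2 (fun r z => D (sp k) (G r) z - D (sp k) (moll r g) z) fun _ => 0

theorem locallyIntegrable_of_memLp {g : Spacetime → ℝ} (hg : MemLp g 2 volume) :
    LocallyIntegrable g volume :=
  hg.locallyIntegrable (by norm_num)

theorem moll_add {r : ℝ} (hr : 0 < r) {g h : Spacetime → ℝ} (hg : LocallyIntegrable g volume)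
    (hh : LocallyIntegrable h volume) :
    moll r (fun z => g z + h z) = fun z => moll r g z + moll r h z := by
  ext z
  have h1 := integrable_conv smooth_kern.continuous (hasCompactSupport_kern hr) hg z
  have h2 := integrable_conv smooth_kern.continuous (hasCompactSupport_kern hr) hh z
  simp only [moll, conv, mul_add]
  exact integral_add h1 h2

theorem moll_const_mul (r c : ℝ) (g : Spacetime → ℝ) :
    moll r (fun z => c * g z) = fun z => c * moll r g z := by
  ext z
  simp only [moll, conv]
  rw [← integral_const_mul]
  congr 1; ext t; ring

namespace Approx

variable {G H : ℝ → Spacetime → ℝ} {g h : Spacetime → ℝ}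

theorem congr (hG : Approx G g) (e : ∀ r > 0, G r = H r) : Approx H g where
  memLp := hG.memLp
  C1 r hr := e r hr ▸ hG.C1 r hr
  lim := hG.lim.congr e
  comm k := (hG.comm k).congr fun r hr => by rw [e r hr]

theorem moll (hg : MemLp g 2 volume) : Approx (fun r => moll r g) g where
  memLp := hg
  C1 r hr := (smooth_moll hr (locallyIntegrable_of_memLp hg)).of_nat 1
  lim := tendsto_moll hg
  comm k := by simp [TendstoL2]

theorem add (hG : Approx G g) (hH : Approx H h) :
    Approx (fun r z => G r z + H r z) fun z => g z + h z where
  memLp := hG.memLp.add hH.memLp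
  C1 r hr := (hG.C1 r hr).add (hH.C1 r hr)
  lim := hG.lim.add hH.lim (fun r hr => (hG.C1 r hr).continuous.aestronglyMeasurable)
    (fun r hr => (hH.C1 r hr).continuous.aestronglyMeasurable) hG.memLp.1 hH.memLp.1
  comm k := by
    have m : ∀ {G : ℝ → Spacetime → ℝ} {g : Spacetime → ℝ}, Approx G g → ∀ r > 0,
        AEStronglyMeasurable
          (fun z => D (sp k) (G r) z - D (sp k) (Biot.moll r g) z) volume := fun hG r hr =>
      ((continuous_D (hG.C1 r hr) _).sub
        ((smooth_moll hr
          (locallyIntegrable_of_memLp hG.memLp)).D _).continuous).aestronglyMeasurable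
    have := (hG.comm k).add (hH.comm k) (m hG) (m hH)
      aestronglyMeasurable_const aestronglyMeasurable_const
    simp only [add_zero] at this
    refine this.congr fun r hr => ?_
    ext z
    have lg := smooth_moll hr (locallyIntegrable_of_memLp hG.memLp)
    have lh := smooth_moll hr (locallyIntegrable_of_memLp hH.memLp)
    rw [moll_add hr (locallyIntegrable_of_memLp hG.memLp) (locallyIntegrable_of_memLp hH.memLp),
      ((lg.hasD _ z).add (lh.hasD _ z)).2,
      ((hasD ((hG.C1 r hr).differentiable (by norm_num) z)).add
        (hasD ((hH.C1 r hr).differentiable (by norm_num) z))).2]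
    ring

theorem const_mul (c : ℝ) (hG : Approx G g) : Approx (fun r z => c * G r z) fun z => c * g z where
  memLp := hG.memLp.const_mul c
  C1 r hr := contDiff_const.mul (hG.C1 r hr)
  lim := hG.lim.bdd_mul (a := fun _ => c) (fun _ => le_rfl)
  comm k := by
    have := (hG.comm k).bdd_mul (a := fun _ => c) (fun _ => le_rfl)
    simp only [mul_zero] at this
    refine this.congr fun r hr => ?_
    ext z
    rw [moll_const_mul,
      (((smooth_moll hr (locallyIntegrable_of_memLp hG.memLp)).hasD _ z).const_mul c).2,
      ((hasD ((hG.C1 r hr).differentiable (by norm_num) z)).const_mul c).2]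
    ring

theorem sub (hG : Approx G g) (hH : Approx H h) :
    Approx (fun r z => G r z - H r z) fun z => g z - h z := by
  have := hG.add (hH.const_mul (-1))
  simpa only [neg_one_mul, ← sub_eq_add_neg] using this

theorem sum {ι : Type*} {s : Finset ι} {G : ι → ℝ → Spacetime → ℝ} {g : ι → Spacetime → ℝ}
    (h : ∀ i, Approx (G i) (g i)) :
    Approx (fun r z => ∑ i ∈ s, G i r z) fun z => ∑ i ∈ s, g i z := by
  classical
  induction s using Finset.induction_on with
  | empty =>
    have := Approx.moll (g := fun _ => 0) MemLp.zero
    refine this.congr fun r _ => ?_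
    ext z; simp [Biot.moll, conv]
  | insert i s hi ih =>
    simp only [Finset.sum_insert hi]
    exact (h i).add ih

/-- Multiplication by a coefficient `c = c(x)`; here Friedrichs' lemma enters. -/
theorem coef {c : Space → ℝ} (hc : ContDiff ℝ 1 c) (hcs : HasCompactSupport c)
    (hg : MemLp g 2 volume) : Approx (fun r z => c z.1 * Biot.moll r g z) fun z => c z.1 * g z := by
  have hC1 : ContDiff ℝ 1 fun z : Spacetime => c z.1 := hc.comp contDiff_fst
  obtain ⟨M, hM⟩ := hc.continuous.bounded_above_of_compact_support hcs
  obtain ⟨L, hL⟩ := hc.lipschitzWith_of_hasCompactSupport hcs (by norm_num)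
  have hL' : LipschitzWith L fun z : Spacetime => c z.1 := by
    simpa [Function.comp_def] using hL.comp LipschitzWith.prod_fst
  have hMg := memLp_mul hC1.continuous (fun z : Spacetime => hM z.1) hg
  refine ⟨hMg, fun r hr => hC1.mul ((smooth_moll hr (locallyIntegrable_of_memLp hg)).of_nat 1),
    (tendsto_moll hg).bdd_mul (a := fun z : Spacetime => c z.1) (fun z => hM z.1), fun k => ?_⟩
  have hcp : HasCompactSupport (pd c k) := hcs.fderiv_apply ℝ (v := EuclideanSpace.single k 1)
  have hp : Continuous (pd c k) := (hc.continuous_fderiv (by norm_num)).clm_apply continuous_const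
  obtain ⟨M', hM'⟩ := hp.bounded_above_of_compact_support hcp
  have e : D (sp k) (fun z : Spacetime => c z.1) = fun z => pd c k z.1 := by
    ext z; exact (hasD_sp (hc.differentiable (by norm_num) z.1) k).2
  refine friedrichs hC1 (fun z : Spacetime => hM z.1) hL' (M := M') ?_ ?_ hg
  · rw [e]; exact fun z => hM' z.1
  · rw [e]
    exact (hcp.uniformContinuous_of_continuous hp).comp uniformContinuous_fst

/-- The spatial gradients converge in `L²` as well, if the limit has a gradient in `L²`. -/
theorem tendsto_D (hG : Approx G g) {d : Spacetime → ℝ} {k : Fin 3}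
    (hd : MemLp d 2 volume) (hw : IsWeakPartial univ (sp k) g d) :
    TendstoL2 (fun r => D (sp k) (G r)) d := by
  have hl := locallyIntegrable_of_memLp hG.memLp
  have := (hG.comm k).add (tendsto_moll hd) (fun r hr =>
      ((continuous_D (hG.C1 r hr) _).sub
        ((smooth_moll hr hl).D _).continuous).aestronglyMeasurable)
    (fun r hr => (smooth_moll hr (locallyIntegrable_of_memLp hd)).continuous.aestronglyMeasurable)
    aestronglyMeasurable_const hd.1
  simp only [zero_add] at this
  refine this.congr fun r hr => ?_
  ext z
  rw [D_moll hr hl hw]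
  ring

end Approx

/-- The left-hand sides of Biot's system, as functions of the values `d s j a = ∂_a u^s_j` and
`dd s j a b = ∂_b ∂_a u^s_j`. -/
def Coeffs.form (P : Coeffs) (x : Space) (d : Fin 2 → Fin 3 → Fin 4 → ℝ)
    (dd : Fin 2 → Fin 3 → Fin 4 → Fin 4 → ℝ) (r : Fin 2) (i : Fin 3) : ℝ :=
  ![P.rho11 x * dd 0 i tm tm + P.rho12 x * dd 1 i tm tm
      - (P.mu x * ∑ j, dd 0 i (sp j) (sp j) + (P.mu x + P.lam x) * ∑ j, dd 0 j (sp j) (sp i)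
        + pd P.lam i x * ∑ j, d 0 j (sp j)
        + ∑ j, pd P.mu j x * (d 0 i (sp j) + d 0 j (sp i)))
      - (P.q x * ∑ j, dd 1 j (sp j) (sp i) + pd P.q i x * ∑ j, d 1 j (sp j)),
    P.rho12 x * dd 0 i tm tm + P.rho22 x * dd 1 i tm tm
      - (P.q x * ∑ j, dd 0 j (sp j) (sp i) + pd P.q i x * ∑ j, d 0 j (sp j))
      - (P.r x * ∑ j, dd 1 j (sp j) (sp i) + pd P.r i x * ∑ j, d 1 j (sp j))] r

theorem Coeffs.src_eq_form (P : Coeffs) {K : Set Spacetime} (u : SmoothPair K) (r : Fin 2)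
    (i : Fin 3) (z : Spacetime) :
    P.src u r i z = P.form z.1 (fun s j a => D a (u.u s j) z)
      (fun s j a b => D b (D a (u.u s j)) z) r i := by
  fin_cases r <;> simp [Coeffs.src, Coeffs.form, lap, u.D_V, SmoothPair.V, mul_comm]

/-- All coefficients have compact support. -/
structure Coeffs.CompactlySupported (P : Coeffs) : Prop where
  rho11 : HasCompactSupport P.rho11
  rho12 : HasCompactSupport P.rho12
  rho22 : HasCompactSupport P.rho22
  mu : HasCompactSupport P.mu
  lam : HasCompactSupport P.lam
  q : HasCompactSupport P.q
  r : HasCompactSupport P.r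

/-- Biot's operator applied to mollified derivatives approximates its value on the derivatives, in
the sense of `Approx`. -/
theorem Coeffs.approx_form {P : Coeffs} (hP : P.IsC2) (hPc : P.CompactlySupported)
    {d : Fin 2 → Fin 3 → Fin 4 → Spacetime → ℝ} (hd : ∀ s j a, MemLp (d s j a) 2 volume)
    {dd : Fin 2 → Fin 3 → Fin 4 → Fin 4 → Spacetime → ℝ}
    (hdd : ∀ s j a b, MemLp (dd s j a b) 2 volume) (r : Fin 2) (i : Fin 3) :
    Approx (fun ε z => P.form z.1 (fun s j a => moll ε (d s j a) z)
        (fun s j a b => moll ε (dd s j a b) z) r i)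
      fun z => P.form z.1 (fun s j a => d s j a z) (fun s j a b => dd s j a b z) r i := by
  have c0 : ∀ {c : Space → ℝ} {g : Spacetime → ℝ}, ContDiff ℝ 2 c → HasCompactSupport c →
      MemLp g 2 volume →
      Approx (fun r z => c z.1 * moll r g z) fun z => c z.1 * g z := fun h hc hg =>
    Approx.coef (h.of_le (by norm_num)) hc hg
  have c1 : ∀ {c : Space → ℝ} {g : Spacetime → ℝ} (i : Fin 3), ContDiff ℝ 2 c →
      HasCompactSupport c → MemLp g 2 volume →
      Approx (fun r z => pd c i z.1 * moll r g z) fun z => pd c i z.1 * g z := fun i h hc hg =>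
    Approx.coef ((h.fderiv_right (by norm_num)).clm_apply contDiff_const)
      (hc.fderiv_apply ℝ (v := EuclideanSpace.single i 1)) hg
  have s0 : ∀ {c : Space → ℝ} {g : Fin 3 → Spacetime → ℝ}, ContDiff ℝ 2 c → HasCompactSupport c →
      (∀ j, MemLp (g j) 2 volume) →
      Approx (fun r z => c z.1 * ∑ j, moll r (g j) z) fun z => c z.1 * ∑ j, g j z :=
    fun h hc hg => by
      simp only [Finset.mul_sum]
      exact Approx.sum fun j => c0 h hc (hg j)
  have s1 : ∀ {c : Space → ℝ} {g : Fin 3 → Spacetime → ℝ} (i : Fin 3), ContDiff ℝ 2 c →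
      HasCompactSupport c → (∀ j, MemLp (g j) 2 volume) →
      Approx (fun r z => pd c i z.1 * ∑ j, moll r (g j) z) fun z => pd c i z.1 * ∑ j, g j z :=
    fun i h hc hg => by
      simp only [Finset.mul_sum]
      exact Approx.sum fun j => c1 i h hc (hg j)
  have hml : HasCompactSupport fun x => P.mu x + P.lam x := hPc.mu.add hPc.lam
  fin_cases r
  · refine (((c0 hP.rho11 hPc.rho11 (hdd 0 i tm tm)).add
      (c0 hP.rho12 hPc.rho12 (hdd 1 i tm tm))).sub
      ((((s0 hP.mu hPc.mu fun j => hdd 0 i (sp j) (sp j)).add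
        (s0 (hP.mu.add hP.lam) hml fun j => hdd 0 j (sp j) (sp i))).add
        (s1 i hP.lam hPc.lam fun j => hd 0 j (sp j))).add
        (Approx.sum (s := Finset.univ) (G := fun j r z => pd P.mu j z.1 *
          (moll r (d 0 i (sp j)) z + moll r (d 0 j (sp i)) z))
          (g := fun j z => pd P.mu j z.1 * (d 0 i (sp j) z + d 0 j (sp i) z)) fun j => ?_))).sub
      ((s0 hP.q hPc.q fun j => hdd 1 j (sp j) (sp i)).add
        (s1 i hP.q hPc.q fun j => hd 1 j (sp j)))
    simp only [mul_add]
    exact (c1 j hP.mu hPc.mu (hd 0 i (sp j))).add (c1 j hP.mu hPc.mu (hd 0 j (sp i)))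
  · exact (((c0 hP.rho12 hPc.rho12 (hdd 0 i tm tm)).add
      (c0 hP.rho22 hPc.rho22 (hdd 1 i tm tm))).sub
      ((s0 hP.q hPc.q fun j => hdd 0 j (sp j) (sp i)).add
        (s1 i hP.q hPc.q fun j => hd 0 j (sp j)))).sub
      ((s0 hP.r hPc.r fun j => hdd 1 j (sp j) (sp i)).add
        (s1 i hP.r hPc.r fun j => hd 1 j (sp j)))

/-! ### Extension by zero -/

section ZeroExtension

variable {Q K : Set Spacetime} {a : Fin 4} {f g : Spacetime → ℝ}

/-- A weak derivative vanishes where the function does. -/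
theorem weak_eq_zero (hQ : IsOpen Q) (hK : IsClosed K) (h : IsWeakPartial Q a f g)
    (hg : MemLp g 2 (volume.restrict Q))
    (hf : ∀ᵐ z ∂(volume.restrict Q), z ∉ K → f z = 0) :
    ∀ᵐ z ∂(volume.restrict Q), z ∉ K → g z = 0 := by
  have ho : IsOpen (Q \ K) := hQ.sdiff hK
  have hl : LocallyIntegrableOn g (Q \ K) volume := by
    have h1 : LocallyIntegrable g (volume.restrict Q) := hg.locallyIntegrable (by norm_num)
    exact (locallyIntegrableOn_of_locallyIntegrable_restrict h1).mono_set sdiff_subset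
  have := ho.ae_eq_zero_of_integral_contDiff_smul_eq_zero hl fun η hη hc hs => by
    have hD : ∀ z, z ∉ Q \ K → η z = 0 := fun z hz => by
      by_contra h
      exact hz (hs (subset_tsupport _ h))
    have e := h η hη hc (hs.trans sdiff_subset)
    have e1 : ∫ z in Q, f z * fderiv ℝ η z (dir a) = 0 := by
      rw [← integral_zero Spacetime ℝ (μ := volume.restrict Q)]
      refine integral_congr_ae ?_
      filter_upwards [hf] with z hz
      by_cases hzK : z ∈ K
      · have : D a η z = 0 := D_eq_zero_of_notMem fun h => (hs h).2 hzK
        rw [D] at this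
        rw [this, mul_zero]
      · rw [hz hzK, zero_mul]
    rw [e1, eq_comm, neg_eq_zero] at e
    rw [← setIntegral_eq_integral_of_forall_compl_eq_zero (s := Q), ← e]
    · simp only [smul_eq_mul, mul_comm]
    · intro z hz
      rw [hD z fun h => hz h.1, zero_smul]
  rw [ae_restrict_iff' hQ.measurableSet]
  filter_upwards [this] with z hz h1 h2
  exact hz ⟨h1, h2⟩

/-- Weak derivatives commute with the extension by zero. -/
theorem weak_indicator (hQ : IsOpen Q) (hK : IsCompact K) (hKQ : K ⊆ Q)
    (h : IsWeakPartial Q a f g)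
    (hf : ∀ᵐ z ∂(volume.restrict Q), z ∉ K → f z = 0)
    (hg : ∀ᵐ z ∂(volume.restrict Q), z ∉ K → g z = 0) :
    IsWeakPartial univ a (K.indicator f) (K.indicator g) := by
  intro ζ hζ hc _
  obtain ⟨χ, hχ, hχc, hχQ, hχ1⟩ := exists_cutoff hK hQ hKQ
  have key := h (fun z => χ z * ζ z) (hχ.mul hζ) hχc.mul_right
    ((tsupport_mul_subset_left).trans hχQ)
  have tr : ∀ (F G : Spacetime → ℝ) (f : Spacetime → ℝ), (∀ z ∈ K, F z = G z) →
      (∀ᵐ z ∂(volume.restrict Q), z ∉ K → f z = 0) →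
      ∫ z in Q, f z * F z = ∫ z in univ, K.indicator f z * G z := fun F G f hFG hf => by
    have e1 : ∫ z in Q, f z * F z = ∫ z in Q, K.indicator f z * G z := by
      refine integral_congr_ae ?_
      filter_upwards [hf] with z hz
      by_cases hzK : z ∈ K
      · rw [indicator_of_mem hzK, hFG z hzK]
      · rw [indicator_of_notMem hzK, hz hzK, zero_mul, zero_mul]
    rw [e1, setIntegral_univ]
    refine setIntegral_eq_integral_of_forall_compl_eq_zero fun z hz => ?_
    rw [indicator_of_notMem fun h => hz (hKQ h), zero_mul]
  rw [tr _ (fun z => fderiv ℝ ζ z (dir a)) f (fun z hz => ?_) hf,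
    tr _ ζ g (fun z hz => by simp [(hχ1 z hz).self_of_nhds]) hg] at key
  · exact key
  · have : (fun z => χ z * ζ z) =ᶠ[nhds z] ζ := by
      filter_upwards [hχ1 z hz] with y hy
      simp [hy]
    rw [this.fderiv_eq]

theorem memLp_indicator (hK : MeasurableSet K) (hKQ : K ⊆ Q)
    (hg : MemLp g 2 (volume.restrict Q)) :
    MemLp (K.indicator g) 2 (volume.restrict univ) := by
  rw [Measure.restrict_univ, memLp_indicator_iff_restrict hK]
  exact hg.mono_measure (Measure.restrict_mono hKQ le_rfl)

theorem ae_indicator (hf : ∀ᵐ z ∂(volume.restrict Q), z ∉ K → f z = 0) :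
    f =ᵐ[volume.restrict Q] K.indicator f := by
  filter_upwards [hf] with z hz
  by_cases hzK : z ∈ K
  · rw [indicator_of_mem hzK]
  · rw [indicator_of_notMem hzK, hz hzK]

/-- The extension by zero of a function of `H²(Q)` which vanishes outside a compact subset. -/
theorem SobolevH2.exists_zero_extension (hQ : IsOpen Q) (hK : IsCompact K) (hKQ : K ⊆ Q)
    (u : SobolevH2 Q) (hu : ∀ᵐ z ∂(volume.restrict Q), z ∉ K → u.val z = 0) :
    ∃ v : SobolevH2 univ,
      ((∀ z ∉ K, v.val z = 0) ∧ (∀ a, ∀ z ∉ K, v.d a z = 0) ∧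
        ∀ a b, ∀ z ∉ K, v.dd a b z = 0) ∧
      u.val =ᵐ[volume.restrict Q] v.val ∧ (∀ a, u.d a =ᵐ[volume.restrict Q] v.d a) ∧
      ∀ a b, u.dd a b =ᵐ[volume.restrict Q] v.dd a b := by
  have hd := fun a => weak_eq_zero hQ hK.isClosed (u.weak_d a) (u.memLp_d a) hu
  have hdd := fun a b => weak_eq_zero hQ hK.isClosed (u.weak_dd a b) (u.memLp_dd a b) (hd a)
  have hm := hK.isClosed.measurableSet
  exact ⟨⟨K.indicator u.val, fun a => K.indicator (u.d a), fun a b => K.indicator (u.dd a b),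
    memLp_indicator hm hKQ u.memLp_val, fun a => memLp_indicator hm hKQ (u.memLp_d a),
    fun a b => memLp_indicator hm hKQ (u.memLp_dd a b),
    fun a => weak_indicator hQ hK hKQ (u.weak_d a) hu (hd a),
    fun a b => weak_indicator hQ hK hKQ (u.weak_dd a b) (hd a) (hdd a b)⟩,
    ⟨fun z hz => indicator_of_notMem hz _, fun a z hz => indicator_of_notMem hz _,
      fun a b z hz => indicator_of_notMem hz _⟩,
    ae_indicator hu, fun a => ae_indicator (hd a), fun a b => ae_indicator (hdd a b)⟩

theorem SpatialH1.exists_zero_extension (hQ : IsOpen Q) (hK : IsCompact K) (hKQ : K ⊆ Q)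
    (F : SpatialH1 Q) (hF : ∀ᵐ z ∂(volume.restrict Q), z ∉ K → F.val z = 0) :
    ∃ G : SpatialH1 univ, ((∀ z ∉ K, G.val z = 0) ∧ ∀ i, ∀ z ∉ K, G.d i z = 0) ∧
      F.val =ᵐ[volume.restrict Q] G.val ∧ ∀ i, F.d i =ᵐ[volume.restrict Q] G.d i := by
  have hd := fun i => weak_eq_zero hQ hK.isClosed (F.weak_d i) (F.memLp_d i) hF
  have hm := hK.isClosed.measurableSet
  exact ⟨⟨K.indicator F.val, fun i => K.indicator (F.d i), memLp_indicator hm hKQ F.memLp_val,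
    fun i => memLp_indicator hm hKQ (F.memLp_d i),
    fun i => weak_indicator hQ hK hKQ (F.weak_d i) hF (hd i)⟩,
    ⟨fun z hz => indicator_of_notMem hz _, fun i z hz => indicator_of_notMem hz _⟩,
    ae_indicator hF, fun i => ae_indicator (hd i)⟩

end ZeroExtension

/-! ### Passage to the limit in the Carleman estimate -/

/-- The densities `E n` and `e` are integrable with respect to the weight `W`, and their weighted
integrals converge. -/
structure LimW (W : Spacetime → ℝ) (E : ℕ → Spacetime → ℝ) (e : Spacetime → ℝ) : Prop where
  int : ∀ n, Integrable fun z => E n z * W z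
  int_lim : Integrable fun z => e z * W z
  lim : Tendsto (fun n => ∫ z, E n z * W z) atTop (𝓝 (∫ z, e z * W z))

namespace LimW

variable {W : Spacetime → ℝ} {E F : ℕ → Spacetime → ℝ} {e f : Spacetime → ℝ}

theorem add (hE : LimW W E e) (hF : LimW W F f) :
    LimW W (fun n z => E n z + F n z) fun z => e z + f z where
  int n := by simp only [add_mul]; exact (hE.int n).add (hF.int n)
  int_lim := by simp only [add_mul]; exact hE.int_lim.add hF.int_lim
  lim := by
    simp only [add_mul]
    rw [integral_add hE.int_lim hF.int_lim]
    exact (hE.lim.add hF.lim).congr fun n => (integral_add (hE.int n) (hF.int n)).symm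

theorem const_mul (c : ℝ) (hE : LimW W E e) : LimW W (fun n z => c * E n z) fun z => c * e z where
  int n := by simp only [mul_assoc]; exact (hE.int n).const_mul c
  int_lim := by simp only [mul_assoc]; exact hE.int_lim.const_mul c
  lim := by simp only [mul_assoc, integral_const_mul]; exact hE.lim.const_mul c

theorem sum {ι : Type*} {s : Finset ι} {E : ι → ℕ → Spacetime → ℝ} {e : ι → Spacetime → ℝ}
    (h : ∀ i, LimW W (E i) (e i)) :
    LimW W (fun n z => ∑ i ∈ s, E i n z) fun z => ∑ i ∈ s, e i z := by
  classical
  induction s using Finset.induction_on with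
  | empty => exact ⟨by simp, by simp, by simp⟩
  | insert i s hi ih =>
    simp only [Finset.sum_insert hi]
    exact (h i).add ih

end LimW

theorem norm_toLp_sq {f : Spacetime → ℝ} (hf : MemLp f 2 volume) :
    ‖hf.toLp f‖ ^ 2 = ∫ z, f z ^ 2 := by
  rw [← real_inner_self_eq_norm_sq, L2.inner_def]
  refine integral_congr_ae ?_
  filter_upwards [hf.coeFn_toLp] with z hz
  rw [hz]; simp [pow_two]

/-- Convergence in `L²` yields convergence of the integrals of the squares, with a bounded
weight. -/
theorem LimW.sq {a : Spacetime → ℝ} (ha : Measurable a) {M : ℝ} (hM : ∀ z, |a z| ≤ M)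
    {ρ : ℕ → ℝ} (hρ : Tendsto ρ atTop (𝓝[>] 0)) {G : ℝ → Spacetime → ℝ} {g : Spacetime → ℝ}
    (hG : TendstoL2 G g) (hm : ∀ n, MemLp (G (ρ n)) 2 volume) (hg : MemLp g 2 volume) :
    LimW (fun z => a z ^ 2) (fun n z => G (ρ n) z ^ 2) fun z => g z ^ 2 := by
  have mul : ∀ {f : Spacetime → ℝ}, MemLp f 2 volume → MemLp (fun z => a z * f z) 2 volume :=
    fun hf => hf.of_le_mul (c := M) (ha.aestronglyMeasurable.mul hf.1)
      (Eventually.of_forall fun z => by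
        rw [norm_mul]
        gcongr
        exact hM z)
  have e : ∀ f : Spacetime → ℝ, (fun z => f z ^ 2 * a z ^ 2) = fun z => (a z * f z) ^ 2 :=
    fun f => by ext z; ring
  refine ⟨fun n => ?_, ?_, ?_⟩
  · rw [e]; exact (mul (hm n)).integrable_sq
  · rw [e]; exact (mul hg).integrable_sq
  · simp only [e, ← norm_toLp_sq (mul hg), ← norm_toLp_sq (mul (hm _))]
    refine (Tendsto.norm ?_).pow 2
    rw [Lp.tendsto_Lp_iff_tendsto_eLpNorm'']
    exact (hG.bdd_mul hM).comp hρ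

/-- A mollification at a small scale is supported near the support of the function. -/
theorem tsupport_moll_subset {K K' : Set Spacetime} (hK' : IsClosed K') {δ : ℝ}
    (hδ : Metric.cthickening δ K ⊆ K') {f : Spacetime → ℝ} (hf : ∀ z ∉ K, f z = 0) {r : ℝ}
    (hr : 0 < r) (hrδ : r ≤ δ) : tsupport (moll r f) ⊆ K' := by
  refine closure_minimal (fun z hz => ?_) hK'
  by_contra h
  refine hz ?_
  have : ∀ t, kern r t * f (z - t) = 0 := fun t => by
    by_cases ht : t ∈ Metric.ball (0 : Spacetime) r
    · rw [hf, mul_zero]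
      intro hK
      refine h (hδ (Metric.mem_cthickening_of_dist_le z (z - t) δ K hK ?_))
      rw [dist_eq_norm, sub_sub_cancel]
      exact (mem_ball_zero_iff.1 ht).le.trans hrδ
    · have : kern r t = 0 := by
        by_contra h'
        exact ht (support_kern hr h')
      rw [this, zero_mul]
  simp only [moll, conv, this, integral_zero]

/-- The Carleman estimate for smooth fields extends to fields in `H²` of the whole space-time
which vanish outside a smaller compact set: it is applied to the mollified fields, whose sources
converge in `L²` together with their spatial gradients. -/
theorem sobolev_estimate {K K' : Set Spacetime} (hK : IsCompact K) (hK' : IsCompact K')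
    (hKK' : K ⊆ interior K') {P : Coeffs} (hP : P.IsC2) (hPc : P.CompactlySupported)
    {φ : Spacetime → ℝ} (hφ : Continuous φ) {τ C : ℝ}
    (H : ∀ u : SmoothPair K',
      ∫ z, (τ * ((∑ i, ∑ a, D a (u.u 0 i) z ^ 2) + ∑ r, ∑ a, D a (u.V r) z ^ 2)
          + τ ^ 3 * ((∑ i, u.u 0 i z ^ 2) + ∑ r, u.V r z ^ 2)) * Real.exp (2 * τ * φ z)
        ≤ C * ∫ z, P.srcEnergy u z * Real.exp (2 * τ * φ z))
    {v : Fin 2 → Fin 3 → SobolevH2 univ} (hv : ∀ r i, ∀ z ∉ K, (v r i).val z = 0)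
    {F : Fin 2 → Fin 3 → SpatialH1 univ}
    (hF : ∀ r i, (fun z => P.form z.1 (fun s j a => (v s j).d a z)
      (fun s j a b => (v s j).dd a b z) r i) =ᵐ[volume] (F r i).val) :
    (∫ z, τ * (gradSq (v 0) z + gradDivSq (v 0) z + gradDivSq (v 1) z)
        * K'.indicator (fun z => Real.exp (2 * τ * φ z)) z)
      + (∫ z, τ ^ 3 * (normSq (v 0) z + div (v 0) z ^ 2 + div (v 1) z ^ 2)
        * K'.indicator (fun z => Real.exp (2 * τ * φ z)) z)
      ≤ C * ∫ z, (sourceSq (F 0) z + sourceSq (F 1) z + gradSourceSq (F 0) z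
        + gradSourceSq (F 1) z) * K'.indicator (fun z => Real.exp (2 * τ * φ z)) z := by
  -- all data on the whole space
  have mv : ∀ r i, MemLp (v r i).val 2 volume := fun r i => by
    simpa using (v r i).memLp_val
  have md : ∀ r i a, MemLp ((v r i).d a) 2 volume := fun r i a => by
    simpa using (v r i).memLp_d a
  have mdd : ∀ r i a b, MemLp ((v r i).dd a b) 2 volume := fun r i a b => by
    simpa using (v r i).memLp_dd a b
  have mF : ∀ r i, MemLp (F r i).val 2 volume := fun r i => by
    simpa using (F r i).memLp_val
  have mdF : ∀ r i k, MemLp ((F r i).d k) 2 volume := fun r i k => by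
    simpa using (F r i).memLp_d k
  -- the mollified fields
  obtain ⟨δ, hδ, hδK⟩ := hK.exists_cthickening_subset_open isOpen_interior hKK'
  set ρ : ℕ → ℝ := fun n => δ / (n + 1)
  have hρ0 : ∀ n, 0 < ρ n := fun n => by positivity
  have hρδ : ∀ n, ρ n ≤ δ := fun n => div_le_self hδ.le (by simp)
  have hρ : Tendsto ρ atTop (𝓝[>] 0) :=
    tendsto_nhdsWithin_iff.2 ⟨by
      have := (tendsto_one_div_add_atTop_nhds_zero_nat (𝕜 := ℝ)).const_mul δ
      simpa [ρ, div_eq_mul_inv] using this, Eventually.of_forall hρ0⟩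
  let u : ℕ → SmoothPair K' := fun n =>
    ⟨fun r i => moll (ρ n) (v r i).val,
      fun r i => smooth_moll (hρ0 n) (locallyIntegrable_of_memLp (mv r i)),
      fun r i => tsupport_moll_subset hK'.isClosed (hδK.trans interior_subset) (hv r i)
        (hρ0 n) (hρδ n)⟩
  have hD : ∀ n r i a, D a ((u n).u r i) = moll (ρ n) ((v r i).d a) := fun n r i a =>
    D_moll (hρ0 n) (locallyIntegrable_of_memLp (mv r i)) ((v r i).weak_d a)
  have hDD : ∀ n r i a b, D b (D a ((u n).u r i)) = moll (ρ n) ((v r i).dd a b) :=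
    fun n r i a b => by
      rw [hD]; exact D_moll (hρ0 n) (locallyIntegrable_of_memLp (md r i a)) ((v r i).weak_dd a b)
  have hV : ∀ n r, (u n).V r = fun z => ∑ j, moll (ρ n) ((v r j).d (sp j)) z := fun n r => by
    ext z; simp only [SmoothPair.V, hD]
  have hDV : ∀ n r a, D a ((u n).V r) = fun z => ∑ j, moll (ρ n) ((v r j).dd (sp j) a) z :=
    fun n r a => by rw [(u n).D_V]; simp only [hDD]
  have hS : ∀ n r i, P.src (u n) r i = fun z => P.form z.1
      (fun s j a => moll (ρ n) ((v s j).d a) z)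
      (fun s j a b => moll (ρ n) ((v s j).dd a b) z) r i := fun n r i => by
    ext z; rw [Coeffs.src_eq_form]; simp only [hDD]; simp only [hD]
  have memC : ∀ {f : Spacetime → ℝ}, Continuous f → tsupport f ⊆ K' → MemLp f 2 volume :=
    fun hf hs => hf.memLp_of_hasCompactSupport (hK'.of_isClosed_subset (isClosed_tsupport _) hs)
  -- the weight
  set W : Spacetime → ℝ := K'.indicator fun z => Real.exp (2 * τ * φ z) with hWdef
  set a : Spacetime → ℝ := K'.indicator fun z => Real.exp (τ * φ z)
  have haW : (fun z => a z ^ 2) = W := by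
    ext z
    by_cases hz : z ∈ K'
    · simp only [a, W, indicator_of_mem hz, ← Real.exp_nat_mul]
      congr 1; push_cast; ring
    · simp [a, W, indicator_of_notMem hz]
  have hec : Continuous fun z => Real.exp (τ * φ z) := by fun_prop
  have ham : Measurable a := hec.measurable.indicator hK'.isClosed.measurableSet
  obtain ⟨M, hM⟩ : ∃ M, ∀ z, |a z| ≤ M := by
    obtain ⟨M, hM⟩ := hK'.exists_bound_of_continuousOn hec.continuousOn
    refine ⟨max M 0, fun z => ?_⟩
    by_cases hz : z ∈ K'
    · simp only [a, indicator_of_mem hz]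
      exact (hM z hz).trans (le_max_left _ _)
    · simp [a, indicator_of_notMem hz]
  have sq : ∀ {G : ℝ → Spacetime → ℝ} {g : Spacetime → ℝ}, TendstoL2 G g →
      (∀ n, MemLp (G (ρ n)) 2 volume) → MemLp g 2 volume →
      LimW W (fun n z => G (ρ n) z ^ 2) fun z => g z ^ 2 := fun h1 h2 h3 =>
    haW ▸ LimW.sq ham hM hρ h1 h2 h3
  -- convergence of all terms
  have Lv : ∀ r i, LimW W (fun n z => (u n).u r i z ^ 2) fun z => (v r i).val z ^ 2 := fun r i =>
    sq (tendsto_moll (mv r i)) (fun n => memC ((u n).smooth r i).continuous ((u n).supp r i))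
      (mv r i)
  have Ld : ∀ r i a, LimW W (fun n z => D a ((u n).u r i) z ^ 2) fun z => (v r i).d a z ^ 2 :=
    fun r i a => by
      simp only [hD]
      exact sq (tendsto_moll (md r i a)) (fun n => by
        rw [← hD]
        exact memC (((u n).smooth r i).D a).continuous
          (tsupport_D_subset.trans ((u n).supp r i))) (md r i a)
  have LV : ∀ r, LimW W (fun n z => (u n).V r z ^ 2) fun z => div (v r) z ^ 2 := fun r => by
    have h := Approx.sum (s := Finset.univ) fun j => Approx.moll (md r j (sp j))
    simp only [hV]
    refine sq h.lim (fun n => ?_) h.memLp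
    rw [← hV]
    exact memC ((u n).smooth_V r).continuous ((u n).tsupport_V hK'.isClosed r)
  have LDV : ∀ r a, LimW W (fun n z => D a ((u n).V r) z ^ 2) fun z => dDiv (v r) a z ^ 2 :=
    fun r a => by
      have h := Approx.sum (s := Finset.univ) fun j => Approx.moll (mdd r j (sp j) a)
      simp only [hDV]
      refine sq h.lim (fun n => ?_) h.memLp
      rw [← hDV]
      exact memC (((u n).smooth_V r).D a).continuous
        (tsupport_D_subset.trans ((u n).tsupport_V hK'.isClosed r))
  have AS := fun r i => Coeffs.approx_form hP hPc (d := fun s j a => (v s j).d a) md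
    (dd := fun s j a b => (v s j).dd a b) mdd r i
  have wF : ∀ r i k, IsWeakPartial univ (sp k) (fun z => P.form z.1 (fun s j a => (v s j).d a z)
      (fun s j a b => (v s j).dd a b z) r i) ((F r i).d k) := fun r i k ζ h1 h2 h3 => by
    rw [← (F r i).weak_d k ζ h1 h2 h3, setIntegral_univ, setIntegral_univ]
    refine integral_congr_ae ?_
    filter_upwards [hF r i] with z hz
    rw [hz]
  have LS : ∀ r i, LimW W (fun n z => P.src (u n) r i z ^ 2) fun z => (F r i).val z ^ 2 :=
    fun r i => by
      simp only [hS]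
      refine sq ((AS r i).lim.congr_ae (hF r i)) (fun n => ?_) (mF r i)
      rw [← hS]
      exact memC (hP.src_C1 (u n) r i).continuous (tsupport_src hK'.isClosed (u n) r i)
  have LDS : ∀ r i k, LimW W (fun n z => D (sp k) (P.src (u n) r i) z ^ 2)
      fun z => (F r i).d k z ^ 2 := fun r i k => by
    simp only [hS]
    refine sq ((AS r i).tendsto_D (mdF r i k) (wF r i k)) (fun n => ?_) (mdF r i k)
    rw [← hS]
    exact memC (continuous_D (hP.src_C1 (u n) r i) _)
      (tsupport_D_subset.trans (tsupport_src hK'.isClosed (u n) r i))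
  have L1 := ((LimW.sum (s := Finset.univ) fun i =>
      LimW.sum (s := Finset.univ) fun a => Ld 0 i a).add
    (LimW.sum (s := Finset.univ) fun r =>
      LimW.sum (s := Finset.univ) fun a => LDV r a)).const_mul τ
  have L2 := ((LimW.sum (s := Finset.univ) fun i => Lv 0 i).add
    (LimW.sum (s := Finset.univ) fun r => LV r)).const_mul (τ ^ 3)
  have L3 := LimW.sum (s := Finset.univ) fun r => LimW.sum (s := Finset.univ) fun i =>
    (LS r i).add (LimW.sum (s := Finset.univ) fun k => LDS r i k)
  -- off `K'` all densities vanish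
  have off : ∀ n z, z ∉ K' → (∀ r i, (u n).u r i z = 0) ∧ (∀ r i a, D a ((u n).u r i) z = 0) ∧
      (∀ r, (u n).V r z = 0) ∧ (∀ r a, D a ((u n).V r) z = 0) ∧
      (∀ r i, P.src (u n) r i z = 0) ∧ ∀ r i k, D (sp k) (P.src (u n) r i) z = 0 :=
    fun n z hz => ⟨fun r i => image_eq_zero_of_notMem_tsupport fun h => hz ((u n).supp r i h),
      fun r i a => D_eq_zero_of_notMem fun h => hz ((u n).supp r i h),
      fun r => image_eq_zero_of_notMem_tsupport fun h => hz ((u n).tsupport_V hK'.isClosed r h),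
      fun r a => D_eq_zero_of_notMem fun h => hz ((u n).tsupport_V hK'.isClosed r h),
      fun r i => image_eq_zero_of_notMem_tsupport fun h =>
        hz (tsupport_src hK'.isClosed (u n) r i h),
      fun r i k => D_eq_zero_of_notMem fun h => hz (tsupport_src hK'.isClosed (u n) r i h)⟩
  have key := le_of_tendsto_of_tendsto' (L1.add L2).lim (L3.lim.const_mul C) fun n => by
    refine le_trans (le_of_eq (integral_congr_ae (Eventually.of_forall fun z => ?_)))
      ((H (u n)).trans (le_of_eq ?_))
    · by_cases hz : z ∈ K'
      · simp only [W, indicator_of_mem hz]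
      · obtain ⟨h1, h2, h3, h4, -⟩ := off n z hz
        simp [h1, h2, h3, h4]
    · congr 1
      refine integral_congr_ae (Eventually.of_forall fun z => ?_)
      by_cases hz : z ∈ K'
      · simp only [W, indicator_of_mem hz, Coeffs.srcEnergy]
      · obtain ⟨-, -, -, -, h5, h6⟩ := off n z hz
        simp [Coeffs.srcEnergy, h5, h6]
  simp only [add_mul _ _ (W _)] at key
  rw [integral_add L1.int_lim L2.int_lim] at key
  have e3 : ∀ z, sourceSq (F 0) z + sourceSq (F 1) z + gradSourceSq (F 0) z + gradSourceSq (F 1) z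
      = ∑ r, ∑ i, ((F r i).val z ^ 2 + ∑ k, (F r i).d k z ^ 2) := fun z => by
    rw [Fin.sum_univ_two, Finset.sum_add_distrib, Finset.sum_add_distrib]
    unfold sourceSq gradSourceSq
    ring
  simp only [e3]
  simp only [Fin.sum_univ_two, ← add_assoc] at key ⊢
  exact key

/-! ### Localization of the coefficients -/

theorem WaveCarleman.congr {K : Set Spacetime} {φ : Spacetime → ℝ} {c c' : Space → ℝ}
    (h : WaveCarleman K φ c) (e : ∀ z ∈ K, c' z.1 = c z.1) : WaveCarleman K φ c' := by
  obtain ⟨τs, hτs, C, hC, H⟩ := h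
  exact ⟨τs, hτs, C, hC, fun τ hτ w hw hs f hf hf0 hle =>
    H τ hτ w hw hs f hf hf0 fun z hz => by rw [← e z hz]; exact hle z hz⟩

/-- The coefficients `P'` agree with `P` near `x`. -/
structure Coeffs.AgreeAt (P' P : Coeffs) (x : Space) : Prop where
  rho11 : P'.rho11 =ᶠ[𝓝 x] P.rho11
  rho12 : P'.rho12 =ᶠ[𝓝 x] P.rho12
  rho22 : P'.rho22 =ᶠ[𝓝 x] P.rho22
  mu : P'.mu =ᶠ[𝓝 x] P.mu
  lam : P'.lam =ᶠ[𝓝 x] P.lam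
  q : P'.q =ᶠ[𝓝 x] P.q
  r : P'.r =ᶠ[𝓝 x] P.r

namespace Coeffs.AgreeAt

variable {P' P : Coeffs} {x : Space}

theorem eventually (h : P'.AgreeAt P x) : ∀ᶠ y in 𝓝 x, P'.AgreeAt P y := by
  filter_upwards [h.rho11.eventuallyEq_nhds, h.rho12.eventuallyEq_nhds, h.rho22.eventuallyEq_nhds,
    h.mu.eventuallyEq_nhds, h.lam.eventuallyEq_nhds, h.q.eventuallyEq_nhds,
    h.r.eventuallyEq_nhds] with y h1 h2 h3 h4 h5 h6 h7
  exact ⟨h1, h2, h3, h4, h5, h6, h7⟩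

theorem isOpen (P' P : Coeffs) : IsOpen {x | P'.AgreeAt P x} :=
  isOpen_iff_mem_nhds.2 fun _ h => AgreeAt.eventually h

theorem rho_eq (h : P'.AgreeAt P x) : P'.rho x = P.rho x := by
  simp only [Coeffs.rho, h.rho11.self_of_nhds, h.rho12.self_of_nhds, h.rho22.self_of_nhds]

theorem A_eq (h : P'.AgreeAt P x) : P'.A x = P.A x := by
  simp only [Coeffs.A, h.rho_eq, h.rho11.self_of_nhds, h.rho12.self_of_nhds, h.rho22.self_of_nhds,
    h.mu.self_of_nhds, h.lam.self_of_nhds, h.q.self_of_nhds, h.r.self_of_nhds]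

theorem mu1_eq (h : P'.AgreeAt P x) : P'.mu1 x = P.mu1 x := by
  simp only [Coeffs.mu1, h.rho_eq, h.rho22.self_of_nhds, h.mu.self_of_nhds]

theorem form_eq (h : P'.AgreeAt P x) (d : Fin 2 → Fin 3 → Fin 4 → ℝ)
    (dd : Fin 2 → Fin 3 → Fin 4 → Fin 4 → ℝ) (r : Fin 2) (i : Fin 3) :
    P'.form x d dd r i = P.form x d dd r i := by
  simp only [Coeffs.form, pd, h.rho11.self_of_nhds, h.rho12.self_of_nhds, h.rho22.self_of_nhds,
    h.mu.self_of_nhds, h.lam.self_of_nhds, h.q.self_of_nhds, h.r.self_of_nhds, h.mu.fderiv_eq,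
    h.lam.fderiv_eq, h.q.fderiv_eq, h.r.fderiv_eq]

end Coeffs.AgreeAt

/-- Coefficients of class `C²` on an open set agree, near a compact subset, with compactly
supported coefficients of class `C²` on the whole space. -/
theorem Coeffs.exists_extension {P : Coeffs} {Ω : Set Space} (hΩ : IsOpen Ω)
    (hP : P.Admissible Ω) {K : Set Space} (hK : IsCompact K) (hKΩ : K ⊆ Ω) :
    ∃ P' : Coeffs, P'.IsC2 ∧ P'.CompactlySupported ∧ ∀ x ∈ K, P'.AgreeAt P x := by
  have ext : ∀ c : Space → ℝ, IsC2Closure Ω c →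
      ∃ c' : Space → ℝ, ContDiff ℝ 2 c' ∧ HasCompactSupport c' ∧ ∀ x ∈ K, c' =ᶠ[𝓝 x] c :=
    fun c hc => by
      have h : ∀ x ∈ Ω, ContDiffAt ℝ ((2 : ℕ∞) : WithTop ℕ∞) c x := fun x hx =>
        hc.1.contDiffAt (hΩ.mem_nhds hx)
      exact exists_contDiff_extension hK hΩ hKΩ h
  obtain ⟨c1, a1, b1, e1⟩ := ext _ hP.rho11_C2
  obtain ⟨c2, a2, b2, e2⟩ := ext _ hP.rho12_C2
  obtain ⟨c3, a3, b3, e3⟩ := ext _ hP.rho22_C2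
  obtain ⟨c4, a4, b4, e4⟩ := ext _ hP.mu_C2
  obtain ⟨c5, a5, b5, e5⟩ := ext _ hP.lam_C2
  obtain ⟨c6, a6, b6, e6⟩ := ext _ hP.q_C2
  obtain ⟨c7, a7, b7, e7⟩ := ext _ hP.r_C2
  exact ⟨⟨c1, c2, c3, c4, c5, c6, c7⟩, ⟨a1, a2, a3, a4, a5, a6, a7⟩,
    ⟨b1, b2, b3, b4, b5, b6, b7⟩, fun x hx => ⟨e1 x hx, e2 x hx, e3 x hx, e4 x hx, e5 x hx,
      e6 x hx, e7 x hx⟩⟩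

/-- Two distinct eigenvalues of a `2 × 2` matrix determine its trace and its determinant. -/
theorem trace_det_of_hasEigenvalue {M : Matrix (Fin 2) (Fin 2) ℝ} {a b : ℝ} (hab : a ≠ b)
    (ha : Module.End.HasEigenvalue (Matrix.toLin' M) a)
    (hb : Module.End.HasEigenvalue (Matrix.toLin' M) b) :
    M 0 0 + M 1 1 = a + b ∧ M 0 0 * M 1 1 - M 0 1 * M 1 0 = a * b := by
  have root : ∀ c, Module.End.HasEigenvalue (Matrix.toLin' M) c →
      c ^ 2 - (M 0 0 + M 1 1) * c + (M 0 0 * M 1 1 - M 0 1 * M 1 0) = 0 := fun c hc => by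
    rw [Module.End.hasEigenvalue_iff_isRoot_charpoly, Matrix.charpoly_toLin',
      Matrix.charpoly_fin_two] at hc
    simpa [Polynomial.IsRoot, Matrix.trace_fin_two, Matrix.det_fin_two] using hc
  have h1 := root a ha
  have h2 := root b hb
  have h3 : M 0 0 + M 1 1 = a + b := by
    refine mul_left_cancel₀ (sub_ne_zero.2 hab) ?_
    linear_combination h2 - h1
  refine ⟨h3, ?_⟩
  rw [h3] at h1
  linear_combination h1

/-! ### Fields on the cylinder -/

theorem isOpen_cylinder {Ω : Set Space} (hΩ : IsOpen Ω) (T : ℝ) : IsOpen (cylinder Ω T) :=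
  hΩ.prod isOpen_Ioo

theorem Coeffs.form_zero (P : Coeffs) {Q : Set Spacetime} (u : Fin 2 → Fin 3 → SobolevH2 Q)
    (i : Fin 3) (z : Spacetime) :
    P.form z.1 (fun s j a => (u s j).d a z) (fun s j a b => (u s j).dd a b z) 0 i
      = P.rho11 z.1 * (u 0 i).dd tm tm z + P.rho12 z.1 * (u 1 i).dd tm tm z
        - lame P.mu P.lam (u 0) i z - gradMulDiv P.q (u 1) i z := by
  simp [Coeffs.form, lame, gradMulDiv, lapl, dDiv, div, mul_comm]

theorem Coeffs.form_one (P : Coeffs) {Q : Set Spacetime} (u : Fin 2 → Fin 3 → SobolevH2 Q)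
    (i : Fin 3) (z : Spacetime) :
    P.form z.1 (fun s j a => (u s j).d a z) (fun s j a b => (u s j).dd a b z) 1 i
      = P.rho12 z.1 * (u 0 i).dd tm tm z + P.rho22 z.1 * (u 1 i).dd tm tm z
        - gradMulDiv P.q (u 0) i z - gradMulDiv P.r (u 1) i z := by
  simp [Coeffs.form, gradMulDiv, dDiv, div, mul_comm]

theorem Coeffs.form_eq_zero (P : Coeffs) (x : Space) {d : Fin 2 → Fin 3 → Fin 4 → ℝ}
    {dd : Fin 2 → Fin 3 → Fin 4 → Fin 4 → ℝ} (hd : ∀ s j a, d s j a = 0)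
    (hdd : ∀ s j a b, dd s j a b = 0) (r : Fin 2) (i : Fin 3) : P.form x d dd r i = 0 := by
  fin_cases r <;> simp [Coeffs.form, hd, hdd]

/-- An integral over `Q` whose density vanishes outside `K ⊆ K' ⊆ Q`, as an integral over the
whole space-time with the weight cut off outside `K'`. -/
theorem setIntegral_eq_integral_indicator {Q K K' : Set Spacetime} (hKK' : K ⊆ K')
    (hK'Q : K' ⊆ Q) {f g w : Spacetime → ℝ} (hfg : f =ᵐ[volume.restrict Q] g)
    (hg : ∀ z ∉ K, g z = 0) : ∫ z in Q, f z * w z = ∫ z, g z * K'.indicator w z := by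
  have h : ∫ z in Q, f z * w z = ∫ z in Q, g z * K'.indicator w z := by
    refine integral_congr_ae ?_
    filter_upwards [hfg] with z hz
    by_cases hzK : z ∈ K'
    · rw [indicator_of_mem hzK, hz]
    · rw [hz, hg z fun h => hzK (hKK' h), zero_mul, zero_mul]
  rw [h]
  refine setIntegral_eq_integral_of_forall_compl_eq_zero fun z hz => ?_
  rw [hg z fun h => hz (hK'Q (hKK' h)), zero_mul]

/-- The Carleman estimate for fields in `H²(Q)` with compact support, once it is known for smooth
fields on a slightly larger compact set and for coefficients which agree near this set. -/
theorem cylinder_estimate {Q K K' : Set Spacetime} (hQ : IsOpen Q) (hK : IsCompact K)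
    (hK' : IsCompact K') (hKK' : K ⊆ interior K') (hK'Q : K' ⊆ Q) {P P' : Coeffs}
    (hP : P'.IsC2) (hPc : P'.CompactlySupported) (hPP : ∀ z ∈ K', P'.AgreeAt P z.1)
    {φ : Spacetime → ℝ} (hφ : Continuous φ) {τ C : ℝ}
    (H : ∀ u : SmoothPair K',
      ∫ z, (τ * ((∑ i, ∑ a, D a (u.u 0 i) z ^ 2) + ∑ r, ∑ a, D a (u.V r) z ^ 2)
          + τ ^ 3 * ((∑ i, u.u 0 i z ^ 2) + ∑ r, u.V r z ^ 2)) * Real.exp (2 * τ * φ z)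
        ≤ C * ∫ z, P'.srcEnergy u z * Real.exp (2 * τ * φ z))
    {us uf : Fin 3 → SobolevH2 Q} {F₁ F₂ : Fin 3 → SpatialH1 Q}
    (hsol : IsSolution P us uf F₁ F₂) (hus : SupportedIn us K) (huf : SupportedIn uf K) :
    (∫ z in Q, τ * (gradSq us z + gradDivSq us z + gradDivSq uf z) * Real.exp (2 * τ * φ z))
      + (∫ z in Q, τ ^ 3 * (normSq us z + div us z ^ 2 + div uf z ^ 2) * Real.exp (2 * τ * φ z))
      ≤ C * ∫ z in Q, (sourceSq F₁ z + sourceSq F₂ z + gradSourceSq F₁ z + gradSourceSq F₂ z)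
        * Real.exp (2 * τ * φ z) := by
  have hKK : K ⊆ K' := hKK'.trans interior_subset
  have hKQ := hKK.trans hK'Q
  let u : Fin 2 → Fin 3 → SobolevH2 Q := ![us, uf]
  let F : Fin 2 → Fin 3 → SpatialH1 Q := ![F₁, F₂]
  have hu : ∀ r i, ∀ᵐ z ∂(volume.restrict Q), z ∉ K → (u r i).val z = 0 := by
    intro r i
    fin_cases r
    · exact hus.mono fun z h hz => h hz i
    · exact huf.mono fun z h hz => h hz i
  choose v hv0 hval hd hdd using fun r i => (u r i).exists_zero_extension hQ hK hKQ (hu r i)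
  -- the system in terms of the extended fields
  have hform : ∀ᵐ z ∂(volume.restrict Q), ∀ r i, P.form z.1 (fun s j a => (v s j).d a z)
      (fun s j a b => (v s j).dd a b z) r i = (F r i).val z := by
    have h1 : ∀ᵐ z ∂(volume.restrict Q), ∀ r i a, (u r i).d a z = (v r i).d a z :=
      ae_all_iff.2 fun r => ae_all_iff.2 fun i => ae_all_iff.2 fun a => hd r i a
    have h2 : ∀ᵐ z ∂(volume.restrict Q), ∀ r i a b, (u r i).dd a b z = (v r i).dd a b z :=
      ae_all_iff.2 fun r => ae_all_iff.2 fun i => ae_all_iff.2 fun a =>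
        ae_all_iff.2 fun b => hdd r i a b
    filter_upwards [hsol, h1, h2] with z hz h1 h2 r i
    simp only [← h1, ← h2]
    fin_cases r
    · exact (P.form_zero u i z).trans (hz i).1
    · exact (P.form_one u i z).trans (hz i).2
  have hF0 : ∀ r i, ∀ᵐ z ∂(volume.restrict Q), z ∉ K → (F r i).val z = 0 := fun r i => by
    filter_upwards [hform] with z hz hzK
    rw [← hz r i]
    exact P.form_eq_zero _ (fun s j a => (hv0 s j).2.1 a z hzK)
      (fun s j a b => (hv0 s j).2.2 a b z hzK) r i
  choose G hG0 hGval hGd using fun r i => (F r i).exists_zero_extension hQ hK hKQ (hF0 r i)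
  have hG : ∀ r i, (fun z => P'.form z.1 (fun s j a => (v s j).d a z)
      (fun s j a b => (v s j).dd a b z) r i) =ᵐ[volume] (G r i).val := fun r i => by
    have h1 := (ae_restrict_iff' hQ.measurableSet).1 hform
    have h2 := (ae_restrict_iff' hQ.measurableSet).1 (hGval r i)
    filter_upwards [h1, h2] with z h1 h2
    by_cases hz : z ∈ K
    · rw [(hPP z (hKK hz)).form_eq, h1 (hKQ hz), h2 (hKQ hz)]
    · rw [(hG0 r i).1 z hz]
      exact P'.form_eq_zero _ (fun s j a => (hv0 s j).2.1 a z hz)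
        (fun s j a b => (hv0 s j).2.2 a b z hz) r i
  have key := sobolev_estimate hK hK' hKK' hP hPc hφ H (fun r i => (hv0 r i).1) hG
  have all : ∀ᵐ z ∂(volume.restrict Q), (∀ r i, (u r i).val z = (v r i).val z) ∧
      (∀ r i a, (u r i).d a z = (v r i).d a z) ∧
      (∀ r i a b, (u r i).dd a b z = (v r i).dd a b z) ∧
      (∀ r i, (F r i).val z = (G r i).val z) ∧ ∀ r i k, (F r i).d k z = (G r i).d k z := by
    refine (ae_all_iff.2 fun r => ae_all_iff.2 fun i => hval r i).and
      ((ae_all_iff.2 fun r => ae_all_iff.2 fun i => ae_all_iff.2 fun a => hd r i a).and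
      ((ae_all_iff.2 fun r => ae_all_iff.2 fun i => ae_all_iff.2 fun a =>
        ae_all_iff.2 fun b => hdd r i a b).and
      ((ae_all_iff.2 fun r => ae_all_iff.2 fun i => hGval r i).and
      (ae_all_iff.2 fun r => ae_all_iff.2 fun i => ae_all_iff.2 fun k => hGd r i k))))
  have e1 : ∫ z in Q, τ * (gradSq us z + gradDivSq us z + gradDivSq uf z) * Real.exp (2 * τ * φ z)
      = _ := setIntegral_eq_integral_indicator hKK hK'Q
    (g := fun z => τ * (gradSq (v 0) z + gradDivSq (v 0) z + gradDivSq (v 1) z))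
    (all.mono fun z ⟨_, h2, h3, _⟩ => by
      simp only [gradSq, gradDivSq, dDiv, ← h2, ← h3]
      rfl)
    fun z hz => by simp [gradSq, gradDivSq, dDiv, (hv0 _ _).2.1 _ z hz, (hv0 _ _).2.2 _ _ z hz]
  have e2 : ∫ z in Q, τ ^ 3 * (normSq us z + div us z ^ 2 + div uf z ^ 2) * Real.exp (2 * τ * φ z)
      = _ := setIntegral_eq_integral_indicator hKK hK'Q
    (g := fun z => τ ^ 3 * (normSq (v 0) z + div (v 0) z ^ 2 + div (v 1) z ^ 2))
    (all.mono fun z ⟨h1, h2, _⟩ => by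
      simp only [normSq, div, ← h1, ← h2]
      rfl)
    fun z hz => by simp [normSq, div, (hv0 _ _).1 z hz, (hv0 _ _).2.1 _ z hz]
  have e3 : ∫ z in Q, (sourceSq F₁ z + sourceSq F₂ z + gradSourceSq F₁ z + gradSourceSq F₂ z)
      * Real.exp (2 * τ * φ z) = _ := setIntegral_eq_integral_indicator hKK hK'Q
    (g := fun z => sourceSq (G 0) z + sourceSq (G 1) z + gradSourceSq (G 0) z
      + gradSourceSq (G 1) z)
    (all.mono fun z ⟨_, _, _, h4, h5⟩ => by
      simp only [sourceSq, gradSourceSq, ← h4, ← h5]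
      rfl)
    fun z hz => by simp [sourceSq, gradSourceSq, (hG0 _ _).1 z hz, (hG0 _ _).2 _ z hz]
  rw [e1, e2, e3]
  exact key

end Biot

end

theorem theorem2p1
    -- the domain, the observation centre and the time horizon
    (Ω : Set Biot.Space) (hΩo : IsOpen Ω) (hΩb : Bornology.IsBounded Ω) (hΩn : Ω.Nonempty)
    (x₀ : Biot.Space) (hx₀ : x₀ ∉ closure Ω)
    -- the coefficients and the three wave speeds
    (P : Biot.Coeffs) (hP : P.Admissible Ω)
    (m θ : ℝ) (hm : 0 < m) (hθ : θ ∈ Set.Ioo (0 : ℝ) 1)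
    (c₁s c₂s c₃s : ℝ) (hc₁s : 0 < c₁s) (hc₂s : 0 < c₂s) (hc₃s : 0 < c₃s)
    (c₂ c₃ : Biot.Space → ℝ) (heig : P.IsEigenvaluePair Ω c₂ c₃)
    (h₁ : Biot.SpeedClass Ω x₀ m θ c₁s P.mu1)
    (h₂ : Biot.SpeedClass Ω x₀ m θ c₂s c₂)
    (h₃ : Biot.SpeedClass Ω x₀ m θ c₃s c₃)
    (c₀ : ℝ) (hc₀ : c₀ = min c₁s (min c₂s c₃s))
    -- the parameters of the weight
    (β γ T : ℝ) (hβ : 0 < β) (hγ : 0 < γ)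
    (hβ₁ : β + m * Biot.D0 Ω x₀ / √c₀ * √β < θ * c₀)
    (hβ₂ : 0 < c₀ * Biot.minDistSq Ω x₀ - β * Biot.maxDistSq Ω x₀)
    (hT : Biot.D0 Ω x₀ / √β < T)
    -- the compact set that carries the solutions
    (K : Set Biot.Spacetime) (hK : IsCompact K) (hKQ : K ⊆ Biot.cylinder Ω T)
    (hKt : ∀ z ∈ K, β + m / √c₀ * (β * |z.2|) < θ * c₀) :
    ∃ τs > 0, ∃ C > 0, ∀ τ ≥ τs,
      ∀ (us uf : Fin 3 → Biot.SobolevH2 (Biot.cylinder Ω T))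
        (F₁ F₂ : Fin 3 → Biot.SpatialH1 (Biot.cylinder Ω T)),
        Biot.IsSolution P us uf F₁ F₂ → Biot.SupportedIn us K → Biot.SupportedIn uf K →
        (∫ z in Biot.cylinder Ω T,
            τ * (Biot.gradSq us z + Biot.gradDivSq us z + Biot.gradDivSq uf z)
              * Real.exp (2 * τ * Biot.phi x₀ β γ z))
          + (∫ z in Biot.cylinder Ω T,
            τ ^ 3 * (Biot.normSq us z + Biot.div us z ^ 2 + Biot.div uf z ^ 2)
              * Real.exp (2 * τ * Biot.phi x₀ β γ z))
          ≤ C * ∫ z in Biot.cylinder Ω T,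
            (Biot.sourceSq F₁ z + Biot.sourceSq F₂ z
              + Biot.gradSourceSq F₁ z + Biot.gradSourceSq F₂ z)
              * Real.exp (2 * τ * Biot.phi x₀ β γ z) := by
  have hc₀p : 0 < c₀ := by
    rw [hc₀]; exact lt_min hc₁s (lt_min hc₂s hc₃s)
  have hl₁ : c₀ ≤ c₁s := hc₀ ▸ min_le_left _ _
  have hl₂ : c₀ ≤ c₂s := hc₀ ▸ (min_le_right _ _).trans (min_le_left _ _)
  have hl₃ : c₀ ≤ c₃s := hc₀ ▸ (min_le_right _ _).trans (min_le_right _ _)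
  have hβθ : β < θ * c₀ := by
    have : 0 ≤ m * Biot.D0 Ω x₀ / √c₀ * √β :=
      mul_nonneg (div_nonneg (mul_nonneg hm.le (Real.sqrt_nonneg _)) (Real.sqrt_nonneg _))
        (Real.sqrt_nonneg _)
    linarith
  have hx₀Ω : x₀ ∉ Ω := fun h => hx₀ (subset_closure h)
  have hQo := Biot.isOpen_cylinder hΩo T
  -- a slightly larger compact set on which the same conditions hold
  have hR : IsOpen (Biot.cylinder Ω T ∩ {z | β + m / √c₀ * (β * |z.2|) < θ * c₀}) :=
    hQo.inter (isOpen_lt (by fun_prop) continuous_const)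
  obtain ⟨K', hK', hKK', hK'R⟩ := exists_compact_between hK hR fun z hz => ⟨hKQ hz, hKt z hz⟩
  have hK'Ω : ∀ z ∈ K', z.1 ∈ Ω := fun z hz => (hK'R hz).1.1
  have hK't : ∀ z ∈ K', β + m / √c₀ * (β * |z.2|) < θ * c₀ := fun z hz => (hK'R hz).2
  obtain ⟨P', hP'2, hP'c, hPP⟩ := Biot.Coeffs.exists_extension hΩo hP
    (hK'.image continuous_fst) (by rintro _ ⟨z, hz, rfl⟩; exact hK'Ω z hz)
  have hPP' : ∀ z ∈ K', P'.AgreeAt P z.1 := fun z hz => hPP z.1 ⟨z, hz, rfl⟩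
  have wave : ∀ {cs : ℝ} {c : Biot.Space → ℝ}, Biot.SpeedClass Ω x₀ m θ cs c → c₀ ≤ cs →
      Biot.WaveCarleman K' (Biot.phi x₀ β γ) c := fun h hl =>
    Biot.waveCarleman_of_speedClass hΩo hx₀Ω h hm hθ.2 hβ hγ hc₀p hl hβθ hK' hK'Ω hK't
  have hφ : Continuous (Biot.phi x₀ β γ) := (Biot.contDiff_phi x₀ β γ (n := 0)).continuous
  have hC2 : ∀ {cs : ℝ} {c : Biot.Space → ℝ}, Biot.SpeedClass Ω x₀ m θ cs c →
      ∀ x ∈ Ω ∩ {x | P'.AgreeAt P x}, ContDiffAt ℝ 2 c x := fun h x hx =>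
    h.isC2.1.contDiffAt (hΩo.mem_nhds hx.1)
  obtain ⟨τs, hτs, C, hC, H⟩ := Biot.smooth_estimate hK' hφ hP'2
    (hΩo.inter (Biot.Coeffs.AgreeAt.isOpen P' P)) (fun z hz => ⟨hK'Ω z hz, hPP' z hz⟩)
    (fun x hx => by rw [hx.2.rho_eq]; exact (hP.rho_pos x (subset_closure hx.1)).ne')
    (hC2 h₂) (hC2 h₃) (fun x hx => (heig x (subset_closure hx.1)).1)
    (fun x hx => by
      obtain ⟨hne, ha, hb⟩ := heig x (subset_closure hx.1)
      rw [hx.2.A_eq]; exact (Biot.trace_det_of_hasEigenvalue hne ha hb).1)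
    (fun x hx => by
      obtain ⟨hne, ha, hb⟩ := heig x (subset_closure hx.1)
      rw [hx.2.A_eq]; exact (Biot.trace_det_of_hasEigenvalue hne ha hb).2)
    ((wave h₁ hl₁).congr fun z hz => (hPP' z hz).mu1_eq) (wave h₂ hl₂) (wave h₃ hl₃)
  exact ⟨τs, one_pos.trans_le hτs, C, hC, fun τ hτ us uf F₁ F₂ hsol hus huf =>
    Biot.cylinder_estimate hQo hK hK' hKK' (fun z hz => (hK'R hz).1) hP'2 hP'c hPP' hφ (H τ hτ)
      hsol hus huf⟩
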